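/- An \emph{oriented matroid} $\vec M=(E,\mathcal C)$ consists of a finite set $E$ and a collection $\mathcal C$ of \emph{signed circuits}, i.e. pairs $C=(C^+,C^-)$ of disjoint subsets of $E$ with support $\underline C=C^+\cup C^-$, such that (i) $(\emptyset,\emptyset)\notin\mathcal C$; (ii) if $(C^+,C^-)\in\mathcal C$ then $(C^-,C^+)\in\mathcal C$; (iii) if $C_1,C_2\in\mathcal C$ and $\underline{C_1}\subseteq\underline{C_2}$, then $C_1=(C_2^+,C_2^-)$ or $C_1=(C_2^-,C_2^+)$; (iv) if $C_1,C_2\in\mathcal C$, $C_1\neq(C_2^-,C_2^+)$ and $e\in C_1^+\cap C_2^-$, then there is $C\in\mathcal C$ with $C^+\subseteq(C_1^+\cup C_2^+)\setminus\{e\}$ and $C^-\subseteq(C_1^-\cup C_2^-)\setminus\{e\}$. The supports of the signed circuits are the circuits of the \emph{underlying matroid}. A signed circuit is \emph{directed} if $C^+=\emptyset$ or $C^-=\emptyset$. An isomorphism of oriented matroids is a bijection between the ground sets that maps the set of signed circuits onto the set of signed circuits. $\vec M$ is \emph{non-even} if its underlying matroid is regular (representable over every field) and there is a set $J\subseteq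 E$ such that $|\underline C\cap J|$ is odd for every directed signed circuit $C$. For $e\in E$, the deletion $\vec M-e$ has ground set $E\setminus\{e\}$ and as signed circuits those $C\in\mathcal C$ with $e\notin\underline C$. The contraction $\vec M/e$ has ground set $E\setminus\{e\}$ and as signed circuits the pairs $(C^+\setminus\{e\},C^-\setminus\{e\})$, $C\in\mathcal C$, for which $\underline C\setminus\{e\}$ is inclusion-minimal among the non-empty sets $\underline X\setminus\{e\}$, $X\in\mathcal C$. A \emph{signed cocircuit} of $\vec M$ is a pair $(S^+,S^-)$ of disjoint subsets of $E$ with inclusion-minimal non-empty union among the pairs satisfying, for all $C\in\mathcal C$, $$(S^+\cap C^+)\cup(S^-\cap C^-)\neq\emptyset\iff(S^+\cap C^-)\cup(S^-\cap C^+)\neq\emptyset .$$ An element $e$ is \emph{butterfly-contractible} if $(S\setminus\{e\},\{e\})$ is a signed cocircuit for some $S\ni e$. A \emph{$\mathsf{GB}$-minor} of $\vec M$ is any oriented matroid obtained from $\vec M$ by a finite (possibly empty) sequence of element deletions and contractions of butterfly-contractible elements, in arbitrary order. For a finite digraph $D$ (loops and multiple edges allowed), $M^*(D)$ is the oriented matroid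 on $E(D)$ whose signed circuits are the pairs $(S^+,S^-)$ and $(S^-,S^+)$ for the bonds (minimal non-empty edge cuts) $S=D[X,Y]$, where $S^+$ (resp. $S^-$) consists of the edges of $S$ directed from $X$ to $Y$ (resp. from $Y$ to $X$). An \emph{oriented bond matroid} is an oriented matroid isomorphic to $M^*(D)$ for some finite digraph $D$. For $m,n\ge1$, $\vec K_{m,n}$ is the complete bipartite graph $K_{m,n}$ with all edges oriented from the partition class of size $m$ to the class of size $n$. \textbf{Theorem.} An oriented bond matroid $\vec M$ is non-even if and only if none of its $\mathsf{GB}$-minors is isomorphic to $M^*(\vec K_{m,n})$ for any $m,n\ge2$ such that $m+n$ is odd. -/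

import Mathlib

universe u v w

/-! ## Oriented matroids -/

/-- An oriented matroid on a finite ground set `E`, given by its signed circuits.
A signed circuit is a pair `C` with positive part `C.1`, negative part `C.2` and support
`C.1 ∪ C.2`; the opposite signed set is `C.swap`. -/
structure OrientedMatroid (α : Type*) where
  E : Set α
  finite : E.Finite
  circuits : Set (Set α × Set α)
  subset_ground : ∀ C ∈ circuits, C.1 ∪ C.2 ⊆ E
  disjoint : ∀ C ∈ circuits, Disjoint C.1 C.2
  empty_notMem : (∅, ∅) ∉ circuits
  swap_mem : ∀ C ∈ circuits, C.swap ∈ circuits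
  eq_or_eq_swap : ∀ C₁ ∈ circuits, ∀ C₂ ∈ circuits,
    C₁.1 ∪ C₁.2 ⊆ C₂.1 ∪ C₂.2 → C₁ = C₂ ∨ C₁ = C₂.swap
  elim : ∀ C₁ ∈ circuits, ∀ C₂ ∈ circuits, C₁ ≠ C₂.swap → ∀ e ∈ C₁.1 ∩ C₂.2,
    ∃ C ∈ circuits, C.1 ⊆ (C₁.1 ∪ C₂.1) \ {e} ∧ C.2 ⊆ (C₁.2 ∪ C₂.2) \ {e}

namespace OrientedMatroid

variable {α : Type u} {β : Type v}

theorem support_eq (M : OrientedMatroid α) {C₁ C₂ : Set α × Set α} (h₁ : C₁ ∈ M.circuits)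
    (h₂ : C₂ ∈ M.circuits) (h : C₁.1 ∪ C₁.2 ⊆ C₂.1 ∪ C₂.2) : C₁.1 ∪ C₁.2 = C₂.1 ∪ C₂.2 := by
  rcases M.eq_or_eq_swap _ h₁ _ h₂ h with h | h
  · rw [h]
  · rw [h, Prod.fst_swap, Prod.snd_swap, Set.union_comm]

theorem support_nonempty (M : OrientedMatroid α) {C : Set α × Set α} (h : C ∈ M.circuits) :
    (C.1 ∪ C.2).Nonempty := by
  rw [Set.nonempty_iff_ne_empty]
  intro h0
  rw [Set.union_empty_iff] at h0
  apply M.empty_notMem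
  have : C = (∅, ∅) := Prod.ext h0.1 h0.2
  rwa [← this]

/-- Unsigned circuit elimination. -/
theorem support_elim (M : OrientedMatroid α) {C₁ C₂ : Set α × Set α} (h₁ : C₁ ∈ M.circuits)
    (h₂ : C₂ ∈ M.circuits) (hne : C₁.1 ∪ C₁.2 ≠ C₂.1 ∪ C₂.2) {e : α} (he₁ : e ∈ C₁.1 ∪ C₁.2)
    (he₂ : e ∈ C₂.1 ∪ C₂.2) :
    ∃ C ∈ M.circuits, C.1 ∪ C.2 ⊆ ((C₁.1 ∪ C₁.2) ∪ (C₂.1 ∪ C₂.2)) \ {e} := by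
  have key : ∀ D₁ ∈ M.circuits, ∀ D₂ ∈ M.circuits, D₁.1 ∪ D₁.2 = C₁.1 ∪ C₁.2 →
      D₂.1 ∪ D₂.2 = C₂.1 ∪ C₂.2 → e ∈ D₁.1 ∩ D₂.2 →
      ∃ C ∈ M.circuits, C.1 ∪ C.2 ⊆ ((C₁.1 ∪ C₁.2) ∪ (C₂.1 ∪ C₂.2)) \ {e} := by
    intro D₁ hD₁ D₂ hD₂ e₁ e₂ he
    obtain ⟨C, hC, hp, hn⟩ := M.elim D₁ hD₁ D₂ hD₂ (by
      rintro rfl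
      apply hne
      rw [← e₁, ← e₂, Prod.fst_swap, Prod.snd_swap, Set.union_comm]) e he
    refine ⟨C, hC, ?_⟩
    rw [← e₁, ← e₂]
    intro x hx
    rcases hx with hx | hx
    · have := hp hx
      simp only [Set.mem_sdiff, Set.mem_union] at this ⊢
      tauto
    · have := hn hx
      simp only [Set.mem_sdiff, Set.mem_union] at this ⊢
      tauto
  have s₁ := M.swap_mem _ h₁
  have s₂ := M.swap_mem _ h₂
  rcases he₁ with a | a <;> rcases he₂ with b | b
  · exact key C₁ h₁ _ s₂ rfl (Set.union_comm _ _) ⟨a, b⟩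
  · exact key C₁ h₁ C₂ h₂ rfl rfl ⟨a, b⟩
  · exact key _ s₁ _ s₂ (Set.union_comm _ _) (Set.union_comm _ _) ⟨a, b⟩
  · exact key _ s₁ C₂ h₂ (Set.union_comm _ _) rfl ⟨a, b⟩

/-- The underlying matroid: a set is independent if it contains no support of a signed circuit. -/
def underlying (M : OrientedMatroid α) : Matroid α :=
  (IndepMatroid.ofFinite (E := M.E) M.finite
    (fun I => I ⊆ M.E ∧ ∀ C ∈ M.circuits, ¬ C.1 ∪ C.2 ⊆ I)
    ⟨Set.empty_subset _, fun C hC h =>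
      (M.support_nonempty hC).ne_empty (Set.subset_empty_iff.1 h)⟩
    (fun I J hJ hIJ => ⟨hIJ.trans hJ.1, fun C hC h => hJ.2 C hC (h.trans hIJ)⟩)
    (by
      intro I J hI hJ hlt
      by_contra! hcon
      have hIf : I.Finite := M.finite.subset hI.1
      have hJf : J.Finite := M.finite.subset hJ.1
      let P : ℕ → Prop := fun k => ∃ K : Set α, K ⊆ I ∪ J ∧
        (∀ C ∈ M.circuits, ¬ C.1 ∪ C.2 ⊆ K) ∧ I.ncard < K.ncard ∧ (I \ K).ncard = k
      have hP : ∃ k, P k := ⟨_, J, Set.subset_union_right, hJ.2, hlt, rfl⟩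
      classical
      obtain ⟨K, hKs, hKi, hKc, hKk⟩ := Nat.find_spec hP
      have hmin := fun k => @Nat.find_min P _ hP k
      rw [← hKk] at hmin
      have hKf : K.Finite := (hIf.union hJf).subset hKs
      have hKE : K ⊆ M.E := hKs.trans (Set.union_subset hI.1 hJ.1)
      obtain ⟨g, hgK, hgI⟩ : ∃ g ∈ K, g ∉ I := by
        by_contra! h
        exact absurd (Set.ncard_le_ncard h hIf) (by omega)
      have hne : (I \ K).Nonempty := by
        rw [Set.nonempty_iff_ne_empty]
        intro h0
        have hIK : I ⊆ K := Set.sdiff_eq_empty.1 h0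
        have hgJ : g ∈ J := (hKs hgK).resolve_left hgI
        obtain ⟨C, hC, hCs⟩ := hcon g hgJ hgI (Set.insert_subset (hJ.1 hgJ) hI.1)
        exact hKi C hC (hCs.trans (Set.insert_subset hgK hIK))
      obtain ⟨e, heI, heK⟩ := hne
      have hT : ∀ f ∈ K, f ∉ I → ∃ C ∈ M.circuits, C.1 ∪ C.2 ⊆ insert e (K \ {f}) := by
        intro f hfK hfI
        by_contra! h
        refine hmin (I \ insert e (K \ {f})).ncard ?_ ⟨insert e (K \ {f}), ?_, h, ?_, rfl⟩
        · apply Set.ncard_lt_ncard _ hIf.sdiff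
          refine ⟨fun x hx => ⟨hx.1, fun hxK => hx.2 (Or.inr ⟨hxK, ?_⟩)⟩, fun hs => ?_⟩
          · rintro rfl
            exact hfI hx.1
          · exact (hs ⟨heI, heK⟩).2 (Or.inl rfl)
        · exact Set.insert_subset (Or.inl heI) (Set.sdiff_subset.trans hKs)
        · rw [Set.ncard_insert_of_notMem (fun h => heK h.1) hKf.sdiff,
            Set.ncard_sdiff_singleton_add_one hfK hKf]
          exact hKc
      obtain ⟨C, hC, hCs⟩ := hT g hgK hgI
      obtain ⟨h, hhC, hhI⟩ : ∃ h ∈ C.1 ∪ C.2, h ∉ I := by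
        by_contra! h
        exact hI.2 C hC h
      have hhK : h ∈ K := by
        rcases hCs hhC with rfl | h'
        · exact absurd heI hhI
        · exact h'.1
      obtain ⟨D, hD, hDs⟩ := hT h hhK hhI
      have hhD : h ∉ D.1 ∪ D.2 := by
        intro h'
        rcases hDs h' with rfl | h''
        · exact hhI heI
        · exact h''.2 rfl
      have heC : e ∈ C.1 ∪ C.2 := by
        by_contra h'
        refine hKi C hC fun x hx => ?_
        rcases hCs hx with rfl | hx'
        · exact absurd hx h'
        · exact hx'.1
      have heD : e ∈ D.1 ∪ D.2 := by
        by_contra h'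
        refine hKi D hD fun x hx => ?_
        rcases hDs hx with rfl | hx'
        · exact absurd hx h'
        · exact hx'.1
      obtain ⟨Z, hZ, hZs⟩ := M.support_elim hC hD (fun heq => hhD (heq ▸ hhC)) heC heD
      refine hKi Z hZ fun x hx => ?_
      obtain ⟨hx1, hx2⟩ := hZs hx
      rcases hx1 with hx1 | hx1
      · rcases hCs hx1 with rfl | h'
        · exact absurd rfl hx2
        · exact h'.1
      · rcases hDs hx1 with rfl | h'
        · exact absurd rfl hx2
        · exact h'.1)
    (fun I hI => hI.1)).matroid

@[simp] theorem underlying_E (M : OrientedMatroid α) : M.underlying.E = M.E := rfl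

theorem underlying_indep_iff (M : OrientedMatroid α) (I : Set α) :
    M.underlying.Indep I ↔ I ⊆ M.E ∧ ∀ C ∈ M.circuits, ¬ C.1 ∪ C.2 ⊆ I := Iff.rfl

/-- The circuits of the underlying matroid are the supports of the signed circuits. -/
theorem underlying_isCircuit_iff (M : OrientedMatroid α) (S : Set α) :
    M.underlying.IsCircuit S ↔ ∃ C ∈ M.circuits, C.1 ∪ C.2 = S := by
  have hdep : ∀ C ∈ M.circuits, M.underlying.Dep (C.1 ∪ C.2) := fun C hC =>
    ⟨fun h => h.2 C hC subset_rfl, M.subset_ground C hC⟩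
  have hex : ∀ T, M.underlying.Dep T → ∃ C ∈ M.circuits, C.1 ∪ C.2 ⊆ T := by
    intro T hT
    by_contra! h
    exact hT.1 ⟨hT.2, h⟩
  constructor
  · intro hS
    obtain ⟨C, hC, hCs⟩ := hex S hS.1
    exact ⟨C, hC, hCs.antisymm (hS.2 (hdep C hC) hCs)⟩
  · rintro ⟨C, hC, rfl⟩
    refine ⟨hdep C hC, fun T hT hTs => ?_⟩
    obtain ⟨D, hD, hDs⟩ := hex T hT
    have := M.support_eq hD hC (hDs.trans hTs)
    exact this ▸ hDs

/-- Isomorphism of oriented matroids. -/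
def IsIsomorphic (M : OrientedMatroid α) (N : OrientedMatroid β) : Prop :=
  ∃ σ : M.E ≃ N.E, ∀ P Q : Set M.E,
    (((fun x : M.E => (x : α)) '' P, (fun x : M.E => (x : α)) '' Q) ∈ M.circuits ↔
      ((fun x : M.E => (σ x : β)) '' P, (fun x : M.E => (σ x : β)) '' Q) ∈ N.circuits)

/-- The deletion `M - e`. -/
def delete (M : OrientedMatroid α) (e : α) : OrientedMatroid α where
  E := M.E \ {e}
  finite := M.finite.sdiff
  circuits := {C | C ∈ M.circuits ∧ e ∉ C.1 ∪ C.2}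
  subset_ground C hC x hx := ⟨M.subset_ground C hC.1 hx, by
    rintro rfl
    exact hC.2 hx⟩
  disjoint C hC := M.disjoint C hC.1
  empty_notMem h := M.empty_notMem h.1
  swap_mem C hC := ⟨M.swap_mem C hC.1, fun h => hC.2 (Or.symm h)⟩
  eq_or_eq_swap C₁ h₁ C₂ h₂ h := M.eq_or_eq_swap C₁ h₁.1 C₂ h₂.1 h
  elim C₁ h₁ C₂ h₂ hne f hf := by
    obtain ⟨C, hC, hp, hn⟩ := M.elim C₁ h₁.1 C₂ h₂.1 hne f hf
    refine ⟨C, ⟨hC, ?_⟩, hp, hn⟩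
    have a := h₁.2
    have b := h₂.2
    rintro (h | h)
    · have := hp h
      simp only [Set.mem_sdiff, Set.mem_union] at this a b
      tauto
    · have := hn h
      simp only [Set.mem_sdiff, Set.mem_union] at this a b
      tauto

/-- The signed circuits of the contraction `M / e`: the signed sets `C \ {e}` for signed circuits
`C` such that the support of `C \ {e}` is non-empty and inclusion-minimal among the non-empty sets
of this form. -/
def contractCircuits (M : OrientedMatroid α) (e : α) : Set (Set α × Set α) :=
  {Z | ∃ C ∈ M.circuits, Z = (C.1 \ {e}, C.2 \ {e}) ∧ ((C.1 ∪ C.2) \ {e}).Nonempty ∧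
    ∀ X ∈ M.circuits, ((X.1 ∪ X.2) \ {e}).Nonempty →
      ¬ (X.1 ∪ X.2) \ {e} ⊂ (C.1 ∪ C.2) \ {e}}

theorem exists_contractCircuit (M : OrientedMatroid α) (e : α) {C : Set α × Set α}
    (hC : C ∈ M.circuits) (hne : ((C.1 ∪ C.2) \ {e}).Nonempty) :
    ∃ Z ∈ M.contractCircuits e, Z.1 ⊆ C.1 \ {e} ∧ Z.2 ⊆ C.2 \ {e} := by
  -- A signed circuit through `e` whose restriction is non-empty is minimal.
  have hmem : ∀ X ∈ M.circuits, e ∈ X.1 ∪ X.2 → ((X.1 ∪ X.2) \ {e}).Nonempty →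
      (X.1 \ {e}, X.2 \ {e}) ∈ M.contractCircuits e := by
    intro X hX heX hXne
    refine ⟨X, hX, rfl, hXne, fun Y hY _ hlt => ?_⟩
    have hsub : Y.1 ∪ Y.2 ⊆ X.1 ∪ X.2 := by
      intro x hx
      by_cases hxe : x = e
      · exact hxe ▸ heX
      · exact (hlt.1 ⟨hx, hxe⟩).1
    have := M.support_eq hY hX hsub
    rw [this] at hlt
    exact hlt.2 subset_rfl
  by_cases heC : e ∈ C.1 ∪ C.2
  · exact ⟨_, hmem C hC heC hne, subset_rfl, subset_rfl⟩
  by_cases hCmin : (C.1 \ {e}, C.2 \ {e}) ∈ M.contractCircuits e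
  · exact ⟨_, hCmin, subset_rfl, subset_rfl⟩
  have hCfin : (C.1 ∪ C.2).Finite := M.finite.subset (M.subset_ground C hC)
  -- Reduce the number of sign conflicts with `C` by elimination.
  have key : ∀ n : ℕ, ∀ X ∈ M.circuits, e ∈ X.1 ∪ X.2 → ((X.1 ∪ X.2) \ {e}).Nonempty →
      (X.1 ∪ X.2) \ {e} ⊆ C.1 ∪ C.2 → ((X.1 ∩ C.2) ∪ (X.2 ∩ C.1)).ncard = n →
      ∃ Y ∈ M.circuits, e ∈ Y.1 ∪ Y.2 ∧ ((Y.1 ∪ Y.2) \ {e}).Nonempty ∧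
        (Y.1 ∪ Y.2) \ {e} ⊆ C.1 ∪ C.2 ∧ (Y.1 ∩ C.2) ∪ (Y.2 ∩ C.1) = ∅ := by
    intro n
    induction n using Nat.strong_induction_on with
    | _ n ih =>
    intro X hX heX hXne hXs hn
    by_cases hempty : (X.1 ∩ C.2) ∪ (X.2 ∩ C.1) = ∅
    · exact ⟨X, hX, heX, hXne, hXs, hempty⟩
    obtain ⟨g, hg⟩ := Set.nonempty_iff_ne_empty.2 hempty
    have hneXC : X ≠ C.swap := by
      rintro rfl
      exact heC (Or.symm heX)
    have hneCX : C ≠ X.swap := by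
      rintro rfl
      exact heC (Or.symm heX)
    obtain ⟨Y, hY, hp, hq⟩ : ∃ Y ∈ M.circuits, Y.1 ⊆ (X.1 ∪ C.1) \ {g} ∧
        Y.2 ⊆ (X.2 ∪ C.2) \ {g} := by
      rcases hg with hg | hg
      · exact M.elim X hX C hC hneXC g hg
      · obtain ⟨Y, hY, a, b⟩ := M.elim C hC X hX hneCX g hg.symm
        exact ⟨Y, hY, Set.union_comm X.1 C.1 ▸ a, Set.union_comm X.2 C.2 ▸ b⟩
    have hgC : g ∈ C.1 ∪ C.2 := by
      rcases hg with hg | hg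
      · exact Or.inr hg.2
      · exact Or.inl hg.2
    have hgY : g ∉ Y.1 ∪ Y.2 := by
      rintro (h | h)
      · exact (hp h).2 rfl
      · exact (hq h).2 rfl
    have hYs : (Y.1 ∪ Y.2) \ {e} ⊆ C.1 ∪ C.2 := by
      rintro x ⟨hx | hx, hxe⟩
      · rcases (hp hx).1 with h | h
        · exact hXs ⟨Or.inl h, hxe⟩
        · exact Or.inl h
      · rcases (hq hx).1 with h | h
        · exact hXs ⟨Or.inr h, hxe⟩
        · exact Or.inr h
    have heY : e ∈ Y.1 ∪ Y.2 := by
      by_contra heY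
      have hsub : Y.1 ∪ Y.2 ⊆ C.1 ∪ C.2 := fun x hx => hYs ⟨hx, by
        rintro rfl
        exact heY hx⟩
      exact hgY (M.support_eq hY hC hsub ▸ hgC)
    have hYne : ((Y.1 ∪ Y.2) \ {e}).Nonempty := by
      by_contra h0
      rw [Set.not_nonempty_iff_eq_empty, Set.sdiff_eq_empty] at h0
      have hYX : Y.1 ∪ Y.2 ⊆ X.1 ∪ X.2 := h0.trans (Set.singleton_subset_iff.2 heX)
      have := M.support_eq hY hX hYX
      rw [← this, Set.sdiff_eq_empty.2 h0] at hXne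
      exact Set.not_nonempty_empty hXne
    refine ih _ ?_ Y hY heY hYne hYs rfl
    rw [← hn]
    have hfin : ((X.1 ∩ C.2) ∪ (X.2 ∩ C.1)).Finite := by
      apply hCfin.subset
      rintro x (hx | hx)
      · exact Or.inr hx.2
      · exact Or.inl hx.2
    apply Set.ncard_lt_ncard _ hfin
    have hCd := Set.disjoint_left.1 (M.disjoint C hC)
    refine ⟨?_, fun hs => ?_⟩
    · rintro x (⟨hx, hxC⟩ | ⟨hx, hxC⟩)
      · rcases (hp hx).1 with h | h
        · exact Or.inl ⟨h, hxC⟩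
        · exact absurd hxC (hCd h)
      · rcases (hq hx).1 with h | h
        · exact Or.inr ⟨h, hxC⟩
        · exact absurd h (hCd hxC)
    · rcases hs hg with h | h
      · exact hgY (Or.inl h.1)
      · exact hgY (Or.inr h.1)
  obtain ⟨X, hX, hXne, hlt⟩ : ∃ X ∈ M.circuits, ((X.1 ∪ X.2) \ {e}).Nonempty ∧
      (X.1 ∪ X.2) \ {e} ⊂ (C.1 ∪ C.2) \ {e} := by
    by_contra! h
    exact hCmin ⟨C, hC, rfl, hne, fun X hX hX' => h X hX hX'⟩
  have heX : e ∈ X.1 ∪ X.2 := by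
    by_contra heX
    have hsub : X.1 ∪ X.2 ⊆ C.1 ∪ C.2 := fun x hx => (hlt.1 ⟨hx, by
      rintro rfl
      exact heX hx⟩).1
    have := M.support_eq hX hC hsub
    rw [this] at hlt
    exact hlt.2 subset_rfl
  obtain ⟨Y, hY, heY, hYne, hYs, hY0⟩ := key _ X hX heX hXne
    (hlt.1.trans Set.sdiff_subset) rfl
  refine ⟨_, hmem Y hY heY hYne, ?_, ?_⟩
  · rintro x ⟨hx, hxe⟩
    refine ⟨(hYs ⟨Or.inl hx, hxe⟩).resolve_right fun h => ?_, hxe⟩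
    exact Set.notMem_empty x (hY0 ▸ Or.inl ⟨hx, h⟩)
  · rintro x ⟨hx, hxe⟩
    refine ⟨(hYs ⟨Or.inr hx, hxe⟩).resolve_left fun h => ?_, hxe⟩
    exact Set.notMem_empty x (hY0 ▸ Or.inr ⟨hx, h⟩)

/-- The contraction `M / e`. -/
def contract (M : OrientedMatroid α) (e : α) : OrientedMatroid α where
  E := M.E \ {e}
  finite := M.finite.sdiff
  circuits := M.contractCircuits e
  subset_ground := by
    rintro _ ⟨C, hC, rfl, -, -⟩
    rw [← Set.union_sdiff_distrib]
    exact Set.sdiff_subset_sdiff_left (M.subset_ground C hC)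
  disjoint := by
    rintro _ ⟨C, hC, rfl, -, -⟩
    exact (M.disjoint C hC).mono Set.sdiff_subset Set.sdiff_subset
  empty_notMem := by
    rintro ⟨C, -, h, hne, -⟩
    rw [Set.union_sdiff_distrib] at hne
    simp only [Prod.mk.injEq] at h
    rw [← h.1, ← h.2] at hne
    simp at hne
  swap_mem := by
    rintro _ ⟨C, hC, rfl, hne, hmin⟩
    refine ⟨C.swap, M.swap_mem C hC, rfl, ?_, ?_⟩
    · rwa [Prod.fst_swap, Prod.snd_swap, Set.union_comm]
    · rwa [Prod.fst_swap, Prod.snd_swap, Set.union_comm C.2 C.1]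
  eq_or_eq_swap := by
    rintro _ ⟨C₁, h₁, rfl, hne₁, -⟩ _ ⟨C₂, h₂, rfl, -, hmin₂⟩ hsub
    simp only [← Set.union_sdiff_distrib] at hsub
    have heq : (C₁.1 ∪ C₁.2) \ {e} = (C₂.1 ∪ C₂.2) \ {e} := by
      by_contra hne
      exact hmin₂ C₁ h₁ hne₁ (hsub.ssubset_of_ne hne)
    have hle : ∀ D₁ ∈ M.circuits, ∀ D₂ ∈ M.circuits,
        (D₁.1 ∪ D₁.2) \ {e} = (D₂.1 ∪ D₂.2) \ {e} → (e ∈ D₁.1 ∪ D₁.2 → e ∈ D₂.1 ∪ D₂.2) →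
        D₁ = D₂ ∨ D₁ = D₂.swap := by
      intro D₁ hD₁ D₂ hD₂ heq he
      refine M.eq_or_eq_swap D₁ hD₁ D₂ hD₂ fun x hx => ?_
      by_cases hxe : x = e
      · subst hxe
        exact he hx
      · exact (heq.subset ⟨hx, hxe⟩).1
    by_cases he : e ∈ C₁.1 ∪ C₁.2 → e ∈ C₂.1 ∪ C₂.2
    · rcases hle C₁ h₁ C₂ h₂ heq he with rfl | rfl
      · exact Or.inl rfl
      · exact Or.inr rfl
    · push Not at he
      rcases hle C₂ h₂ C₁ h₁ heq.symm (fun _ => he.1) with rfl | rfl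
      · exact Or.inl rfl
      · exact Or.inr rfl
  elim := by
    rintro _ ⟨C₁, h₁, rfl, hne₁, -⟩ _ ⟨C₂, h₂, rfl, hne₂, -⟩ hne f ⟨hf₁, hf₂⟩
    obtain ⟨C, hC, hp, hn⟩ := M.elim C₁ h₁ C₂ h₂ (by
      rintro rfl
      exact hne rfl) f ⟨hf₁.1, hf₂.1⟩
    have hCne : ((C.1 ∪ C.2) \ {e}).Nonempty := by
      by_contra h0
      rw [Set.not_nonempty_iff_eq_empty] at h0
      have hCe : C.1 ∪ C.2 ⊆ {e} := Set.sdiff_eq_empty.1 h0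
      have heC : e ∈ C.1 ∪ C.2 := by
        obtain ⟨x, hx⟩ := M.support_nonempty hC
        have : x = e := hCe hx
        exact this ▸ hx
      have hor : e ∈ C₁.1 ∪ C₁.2 ∨ e ∈ C₂.1 ∪ C₂.2 := by
        rcases heC with h | h
        · have := (hp h).1
          simp only [Set.mem_union] at this ⊢
          tauto
        · have := (hn h).1
          simp only [Set.mem_union] at this ⊢
          tauto
      rcases hor with h | h
      · rw [← M.support_eq hC h₁ (hCe.trans (Set.singleton_subset_iff.2 h)), h0] at hne₁
        exact Set.not_nonempty_empty hne₁
      · rw [← M.support_eq hC h₂ (hCe.trans (Set.singleton_subset_iff.2 h)), h0] at hne₂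
        exact Set.not_nonempty_empty hne₂
    obtain ⟨Z, hZ, hZp, hZn⟩ := M.exists_contractCircuit e hC hCne
    refine ⟨Z, hZ, fun x hx => ?_, fun x hx => ?_⟩
    · have a := hZp hx
      have b := hp a.1
      simp only [Set.mem_sdiff, Set.mem_union] at a b ⊢
      tauto
    · have a := hZn hx
      have b := hn a.1
      simp only [Set.mem_sdiff, Set.mem_union] at a b ⊢
      tauto

/-- `S` is a signed subset of the ground set that is orthogonal to every signed circuit. -/
def IsOrthogonal (M : OrientedMatroid α) (S : Set α × Set α) : Prop :=
  S.1 ∪ S.2 ⊆ M.E ∧ Disjoint S.1 S.2 ∧ ∀ C ∈ M.circuits,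
    (((S.1 ∩ C.1) ∪ (S.2 ∩ C.2)).Nonempty ↔ ((S.1 ∩ C.2) ∪ (S.2 ∩ C.1)).Nonempty)

/-- The signed cocircuits: the orthogonal signed sets of inclusion-minimal non-empty support. -/
def IsSignedCocircuit (M : OrientedMatroid α) (S : Set α × Set α) : Prop :=
  M.IsOrthogonal S ∧ (S.1 ∪ S.2).Nonempty ∧
    ∀ T, M.IsOrthogonal T → (T.1 ∪ T.2).Nonempty → ¬ T.1 ∪ T.2 ⊂ S.1 ∪ S.2

/-- `e` is butterfly-contractible: it is the only negative element of some signed cocircuit. -/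
def IsButterflyContractible (M : OrientedMatroid α) (e : α) : Prop :=
  ∃ S : Set α, e ∈ S ∧ M.IsSignedCocircuit (S \ {e}, {e})

/-- `N` arises from `M` by one deletion or by contracting one butterfly-contractible element. -/
def GBStep (M N : OrientedMatroid α) : Prop :=
  ∃ e ∈ M.E, N = M.delete e ∨ (M.IsButterflyContractible e ∧ N = M.contract e)

/-- `N` is a generalised butterfly minor of `M`. -/
def IsGBMinor (N M : OrientedMatroid α) : Prop :=
  Relation.ReflTransGen GBStep M N

/-- A signed circuit is directed if one of its two parts is empty. -/
def IsDirected (C : Set α × Set α) : Prop := C.1 = ∅ ∨ C.2 = ∅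

end OrientedMatroid

/-- A matroid is representable over `F` if it is given by linear independence of the columns
of a matrix over `F` that are indexed by the elements. -/
def Matroid.IsLinearOver {α : Type u} (M : Matroid α) (F : Type w) [Field F] : Prop :=
  ∃ (n : ℕ) (v : α → Fin n → F), ∀ I ⊆ M.E, M.Indep I ↔ LinearIndepOn F v I

/-- A matroid is regular if it is representable over every field. -/
def Matroid.IsRegular {α : Type u} (M : Matroid α) : Prop :=
  ∀ (F : Type w) [Field F], M.IsLinearOver F

/-- `M` is non-even: its underlying matroid is regular and some set of elements meets every
directed circuit in an odd number of elements. -/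
def OrientedMatroid.IsNonEven {α : Type u} (M : OrientedMatroid α) : Prop :=
  Matroid.IsRegular.{u, w} M.underlying ∧
    ∃ J ⊆ M.E, ∀ C ∈ M.circuits, OrientedMatroid.IsDirected C → Odd ((C.1 ∪ C.2) ∩ J).ncard

/-! ## Digraphs and their oriented bond matroids -/

/-- A digraph with vertex type `V` and edge type `E`; loops and multiple edges are allowed. -/
structure MultiDigraph (V E : Type*) where
  tail : E → V
  head : E → V

namespace MultiDigraph

variable {V E : Type*}

/-- The edges leaving `X` (first component) and entering `X` (second component). -/
def signedCut (D : MultiDigraph V E) (X : Set V) : Set E × Set E :=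
  ({e | D.tail e ∈ X ∧ D.head e ∉ X}, {e | D.tail e ∉ X ∧ D.head e ∈ X})

/-- The set `D[X, Xᶜ]` of edges with one end in `X` and the other outside `X`. -/
def cut (D : MultiDigraph V E) (X : Set V) : Set E :=
  (D.signedCut X).1 ∪ (D.signedCut X).2

/-- `X` induces a bond, that is, an inclusion-minimal non-empty cut. -/
def IsBondSide (D : MultiDigraph V E) (X : Set V) : Prop :=
  (D.cut X).Nonempty ∧ ∀ Y : Set V, (D.cut Y).Nonempty → ¬ D.cut Y ⊂ D.cut X

theorem signedCut_compl (D : MultiDigraph V E) (X : Set V) :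
    D.signedCut Xᶜ = (D.signedCut X).swap := by
  simp [signedCut]

theorem cut_compl (D : MultiDigraph V E) (X : Set V) : D.cut Xᶜ = D.cut X := by
  rw [cut, signedCut_compl, Prod.fst_swap, Prod.snd_swap, Set.union_comm, cut]

theorem mem_cut (D : MultiDigraph V E) (X : Set V) (e : E) :
    e ∈ D.cut X ↔ ¬ (D.tail e ∈ X ↔ D.head e ∈ X) := by
  simp only [cut, signedCut, Set.mem_union, Set.mem_ofPred_eq]
  tauto

/-- Every non-empty cut conformally contains a bond. -/
theorem exists_bondSide [Finite E] (D : MultiDigraph V E) : ∀ (n : ℕ) (W : Set V),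
    (D.cut W).ncard = n → (D.cut W).Nonempty → ∃ Y, D.IsBondSide Y ∧
      (D.signedCut Y).1 ⊆ (D.signedCut W).1 ∧ (D.signedCut Y).2 ⊆ (D.signedCut W).2 := by
  intro n
  induction n using Nat.strong_induction_on with
  | _ n ih =>
  intro W hn hW
  by_cases hb : D.IsBondSide W
  · exact ⟨W, hb, subset_rfl, subset_rfl⟩
  obtain ⟨Z, hZne, hZ⟩ : ∃ Z, (D.cut Z).Nonempty ∧ D.cut Z ⊂ D.cut W := by
    by_contra! h
    exact hb ⟨hW, h⟩
  have step : ∀ U : Set V, (D.signedCut U).1 ⊆ (D.signedCut W).1 →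
      (D.signedCut U).2 ⊆ (D.signedCut W).2 → (D.cut U).Nonempty →
      (∃ g ∈ D.cut W, g ∉ D.cut U) → ∃ Y, D.IsBondSide Y ∧
      (D.signedCut Y).1 ⊆ (D.signedCut W).1 ∧ (D.signedCut Y).2 ⊆ (D.signedCut W).2 := by
    rintro U hp hq hne ⟨g, hg, hgU⟩
    obtain ⟨Y, hY, a, b⟩ := ih (D.cut U).ncard (by
      rw [← hn]
      exact Set.ncard_lt_ncard ⟨Set.union_subset_union hp hq, fun h => hgU (h hg)⟩
        (Set.toFinite _)) U rfl hne
    exact ⟨Y, hY, a.trans hp, b.trans hq⟩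
  have hsub : ∀ x, ¬ (D.tail x ∈ Z ↔ D.head x ∈ Z) → ¬ (D.tail x ∈ W ↔ D.head x ∈ W) := by
    intro x hx
    exact (D.mem_cut W x).1 (hZ.1 ((D.mem_cut Z x).2 hx))
  obtain ⟨g, hg⟩ := hZne
  obtain ⟨k, hkW, hkZ⟩ := Set.exists_of_ssubset hZ
  have hgW := hZ.1 hg
  have hgW' := hgW
  have hkW' := hkW
  rw [mem_cut] at hg hgW hkW hkZ
  have hall : ∀ U : Set V, (U = W ∩ Z ∨ U = W \ Z ∨ U = W ∪ Z) →
      (D.signedCut U).1 ⊆ (D.signedCut W).1 ∧ (D.signedCut U).2 ⊆ (D.signedCut W).2 := by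
    intro U hU
    have hs : ∀ x, ((D.tail x ∈ U ∧ D.head x ∉ U) → (D.tail x ∈ W ∧ D.head x ∉ W)) ∧
        ((D.tail x ∉ U ∧ D.head x ∈ U) → (D.tail x ∉ W ∧ D.head x ∈ W)) := by
      intro x
      have hx := hsub x
      clear hg hgW hkW hkZ hgW' hkW' step ih hb hn hW hZ hsub
      by_cases h1 : D.tail x ∈ W <;> by_cases h2 : D.head x ∈ W <;>
      by_cases h3 : D.tail x ∈ Z <;> by_cases h4 : D.head x ∈ Z <;>
      rcases hU with rfl | rfl | rfl <;> simp_all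
    exact ⟨fun x => (hs x).1, fun x => (hs x).2⟩
  obtain ⟨U, hU, hsep⟩ : ∃ U : Set V, (U = W ∩ Z ∨ U = W \ Z ∨ U = W ∪ Z) ∧
      ((g ∈ D.cut U ∧ k ∉ D.cut U) ∨ (k ∈ D.cut U ∧ g ∉ D.cut U)) := by
    have pick : ∀ p q r s p' q' r' s' : Prop, ¬ (p ↔ p') → ¬ (q ↔ q') → ¬ (r ↔ r') → (s ↔ s') →
        (¬ (p ∧ q ↔ p' ∧ q') ∧ (r ∧ s ↔ r' ∧ s') ∨ ¬ (r ∧ s ↔ r' ∧ s') ∧ (p ∧ q ↔ p' ∧ q')) ∨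
        (¬ (p ∧ ¬ q ↔ p' ∧ ¬ q') ∧ (r ∧ ¬ s ↔ r' ∧ ¬ s') ∨
          ¬ (r ∧ ¬ s ↔ r' ∧ ¬ s') ∧ (p ∧ ¬ q ↔ p' ∧ ¬ q')) ∨
        (¬ (p ∨ q ↔ p' ∨ q') ∧ (r ∨ s ↔ r' ∨ s') ∨ ¬ (r ∨ s ↔ r' ∨ s') ∧ (p ∨ q ↔ p' ∨ q')) := by
      intro p q r s p' q' r' s' h1 h2 h3 h4
      by_cases p <;> by_cases q <;> by_cases r <;> by_cases s <;> simp_all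
    have := pick _ _ _ _ _ _ _ _ hgW hg hkW (not_not.1 hkZ)
    simp only [mem_cut, not_not]
    rcases this with h | h | h
    · exact ⟨W ∩ Z, Or.inl rfl, h⟩
    · exact ⟨W \ Z, Or.inr (Or.inl rfl), h⟩
    · exact ⟨W ∪ Z, Or.inr (Or.inr rfl), h⟩
  obtain ⟨hp, hq⟩ := hall U hU
  rcases hsep with ⟨h1, h2⟩ | ⟨h1, h2⟩
  · exact step U hp hq ⟨g, h1⟩ ⟨k, hkW', h2⟩
  · exact step U hp hq ⟨k, h1⟩ ⟨g, hgW', h2⟩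

/-- The oriented bond matroid `M*(D)`: its signed circuits are the bonds of `D`, signed by the
direction in which an edge crosses the bond. The opposite of a signed bond is the signed bond of
the complementary side. -/
def bondMatroid [Finite E] (D : MultiDigraph V E) : OrientedMatroid E where
  E := Set.univ
  finite := Set.finite_univ
  circuits := {C | ∃ X : Set V, D.IsBondSide X ∧ C = D.signedCut X}
  subset_ground _ _ := Set.subset_univ _
  disjoint := by
    rintro _ ⟨X, -, rfl⟩
    exact Set.disjoint_left.2 fun x hx hx' => hx'.1 hx.1
  empty_notMem := by
    rintro ⟨X, hX, h⟩
    have := hX.1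
    rw [cut, ← h] at this
    simp at this
  swap_mem := by
    rintro _ ⟨X, hX, rfl⟩
    refine ⟨Xᶜ, ?_, (D.signedCut_compl X).symm⟩
    simpa only [IsBondSide, cut_compl] using hX
  eq_or_eq_swap := by
    rintro _ ⟨X, hX, rfl⟩ _ ⟨Y, hY, rfl⟩ hsub
    change D.cut X ⊆ D.cut Y at hsub
    have heq : D.cut X = D.cut Y := by
      by_contra hne
      exact hY.2 X hX.1 (hsub.ssubset_of_ne hne)
    have hmem : ∀ x, (D.tail x ∈ X ↔ D.head x ∈ X) ↔ (D.tail x ∈ Y ↔ D.head x ∈ Y) := by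
      intro x
      have : x ∈ D.cut X ↔ x ∈ D.cut Y := by rw [heq]
      rw [mem_cut, mem_cut] at this
      tauto
    have hI : D.cut (X ∩ Y) ⊆ D.cut X := by
      intro x hx
      have := hmem x
      simp only [mem_cut, Set.mem_inter_iff] at hx ⊢
      tauto
    by_cases hne : (D.cut (X ∩ Y)).Nonempty
    · left
      have h2 : D.cut X ⊆ D.cut (X ∩ Y) := by
        by_contra h
        exact hX.2 _ hne ⟨hI, h⟩
      have h3 : ∀ x, (D.tail x ∈ X ∧ D.head x ∉ X ↔ D.tail x ∈ Y ∧ D.head x ∉ Y) ∧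
          (D.tail x ∉ X ∧ D.head x ∈ X ↔ D.tail x ∉ Y ∧ D.head x ∈ Y) := by
        intro x
        have a := hmem x
        have b := @h2 x
        simp only [mem_cut, Set.mem_inter_iff] at b
        tauto
      exact Prod.ext (Set.ext fun x => (h3 x).1) (Set.ext fun x => (h3 x).2)
    · right
      rw [Set.not_nonempty_iff_eq_empty] at hne
      have h3 : ∀ x, (D.tail x ∈ X ∧ D.head x ∉ X ↔ D.tail x ∉ Y ∧ D.head x ∈ Y) ∧
          (D.tail x ∉ X ∧ D.head x ∈ X ↔ D.tail x ∈ Y ∧ D.head x ∉ Y) := by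
        intro x
        have a := hmem x
        have b : x ∉ D.cut (X ∩ Y) := by
          rw [hne]
          exact Set.notMem_empty x
        simp only [mem_cut, Set.mem_inter_iff] at b
        tauto
      exact Prod.ext (Set.ext fun x => (h3 x).1) (Set.ext fun x => (h3 x).2)
  elim := by
    rintro _ ⟨X, hX, rfl⟩ _ ⟨Y, hY, rfl⟩ hne e ⟨he1, he2⟩
    have fin : ∀ W : Set V, (D.cut W).Nonempty → (W = X ∪ Y ∨ W = X ∩ Y) →
        ∃ C ∈ {C | ∃ X : Set V, D.IsBondSide X ∧ C = D.signedCut X},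
          C.1 ⊆ ((D.signedCut X).1 ∪ (D.signedCut Y).1) \ {e} ∧
          C.2 ⊆ ((D.signedCut X).2 ∪ (D.signedCut Y).2) \ {e} := by
      intro W hW hWe
      obtain ⟨Z, hZ, hp, hq⟩ := D.exists_bondSide _ W rfl hW
      refine ⟨_, ⟨Z, hZ, rfl⟩, hp.trans ?_, hq.trans ?_⟩
      · intro x hx
        refine ⟨?_, ?_⟩
        · rcases hWe with rfl | rfl <;>
            simp only [signedCut, Set.mem_ofPred_eq, Set.mem_inter_iff, Set.mem_union] at hx ⊢ <;>
            tauto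
        · rintro rfl
          rcases hWe with rfl | rfl <;>
            simp only [signedCut, Set.mem_ofPred_eq, Set.mem_inter_iff, Set.mem_union]
              at hx he1 he2 <;> tauto
      · intro x hx
        refine ⟨?_, ?_⟩
        · rcases hWe with rfl | rfl <;>
            simp only [signedCut, Set.mem_ofPred_eq, Set.mem_inter_iff, Set.mem_union] at hx ⊢ <;>
            tauto
        · rintro rfl
          rcases hWe with rfl | rfl <;>
            simp only [signedCut, Set.mem_ofPred_eq, Set.mem_inter_iff, Set.mem_union]
              at hx he1 he2 <;> tauto
    by_cases h1 : (D.cut (X ∪ Y)).Nonempty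
    · exact fin _ h1 (Or.inl rfl)
    by_cases h2 : (D.cut (X ∩ Y)).Nonempty
    · exact fin _ h2 (Or.inr rfl)
    exfalso
    apply hne
    rw [Set.not_nonempty_iff_eq_empty] at h1 h2
    have h3 : ∀ x, (D.tail x ∈ X ∧ D.head x ∉ X ↔ D.tail x ∉ Y ∧ D.head x ∈ Y) ∧
        (D.tail x ∉ X ∧ D.head x ∈ X ↔ D.tail x ∈ Y ∧ D.head x ∉ Y) := by
      intro x
      have a : x ∉ D.cut (X ∪ Y) := by
        rw [h1]
        exact Set.notMem_empty x
      have b : x ∉ D.cut (X ∩ Y) := by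
        rw [h2]
        exact Set.notMem_empty x
      simp only [mem_cut, Set.mem_inter_iff, Set.mem_union] at a b
      tauto
    exact Prod.ext (Set.ext fun x => (h3 x).1) (Set.ext fun x => (h3 x).2)

/-- The complete bipartite digraph with all edges oriented from the part of size `m` to the part
of size `n`. -/
def completeBipartite (m n : ℕ) : MultiDigraph (Fin m ⊕ Fin n) (Fin m × Fin n) where
  tail e := Sum.inl e.1
  head e := Sum.inr e.2

end MultiDigraph

/-- An oriented bond matroid is an oriented matroid isomorphic to `M*(D)` for a finite
digraph `D` (every finite digraph has a copy whose vertex and edge types lie in `Type`). -/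
def OrientedMatroid.IsOrientedBondMatroid {α : Type u} (M : OrientedMatroid α) : Prop :=
  ∃ (V E : Type) (_ : Finite V) (_ : Finite E) (D : MultiDigraph V E),
    M.IsIsomorphic D.bondMatroid

/-! ### Parity of factorization lengths in monoids of nonnegative integer vectors -/

namespace AddSubmonoid

variable {α : Type*}

/-! Represent `M` by a digraph `D` with edge set `G = M.E`, and consider the monoid `D.cone G` of
nonnegative integer vectors on `G` that are potential differences. Its indecomposable elements are
the indicator vectors of the directed bonds (`isIndecomposable_cone_iff`), that is, of the directed
signed circuits. A set `J` meeting all of them oddly solves a linear system modulo two. If the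
system has no solution, an odd number of directed bonds sums to an even vector `y + y` with `y` in
the cone, and factoring `y` twice gives the same vector an even number of factors. So `J` exists
exactly when no vector is ambiguous, i.e. has factorizations of both parities
(`exists_odd_iff_forall_not_isAmbiguous`). Regularity is automatic (`Represents.isRegular`).

Deleting an element of `M` passes to a face of the cone (`Represents.delete`). Contracting a
butterfly-contractible element forgets a coordinate whose nonnegativity follows from the other ones,
which is an isomorphism of monoids (`IsRedundant.exists_isAmbiguous_iff`). Hence an ambiguity in a
minor gives one in `M`. For a complete bipartite digraph, the stars of either class partition the
edges, so `J` would have cardinality congruent to both `m` and `n`; this excludes odd `m + n`.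

Conversely, induct on the number of elements. One may assume that no ambiguous vector has a zero
coordinate and that there are neither parallel edges nor transitive triangles, since such
configurations allow a deletion or a contraction preserving ambiguity. Let `w` be minimal ambiguous.
Every proper `x ≤ w` in the cone has a split parity, the parity of the factorizations refining `w =
x + (w - x)`. Nonzero `x`, `y` with `x + y ≤ w` have equal split parity, yet both parities occur.
Comparing level cuts and vertex stars with an element of the other parity forces the structure. The
potential of `w` has at most two levels (`exists_two_levels`). If there are two, the middle level is
a pair of vertices to which all other ends are joined (`exists_middle_pair`); as triangles are
excluded, `w` is the all-ones vector, and a twist at the pair makes the tensions those of a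
bipartite graph (`exists_bipartite_labelling`). In the bipartite case, a missing edge would link all
row stars to all column stars, so the graph is complete; row and column stars have split parities
`m` and `n`, which must differ (`IsMinimalAmbiguous.bipartite`). -/

/-- `a` is a nonzero element of `K` that is not a sum of two nonzero elements of `K`. -/
def IsIndecomposable (K : AddSubmonoid (α → ℕ)) (a : α → ℕ) : Prop :=
  a ∈ K ∧ a ≠ 0 ∧ ∀ x ∈ K, ∀ y ∈ K, a = x + y → x = 0 ∨ y = 0

/-- `w` is a sum of indecomposable elements whose number has residue `ε` modulo two. -/
def HasLengthParity (K : AddSubmonoid (α → ℕ)) (w : α → ℕ) (ε : ZMod 2) : Prop :=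
  ∃ s : Multiset (α → ℕ), (∀ a ∈ s, K.IsIndecomposable a) ∧ s.sum = w ∧ (s.card : ZMod 2) = ε

/-- `w` has factorizations into indecomposable elements of both parities. -/
def IsAmbiguous (K : AddSubmonoid (α → ℕ)) (w : α → ℕ) : Prop :=
  K.HasLengthParity w 0 ∧ K.HasLengthParity w 1

/-- `K` is closed under truncation-free differences and all its elements are supported on `G`. -/
structure IsSaturatedOn (K : AddSubmonoid (α → ℕ)) (G : Set α) : Prop where
  finite : G.Finite
  sub_mem : ∀ x ∈ K, ∀ y ∈ K, x ≤ y → y - x ∈ K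
  eq_zero : ∀ x ∈ K, ∀ e ∉ G, x e = 0

variable {K : AddSubmonoid (α → ℕ)} {G : Set α} {w x y : α → ℕ} {ε δ : ZMod 2}

theorem HasLengthParity.mem (h : K.HasLengthParity w ε) : w ∈ K := by
  obtain ⟨s, hs, rfl, -⟩ := h
  exact K.multiset_sum_mem s fun a ha => (hs a ha).1

theorem HasLengthParity.add (h : K.HasLengthParity x ε) (h' : K.HasLengthParity y δ) :
    K.HasLengthParity (x + y) (ε + δ) := by
  obtain ⟨s, hs, rfl, rfl⟩ := h
  obtain ⟨t, ht, rfl, rfl⟩ := h'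
  refine ⟨s + t, fun a ha => ?_, by simp, by simp⟩
  rcases Multiset.mem_add.1 ha with h | h
  exacts [hs a h, ht a h]

theorem IsIndecomposable.hasLengthParity (h : K.IsIndecomposable x) : K.HasLengthParity x 1 :=
  ⟨{x}, by simpa using h, by simp, by simp⟩

theorem hasLengthParity_zero : K.HasLengthParity 0 0 := ⟨0, by simp, by simp, by simp⟩

theorem HasLengthParity.sum {ι : Type*} (s : Finset ι) (f : ι → α → ℕ)
    (h : ∀ i ∈ s, K.HasLengthParity (f i) 1) : K.HasLengthParity (∑ i ∈ s, f i) s.card := by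
  classical
  induction s using Finset.induction_on with
  | empty => simpa using hasLengthParity_zero
  | insert a s ha ih =>
    rw [Finset.sum_insert ha, Finset.card_insert_of_notMem ha, Nat.cast_succ,
      add_comm (s.card : ZMod 2)]
    exact (h a (by simp)).add (ih fun i hi => h i (by simp [hi]))

namespace IsSaturatedOn

/-- The total weight on `G` is the measure for the inductions below. -/
theorem sum_lt (hK : K.IsSaturatedOn G) (hx : x ∈ K) (hy : y ∈ K) (hle : x ≤ y) (hne : x ≠ y) :
    ∑ e ∈ hK.finite.toFinset, x e < ∑ e ∈ hK.finite.toFinset, y e := by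
  refine Finset.sum_lt_sum (fun e _ => hle e) ?_
  by_contra! h
  refine hne (funext fun e => ?_)
  by_cases he : e ∈ G
  · exact (hle e).antisymm (h e (by simpa using he))
  · rw [hK.eq_zero x hx e he, hK.eq_zero y hy e he]

theorem exists_hasLengthParity (hK : K.IsSaturatedOn G) (hx : x ∈ K) :
    ∃ ε, K.HasLengthParity x ε := by
  induction hn : ∑ e ∈ hK.finite.toFinset, x e using Nat.strong_induction_on generalizing x with
  | _ n ih =>
  subst hn
  by_cases h0 : x = 0
  · exact ⟨0, h0 ▸ hasLengthParity_zero⟩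
  by_cases hi : K.IsIndecomposable x
  · exact ⟨1, hi.hasLengthParity⟩
  obtain ⟨y, hy, z, hz, rfl, hy0, hz0⟩ :
      ∃ y ∈ K, ∃ z ∈ K, x = y + z ∧ y ≠ 0 ∧ z ≠ 0 := by
    by_contra! h
    refine hi ⟨hx, h0, fun y hy z hz hyz => ?_⟩
    by_cases hy0 : y = 0
    · exact Or.inl hy0
    · exact Or.inr (h y hy z hz hyz hy0)
  obtain ⟨ε, hε⟩ := ih _ (hK.sum_lt hy hx le_self_add (by simpa using hz0)) hy rfl
  obtain ⟨δ, hδ⟩ := ih _ (hK.sum_lt hz hx le_add_self (by simpa using hy0)) hz rfl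
  exact ⟨_, hε.add hδ⟩

/-- Some factorization of `y` can be appended to both factorizations of `x`. Ambiguity thus passes
from a summand to the sum, and all summands of a non-ambiguous vector have a well-defined parity. -/
theorem isAmbiguous_add (hK : K.IsSaturatedOn G) (hx : K.IsAmbiguous x) (hy : y ∈ K) :
    K.IsAmbiguous (x + y) := by
  obtain ⟨ε, hε⟩ := hK.exists_hasLengthParity hy
  have key : ∀ δ, K.HasLengthParity x δ := by
    intro δ
    fin_cases δ
    exacts [hx.1, hx.2]
  refine ⟨?_, ?_⟩
  · exact neg_add_cancel ε ▸ (key (-ε)).add hε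
  · simpa using (key (1 - ε)).add hε

end IsSaturatedOn

open Classical in
/-- The common parity of the factorizations of an element that is not ambiguous. -/
noncomputable def lengthParity (K : AddSubmonoid (α → ℕ)) (x : α → ℕ) : ZMod 2 :=
  if K.HasLengthParity x 1 then 1 else 0

theorem HasLengthParity.lengthParity_eq (h : K.HasLengthParity x ε) (hx : ¬ K.IsAmbiguous x) :
    K.lengthParity x = ε := by
  unfold lengthParity
  split_ifs with h1
  · fin_cases ε
    · exact absurd ⟨h, h1⟩ hx
    · rfl
  · fin_cases ε
    · rfl
    · exact absurd h h1

namespace IsSaturatedOn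

theorem lengthParity_add (hK : K.IsSaturatedOn G) (hx : x ∈ K) (hy : y ∈ K)
    (h : ¬ K.IsAmbiguous (x + y)) :
    K.lengthParity (x + y) = K.lengthParity x + K.lengthParity y := by
  obtain ⟨ε, hε⟩ := hK.exists_hasLengthParity hx
  obtain ⟨δ, hδ⟩ := hK.exists_hasLengthParity hy
  rw [(hε.add hδ).lengthParity_eq h,
    hε.lengthParity_eq fun h' => h (hK.isAmbiguous_add h' hy),
    hδ.lengthParity_eq fun h' => h (add_comm y x ▸ hK.isAmbiguous_add h' hx)]

end IsSaturatedOn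

/-! ### Minimal ambiguous elements and split parities -/

/-- `w` is ambiguous, but no smaller element of `K` is. -/
structure IsMinimalAmbiguous (K : AddSubmonoid (α → ℕ)) (w : α → ℕ) : Prop where
  isAmbiguous : K.IsAmbiguous w
  eq_of_le : ∀ x ≤ w, K.IsAmbiguous x → x = w

/-- The parity of the factorizations of `w` that refine `w = x + (w - x)`. -/
noncomputable def splitParity (K : AddSubmonoid (α → ℕ)) (w x : α → ℕ) : ZMod 2 :=
  K.lengthParity x + K.lengthParity (w - x)

theorem IsSaturatedOn.exists_isMinimalAmbiguous (hK : K.IsSaturatedOn G) (hw : K.IsAmbiguous w) :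
    ∃ w, K.IsMinimalAmbiguous w := by
  induction hn : ∑ e ∈ hK.finite.toFinset, w e using Nat.strong_induction_on generalizing w with
  | _ n ih =>
  subst hn
  by_cases h : ∃ x ≤ w, K.IsAmbiguous x ∧ x ≠ w
  · obtain ⟨x, hxw, hx, hne⟩ := h
    exact ih _ (hK.sum_lt hx.1.mem hw.1.mem hxw hne) hx rfl
  · push Not at h
    exact ⟨w, hw, h⟩

namespace IsMinimalAmbiguous

theorem mem (hw : K.IsMinimalAmbiguous w) : w ∈ K := hw.isAmbiguous.1.mem

theorem not_isAmbiguous (hw : K.IsMinimalAmbiguous w) (hx : x ≤ w) (hne : x ≠ w) :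
    ¬ K.IsAmbiguous x := fun h => hne (hw.eq_of_le x hx h)

theorem splitParity_sub (hx : x ≤ w) : K.splitParity w (w - x) = K.splitParity w x := by
  unfold splitParity
  rw [tsub_tsub_cancel_of_le hx, add_comm]

/-- Write `w = x + y + z`. Both `y + z` and `x + z` are proper, hence not ambiguous, so both split
parities equal the sum of the three parities of `x`, `y` and `z`. -/
theorem splitParity_eq_of_add_le (hw : K.IsMinimalAmbiguous w) (hK : K.IsSaturatedOn G)
    (hx : x ∈ K) (hy : y ∈ K) (hx0 : x ≠ 0) (hy0 : y ≠ 0) (h : x + y ≤ w) :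
    K.splitParity w x = K.splitParity w y := by
  obtain ⟨z, rfl⟩ := exists_add_of_le h
  have hz : z ∈ K := by
    have := hK.sub_mem _ (K.add_mem hx hy) _ hw.mem h
    rwa [add_tsub_cancel_left] at this
  have e1 : x + y + z - x = y + z := by rw [add_assoc, add_tsub_cancel_left]
  have e2 : x + y + z - y = x + z := by rw [add_assoc, add_left_comm, add_tsub_cancel_left]
  unfold splitParity
  rw [e1, e2, hK.lengthParity_add hy hz, hK.lengthParity_add hx hz]
  · ring
  · refine hw.not_isAmbiguous ?_ ?_
    · rw [add_assoc, add_left_comm]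
      exact le_add_self
    · intro h
      apply hy0
      rw [add_right_comm] at h
      simpa using h
  · refine hw.not_isAmbiguous ?_ ?_
    · rw [add_assoc]
      exact le_add_self
    · intro h
      apply hx0
      rw [add_assoc] at h
      simpa using h

/-- Split off one factor `a` of a factorization of `w` of parity `ε`: the remaining factors show
that `w = a + (w - a)` refines to parity `ε`. -/
theorem exists_splitParity_eq (hw : K.IsMinimalAmbiguous w) (ε : ZMod 2) :
    ∃ a, K.IsIndecomposable a ∧ a ≤ w ∧ a ≠ w ∧ K.splitParity w a = ε := by
  have cons : ∀ ε, K.HasLengthParity w ε → w ≠ 0 →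
      ∃ a z, K.IsIndecomposable a ∧ K.HasLengthParity z (ε - 1) ∧ w = a + z := by
    rintro ε ⟨s, hs, rfl, rfl⟩ h0
    obtain ⟨a, ha⟩ : ∃ a, a ∈ s := Multiset.exists_mem_of_ne_zero (by
      rintro rfl
      exact h0 rfl)
    obtain ⟨t, rfl⟩ := Multiset.exists_cons_of_mem ha
    exact ⟨a, t.sum, hs a ha, ⟨t, fun b hb => hs b (Multiset.mem_cons_of_mem hb), rfl, by simp⟩,
      by simp⟩
  have zero1 : ¬ K.HasLengthParity 0 1 := by
    rintro ⟨s, hs, h0, h1⟩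
    rcases Multiset.empty_or_exists_mem s with rfl | ⟨a, ha⟩
    · simp at h1
    · exact (hs a ha).2.1 (Multiset.sum_eq_zero_iff.1 h0 a ha)
  have hw0 : w ≠ 0 := by
    rintro rfl
    exact zero1 hw.isAmbiguous.2
  -- A factorization of even length of a nonzero element has at least two factors.
  have hwi : ¬ K.IsIndecomposable w := by
    intro hi
    obtain ⟨a, z, ha, hz, h⟩ := cons 0 hw.isAmbiguous.1 hw0
    rcases hi.2.2 a ha.1 z hz.mem h with h | h
    · exact ha.2.1 h
    · rw [h] at hz
      exact zero1 (by simpa using hz)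
  have hε : K.HasLengthParity w ε := by
    fin_cases ε
    exacts [hw.isAmbiguous.1, hw.isAmbiguous.2]
  obtain ⟨a, z, ha, hz, rfl⟩ := cons ε hε hw0
  have hne : a ≠ a + z := fun h => hwi (h ▸ ha)
  refine ⟨a, ha, le_self_add, hne, ?_⟩
  unfold splitParity
  rw [add_tsub_cancel_left, ha.hasLengthParity.lengthParity_eq
    (hw.not_isAmbiguous le_self_add hne), hz.lengthParity_eq (hw.not_isAmbiguous le_add_self ?_)]
  · ring
  · intro h
    exact ha.2.1 (by simpa using h)

end IsMinimalAmbiguous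

end AddSubmonoid

/-! ### The bipartite case -/

namespace AddSubmonoid

variable {α : Type*} {K : AddSubmonoid (α → ℕ)} {G : Set α}

open Classical in
/-- The indicator vector of a set. -/
noncomputable def vec (S : Set α) : α → ℕ := fun e => if e ∈ S then 1 else 0

theorem vec_apply_of_mem {S : Set α} {e : α} (h : e ∈ S) : vec S e = 1 := if_pos h

theorem vec_apply_of_notMem {S : Set α} {e : α} (h : e ∉ S) : vec S e = 0 := if_neg h

theorem vec_ne_zero {S : Set α} (h : S.Nonempty) : vec S ≠ 0 := by
  obtain ⟨e, he⟩ := h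
  intro h
  simpa [vec_apply_of_mem he] using congrFun h e

theorem vec_le_iff {S : Set α} {w : α → ℕ} : vec S ≤ w ↔ ∀ e ∈ S, 1 ≤ w e := by
  refine ⟨fun h e he => vec_apply_of_mem he ▸ h e, fun h e => ?_⟩
  by_cases he : e ∈ S
  · rw [vec_apply_of_mem he]
    exact h e he
  · rw [vec_apply_of_notMem he]
    exact Nat.zero_le _

theorem vec_inj {S T : Set α} (h : vec S = vec T) : S = T := by
  ext e
  have := congrFun h e
  by_cases h1 : e ∈ S <;> by_cases h2 : e ∈ T <;> simp_all [vec]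

theorem add_vec_le_vec {S : Set α} {x : α → ℕ} (hx : x ≤ vec G) (hS : S ⊆ G)
    (h : ∀ e ∈ S, x e = 0) : x + vec S ≤ vec G := by
  intro e
  rw [Pi.add_apply]
  by_cases he : e ∈ S
  · rw [h e he, vec_apply_of_mem he, vec_apply_of_mem (hS he)]
  · rw [vec_apply_of_notMem he]
    exact hx e

/-- Suppose that the all-ones vector is minimal ambiguous and that the elements of `K` are
differences of potentials along the edges of a bipartite graph, whose stars belong to `K`.
Then the graph is complete bipartite, and its numbers of vertices have the parities of
the obstructions. -/
theorem IsMinimalAmbiguous.bipartite {I : Type*} {i j : α → I}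
    (hw : K.IsMinimalAmbiguous (vec G)) (hK : K.IsSaturatedOn G)
    (hpot : ∀ x ∈ K, ∃ (a : I → ℤ) (b : I → ℤ), ∀ e ∈ G, (x e : ℤ) = a (i e) - b (j e))
    (hrow : ∀ r, vec {e ∈ G | i e = r} ∈ K) (hcol : ∀ c, vec {e ∈ G | j e = c} ∈ K) :
    (∀ e ∈ G, ∀ f ∈ G, ∃ g ∈ G, i g = i e ∧ j g = j f) ∧ 2 ≤ (i '' G).ncard ∧
      2 ≤ (j '' G).ncard ∧ Odd ((i '' G).ncard + (j '' G).ncard) := by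
  set row : I → α → ℕ := fun r => vec {e ∈ G | i e = r} with hrowdef
  set col : I → α → ℕ := fun c => vec {e ∈ G | j e = c} with hcoldef
  have row0 : ∀ e ∈ G, row (i e) ≠ 0 := fun e he => vec_ne_zero ⟨e, he, rfl⟩
  have col0 : ∀ e ∈ G, col (j e) ≠ 0 := fun e he => vec_ne_zero ⟨e, he, rfl⟩
  have rows : ∀ r r', r ≠ r' → row r + row r' ≤ vec G := by
    intro r r' h
    refine add_vec_le_vec (vec_le_iff.2 fun e he => (vec_apply_of_mem he.1).ge)
      (Set.sep_subset _ _) fun e he => vec_apply_of_notMem fun he' => ?_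
    exact h (he'.2.symm.trans he.2)
  have cols : ∀ r r', r ≠ r' → col r + col r' ≤ vec G := by
    intro r r' h
    refine add_vec_le_vec (vec_le_iff.2 fun e he => (vec_apply_of_mem he.1).ge)
      (Set.sep_subset _ _) fun e he => vec_apply_of_notMem fun he' => ?_
    exact h (he'.2.symm.trans he.2)
  have hrowcl : ∀ e ∈ G, ∀ f ∈ G,
      K.splitParity (vec G) (row (i e)) = K.splitParity (vec G) (row (i f)) := by
    intro e he f hf
    by_cases h : i e = i f
    · rw [h]
    · exact hw.splitParity_eq_of_add_le hK (hrow _) (hrow _) (row0 e he) (row0 f hf) (rows _ _ h)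
  have hcolcl : ∀ e ∈ G, ∀ f ∈ G,
      K.splitParity (vec G) (col (j e)) = K.splitParity (vec G) (col (j f)) := by
    intro e he f hf
    by_cases h : j e = j f
    · rw [h]
    · exact hw.splitParity_eq_of_add_le hK (hcol _) (hcol _) (col0 e he) (col0 f hf) (cols _ _ h)
  have hGne : G.Nonempty := by
    by_contra h
    rw [Set.not_nonempty_iff_eq_empty] at h
    obtain ⟨a, ha, hle, hne, -⟩ := hw.exists_splitParity_eq 0
    subst h
    have h0 : vec (∅ : Set α) = 0 := funext fun e => vec_apply_of_notMem (Set.notMem_empty e)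
    rw [h0] at hle
    exact ha.2.1 (le_antisymm hle fun e => Nat.zero_le _)
  -- The stars, as far as they are proper, do not all have the same split parity.
  have main : ∀ ε, ¬ ((∀ e ∈ G, row (i e) = vec G ∨ K.splitParity (vec G) (row (i e)) = ε) ∧
      ∀ e ∈ G, col (j e) = vec G ∨ K.splitParity (vec G) (col (j e)) = ε) := by
    rintro ε ⟨h1, h2⟩
    -- An element of the other split parity meets every star: a proper star disjoint from it could
    -- be added below the all-ones vector, forcing equal split parities, and a star that is all of
    -- `G` is met by any nonzero vector.
    have key : ∀ x ∈ K, x ≠ 0 → x ≤ vec G → K.splitParity (vec G) x = ε + 1 →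
        (∀ e ∈ G, ∃ f ∈ G, i f = i e ∧ x f = 1) ∧ (∀ e ∈ G, ∃ f ∈ G, j f = j e ∧ x f = 1) := by
      intro x hx hx0 hxle hxε
      have step : ∀ S : Set α, S ⊆ G → vec S ∈ K → S.Nonempty →
          (vec S = vec G ∨ K.splitParity (vec G) (vec S) = ε) → ∃ f ∈ S, x f = 1 := by
        intro S hS hSK hSne hor
        by_contra! hcon
        have h0 : ∀ e ∈ S, x e = 0 := by
          intro e he
          have h1 : x e ≤ vec G e := hxle e
          rw [vec_apply_of_mem (hS he)] at h1
          have h2 := hcon e he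
          omega
        rcases hor with h | h
        · refine hx0 (funext fun e => ?_)
          by_cases he : e ∈ G
          · exact h0 e (vec_inj h ▸ he)
          · exact hK.eq_zero x hx e he
        · have := hw.splitParity_eq_of_add_le hK hx hSK hx0 (vec_ne_zero hSne)
            (add_vec_le_vec hxle hS h0)
          rw [hxε, h] at this
          simp at this
      refine ⟨fun e he => ?_, fun e he => ?_⟩
      · obtain ⟨f, hf, hf'⟩ := step _ (Set.sep_subset _ _) (hrow (i e)) ⟨e, he, rfl⟩ (h1 e he)
        exact ⟨f, hf.1, hf.2, hf'⟩
      · obtain ⟨f, hf, hf'⟩ := step _ (Set.sep_subset _ _) (hcol (j e)) ⟨e, he, rfl⟩ (h2 e he)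
        exact ⟨f, hf.1, hf.2, hf'⟩
    obtain ⟨x, hx, hxle, hxne, hxε⟩ := hw.exists_splitParity_eq (ε + 1)
    obtain ⟨a, b, hab⟩ := hpot x hx.1
    have hyK := hK.sub_mem x hx.1 _ hw.mem hxle
    have k1 := (key x hx.1 hx.2.1 hxle hxε).1
    -- The complement of `x` has the same split parity, so it meets every star too.
    have k2 := (key _ hyK (fun h => hxne (le_antisymm hxle (tsub_eq_zero_iff_le.1 h)))
      tsub_le_self (by rw [IsMinimalAmbiguous.splitParity_sub hxle, hxε])).2
    -- In a row of minimal `a`, `x` has an edge `f`, so the column of `f` has `b` smaller by one.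
    -- The complement of `x` has an edge `g` in that column, and `x g = 0` forces the row of `g` to
    -- have smaller `a`, a contradiction.
    obtain ⟨e, he, hmin⟩ := hK.finite.exists_minimalFor (fun e => a (i e)) G hGne
    obtain ⟨f, hf, hfe, hxf⟩ := k1 e he
    obtain ⟨g, hg, hgf, hxg⟩ := k2 f hf
    rw [Pi.sub_apply, vec_apply_of_mem hg] at hxg
    have hxg0 : x g = 0 := by omega
    have e1 := hab f hf
    have e2 := hab g hg
    rw [hxf] at e1
    rw [hxg0, hgf] at e2
    rw [hfe] at e1
    push_cast at e1 e2
    have := hmin hg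
    simp only at this
    omega
  have complete : ∀ e ∈ G, ∀ f ∈ G, ∃ g ∈ G, i g = i e ∧ j g = j f := by
    intro e he f hf
    by_contra! hcon
    -- A row and a column without a common edge are compatible, which would link the parity of all
    -- rows with that of all columns.
    have hef : K.splitParity (vec G) (row (i e)) = K.splitParity (vec G) (col (j f)) := by
      refine hw.splitParity_eq_of_add_le hK (hrow _) (hcol _) (row0 e he) (col0 f hf) ?_
      refine add_vec_le_vec (vec_le_iff.2 fun e he => (vec_apply_of_mem he.1).ge)
        (Set.sep_subset _ _) fun g hg => vec_apply_of_notMem fun hg' => ?_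
      exact hcon g hg.1 hg'.2 hg.2
    exact main _ ⟨fun g hg => Or.inr (hrowcl g hg e he),
      fun g hg => Or.inr ((hcolcl g hg f hf).trans hef.symm)⟩
  have two : ∀ (k : α → I), (∃ e ∈ G, ∃ f ∈ G, k e ≠ k f) → 2 ≤ (k '' G).ncard := by
    rintro k ⟨e, he, f, hf, h⟩
    exact (Set.one_lt_ncard (hK.finite.image k)).2
      ⟨k e, Set.mem_image_of_mem k he, k f, Set.mem_image_of_mem k hf, h⟩
  obtain ⟨e₀, he₀⟩ := hGne
  have hi2 : ∃ e ∈ G, ∃ f ∈ G, i e ≠ i f := by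
    by_contra! h
    -- A single row is the whole all-ones vector; for such an improper star `main` asks nothing
    -- about its parity.
    refine main _ ⟨fun e he => Or.inl ?_, fun e he => Or.inr (hcolcl e he e₀ he₀)⟩
    exact congrArg vec (Set.ext fun f => ⟨fun hf => hf.1, fun hf => ⟨hf, h f hf e he⟩⟩)
  have hj2 : ∃ e ∈ G, ∃ f ∈ G, j e ≠ j f := by
    by_contra! h
    refine main _ ⟨fun e he => Or.inr (hrowcl e he e₀ he₀), fun e he => Or.inl ?_⟩
    exact congrArg vec (Set.ext fun f => ⟨fun hf => hf.1, fun hf => ⟨hf, h f hf e he⟩⟩)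
  refine ⟨complete, two i hi2, two j hj2, ?_⟩
  have other : ∀ (k : α → I), (∃ e ∈ G, ∃ f ∈ G, k e ≠ k f) → ∀ e ∈ G,
      ∃ f ∈ G, k f ≠ k e := by
    rintro k ⟨e, he, f, hf, h⟩ g hg
    by_contra! hcon
    exact h ((hcon e he).trans (hcon f hf).symm)
  -- If the elements of `K` supported in `S` are constant on `S`, one summand of `vec S` vanishes at
  -- a chosen point of `S`, hence everywhere.
  have indec : ∀ S : Set α, S ⊆ G → vec S ∈ K → S.Nonempty →
      (∀ x ∈ K, (∀ e ∉ S, x e = 0) → ∀ e ∈ S, ∀ f ∈ S, x e = x f) → K.IsIndecomposable (vec S) := by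
    intro S hSG hS hne h
    refine ⟨hS, vec_ne_zero hne, fun x hx y hy hxy => ?_⟩
    have hz : ∀ e ∉ S, x e = 0 ∧ y e = 0 := by
      intro e he
      have := congrFun hxy e
      rw [vec_apply_of_notMem he, Pi.add_apply] at this
      omega
    obtain ⟨e, he⟩ := hne
    have h1 := congrFun hxy e
    rw [vec_apply_of_mem he, Pi.add_apply] at h1
    have : x e = 0 ∨ y e = 0 := by omega
    rcases this with h0 | h0
    · refine Or.inl (funext fun f => ?_)
      by_cases hf : f ∈ S
      · rw [h x hx (fun e he => (hz e he).1) f hf e he, h0, Pi.zero_apply]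
      · exact (hz f hf).1
    · refine Or.inr (funext fun f => ?_)
      by_cases hf : f ∈ S
      · rw [h y hy (fun e he => (hz e he).2) f hf e he, h0, Pi.zero_apply]
      · exact (hz f hf).2
  have rowindec : ∀ e ∈ G, K.IsIndecomposable (row (i e)) := by
    intro e he
    refine indec _ (Set.sep_subset _ _) (hrow _) ⟨e, he, rfl⟩ fun x hx h0 f hf g hg => ?_
    obtain ⟨a, b, hab⟩ := hpot x hx
    obtain ⟨e', he', hne⟩ := other i hi2 e he
    -- By completeness the column of `f` has an edge in another row `i e'`, where `x` vanishes; this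
    -- determines the column potential independently of `f`.
    have col_eq : ∀ f ∈ G, i f = i e → (x f : ℤ) = a (i e) - a (i e') := by
      intro f hf hfe
      obtain ⟨g, hg, hge, hgf⟩ := complete e' he' f hf
      have h1 := hab f hf
      have h2 := hab g hg
      rw [h0 g fun hg' => hne (hge.symm.trans hg'.2)] at h2
      rw [hfe] at h1
      rw [hge, hgf] at h2
      push_cast at h2
      omega
    have h1 := col_eq f hf.1 hf.2
    have h2 := col_eq g hg.1 hg.2
    omega
  have colindec : ∀ e ∈ G, K.IsIndecomposable (col (j e)) := by
    intro e he
    refine indec _ (Set.sep_subset _ _) (hcol _) ⟨e, he, rfl⟩ fun x hx h0 f hf g hg => ?_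
    obtain ⟨a, b, hab⟩ := hpot x hx
    obtain ⟨e', he', hne⟩ := other j hj2 e he
    have row_eq : ∀ f ∈ G, j f = j e → (x f : ℤ) = b (j e') - b (j e) := by
      intro f hf hfe
      obtain ⟨g, hg, hgf, hge⟩ := complete f hf e' he'
      have h1 := hab f hf
      have h2 := hab g hg
      rw [h0 g fun hg' => hne (hge.symm.trans hg'.2)] at h2
      rw [hfe] at h1
      rw [hge, hgf] at h2
      push_cast at h2
      omega
    have h1 := row_eq f hf.1 hf.2
    have h2 := row_eq g hg.1 hg.2
    omega
  -- The remaining stars of the same class factor the complement of one star, so the refined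
  -- factorization uses every star of the class once.
  have count : ∀ (k : α → I), (∃ e ∈ G, ∃ f ∈ G, k e ≠ k f) →
      (∀ e ∈ G, K.IsIndecomposable (vec {f ∈ G | k f = k e})) →
      ∀ e ∈ G, K.splitParity (vec G) (vec {f ∈ G | k f = k e}) = ((k '' G).ncard : ZMod 2) := by
    classical
    intro k hk hind e he
    have hle : vec {f ∈ G | k f = k e} ≤ vec G :=
      vec_le_iff.2 fun e he => (vec_apply_of_mem he.1).ge
    obtain ⟨f, hf, hfe⟩ := other k hk e he
    have hfin := hK.finite.image k
    have hne1 : vec {f ∈ G | k f = k e} ≠ vec G := by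
      intro h
      have : f ∈ {f ∈ G | k f = k e} := (vec_inj h).symm.subset hf
      exact hfe this.2
    have hne0 := (hind e he).2.1
    have hsum : ∑ c ∈ hfin.toFinset.erase (k e), vec {f ∈ G | k f = c} =
        vec G - vec {f ∈ G | k f = k e} := by
      funext g
      rw [Finset.sum_apply, Pi.sub_apply]
      by_cases hg : g ∈ G
      · rw [vec_apply_of_mem hg]
        by_cases hge : k g = k e
        · rw [vec_apply_of_mem (S := {f ∈ G | k f = k e}) ⟨hg, hge⟩]
          refine Finset.sum_eq_zero fun c hc => vec_apply_of_notMem fun h => ?_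
          exact (Finset.mem_erase.1 hc).1 (h.2.symm.trans hge)
        · rw [vec_apply_of_notMem (S := {f ∈ G | k f = k e}) fun h => hge h.2]
          rw [Finset.sum_eq_single (k g), vec_apply_of_mem (S := {f ∈ G | k f = k g}) ⟨hg, rfl⟩]
          · exact fun c _ hc => vec_apply_of_notMem fun h => hc h.2.symm
          · intro h
            refine absurd (Finset.mem_erase.2 ⟨hge, ?_⟩) h
            simpa using ⟨g, hg, rfl⟩
      · rw [vec_apply_of_notMem hg, Nat.zero_sub]
        exact Finset.sum_eq_zero fun c _ => vec_apply_of_notMem fun h => hg h.1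
    have hlen : K.HasLengthParity (vec G - vec {f ∈ G | k f = k e})
        ((hfin.toFinset.erase (k e)).card : ZMod 2) := by
      rw [← hsum]
      refine HasLengthParity.sum _ _ fun c hc => ?_
      obtain ⟨g, hg, rfl⟩ := hfin.mem_toFinset.1 (Finset.mem_of_mem_erase hc)
      exact (hind g hg).hasLengthParity
    unfold splitParity
    rw [(hind e he).hasLengthParity.lengthParity_eq (hw.not_isAmbiguous hle hne1),
      hlen.lengthParity_eq (hw.not_isAmbiguous tsub_le_self ?_)]
    · rw [Set.ncard_eq_toFinset_card _ hfin, ← Finset.card_erase_add_one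
        (hfin.mem_toFinset.2 (Set.mem_image_of_mem k he))]
      push_cast
      ring
    · intro h
      apply hne0
      funext g
      have h1 := congrFun h g
      have h2 : vec _ g ≤ vec G g := hle g
      rw [Pi.sub_apply] at h1
      simp only [Pi.zero_apply]
      omega
  rw [← Nat.not_even_iff_odd]
  intro heven
  have hcast : ((i '' G).ncard : ZMod 2) = (j '' G).ncard := by
    rw [← CharTwo.add_eq_zero, ← Nat.cast_add]
    exact (ZMod.natCast_eq_zero_iff_even).2 heven
  exact main _ ⟨fun e he => Or.inr (count i hi2 rowindec e he),
    fun e he => Or.inr ((count j hj2 colindec e he).trans hcast.symm)⟩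

end AddSubmonoid

/-! ### Odd transversals via linear algebra modulo two -/

namespace AddSubmonoid

variable {α : Type*} {K : AddSubmonoid (α → ℕ)} {G : Set α}

/-- Each factor contributes an odd number to the sum over `J`, so this sum counts the factors modulo
two. It therefore excludes ambiguity. -/
theorem HasLengthParity.even_sum_iff {J : Finset α} {w : α → ℕ} {ε : ZMod 2}
    (hJ : ∀ a, K.IsIndecomposable a → Odd (∑ e ∈ J, a e)) (h : K.HasLengthParity w ε) :
    ((∑ e ∈ J, w e : ℕ) : ZMod 2) = ε := by
  obtain ⟨s, hs, rfl, rfl⟩ := h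
  induction s using Multiset.induction_on with
  | empty => simp
  | cons a s ih =>
    rw [Multiset.sum_cons, Multiset.card_cons]
    simp only [Pi.add_apply, Finset.sum_add_distrib]
    push_cast at ih ⊢
    rw [ih fun b hb => hs b (Multiset.mem_cons_of_mem hb), add_comm (s.card : ZMod 2)]
    congr 1
    have := (ZMod.natCast_eq_one_iff_odd).2 (hJ a (hs a (Multiset.mem_cons_self a s)))
    exact_mod_cast this

/-- The indecomposable elements can be met oddly if and only if no element is ambiguous. -/
theorem exists_odd_iff_forall_not_isAmbiguous (hK : K.IsSaturatedOn G)
    (hhalf : ∀ w ∈ K, (∀ e, Even (w e)) → ∃ y ∈ K, w = y + y) :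
    (∃ J : Finset α, ↑J ⊆ G ∧ ∀ a, K.IsIndecomposable a → Odd (∑ e ∈ J, a e)) ↔
      ∀ w, ¬ K.IsAmbiguous w := by
  constructor
  · rintro ⟨J, -, hJ⟩ w ⟨h0, h1⟩
    exact zero_ne_one ((h0.even_sum_iff hJ).symm.trans (h1.even_sum_iff hJ))
  intro hamb
  classical
  -- The extra coordinate counts factors modulo two, so that solvability of the inhomogeneous system
  -- becomes a statement about a span.
  set S : Set ((α → ZMod 2) × ZMod 2) :=
    {v | ∃ a, K.IsIndecomposable a ∧ v = ((fun e => (a e : ZMod 2)), 1)} with hS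
  have hspan : ∀ v ∈ Submodule.span (ZMod 2) S, ∃ s : Multiset (α → ℕ),
      (∀ a ∈ s, K.IsIndecomposable a) ∧ v = ((fun e => (s.sum e : ZMod 2)), (s.card : ZMod 2)) := by
    intro v hv
    induction hv using Submodule.span_induction with
    | mem v hv =>
      obtain ⟨a, ha, rfl⟩ := hv
      exact ⟨{a}, by simpa using ha, by simp⟩
    | zero => exact ⟨0, by simp, by ext <;> simp⟩
    | add u v _ _ hu hv =>
      obtain ⟨s, hs, rfl⟩ := hu
      obtain ⟨t, ht, rfl⟩ := hv
      refine ⟨s + t, fun a ha => ?_, ?_⟩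
      · rcases Multiset.mem_add.1 ha with h | h
        exacts [hs a h, ht a h]
      · ext <;> simp
    | smul c v _ hv =>
      fin_cases c
      · refine ⟨0, by simp, ?_⟩
        change (0 : ZMod 2) • v = _
        rw [zero_smul]
        ext <;> simp
      · obtain ⟨s, hs, h⟩ := hv
        exact ⟨s, hs, by rw [← h]; exact one_smul _ v⟩
  -- Otherwise an odd number of indecomposables has an even sum `y + y`, and doubling a
  -- factorization of `y` yields one of even length.
  have hnot : ((0 : α → ZMod 2), (1 : ZMod 2)) ∉ Submodule.span (ZMod 2) S := by
    intro h
    obtain ⟨s, hs, hv⟩ := hspan _ h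
    obtain ⟨hv1, hv2⟩ := Prod.ext_iff.1 hv
    have hlen : K.HasLengthParity s.sum 1 := ⟨s, hs, rfl, hv2.symm⟩
    obtain ⟨y, hy, hyy⟩ := hhalf _ hlen.mem fun e => by
      have := congrFun hv1 e
      exact (ZMod.natCast_eq_zero_iff_even).1 this.symm
    obtain ⟨ε, hε⟩ := hK.exists_hasLengthParity hy
    refine hamb s.sum ⟨?_, hlen⟩
    rw [hyy]
    exact CharTwo.add_self_eq_zero ε ▸ hε.add hε
  -- A functional that kills the span but not `(0, 1)` takes the value `1` on the latter, so its
  -- coordinate part takes the value `1` on every indecomposable. `J` collects the coordinates in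
  -- `G` on which it is `1`.
  obtain ⟨φ, hφ, hφS⟩ := Submodule.exists_dual_map_eq_bot_of_notMem hnot inferInstance
  have h01 : ∀ c : ZMod 2, c ≠ 0 → c = 1 := by decide
  have hφ1 : φ (0, 1) = 1 := h01 _ hφ
  have hφ0 : ∀ a, K.IsIndecomposable a → φ ((fun e => (a e : ZMod 2)), 1) = 0 := by
    intro a ha
    have : φ ((fun e => (a e : ZMod 2)), 1) ∈ (Submodule.span (ZMod 2) S).map φ :=
      Submodule.mem_map_of_mem (Submodule.subset_span ⟨a, ha, rfl⟩)
    rwa [hφS, Submodule.mem_bot] at this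
  refine ⟨hK.finite.toFinset.filter fun e => φ (Pi.single e 1, 0) = 1, ?_, fun a ha => ?_⟩
  · intro e he
    have := (Finset.mem_filter.1 he).1
    simpa using this
  have hdec : ((fun e => (a e : ZMod 2)), (1 : ZMod 2)) =
      ∑ e ∈ hK.finite.toFinset, (a e : ZMod 2) • ((Pi.single e 1 : α → ZMod 2), (0 : ZMod 2)) +
        (0, 1) := by
    ext e
    · simp only [Prod.fst_add, Prod.fst_sum, Prod.smul_fst, Pi.add_apply, Finset.sum_apply,
        Pi.smul_apply, smul_eq_mul, Pi.zero_apply, add_zero]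
      by_cases he : e ∈ G
      · rw [Finset.sum_eq_single e]
        · simp
        · intro f _ hf
          simp [Pi.single_eq_of_ne hf.symm]
        · intro h
          simp [he] at h
      · rw [hK.eq_zero a ha.1 e he, Nat.cast_zero, eq_comm]
        refine Finset.sum_eq_zero fun f hf => ?_
        have : e ≠ f := by
          rintro rfl
          simp [he] at hf
        simp [Pi.single_eq_of_ne this]
    · simp [Prod.snd_sum]
  have h1 := hφ0 a ha
  rw [hdec, map_add, hφ1, map_sum] at h1
  simp only [map_smul, smul_eq_mul] at h1
  rw [← ZMod.natCast_eq_one_iff_odd, Finset.sum_filter, Nat.cast_sum]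
  rw [CharTwo.add_eq_zero] at h1
  refine Eq.trans ?_ h1
  refine Finset.sum_congr rfl fun e _ => ?_
  split_ifs with h
  · rw [h, mul_one]
  · have : φ (Pi.single e 1, 0) = 0 := by
      by_contra h'
      exact h (h01 _ h')
    rw [this, mul_zero, Nat.cast_zero]

end AddSubmonoid

/-! ### Cuts, bonds and the cone of nonnegative tensions -/

namespace MultiDigraph

open AddSubmonoid

variable {V α : Type*} (D : MultiDigraph V α) (G : Set α)

/-- The edges of `G` leaving and entering `X`. -/
def signedCutOn (X : Set V) : Set α × Set α := ((D.signedCut X).1 ∩ G, (D.signedCut X).2 ∩ G)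

/-- The edges of `G` between `X` and its complement. -/
def cutOn (X : Set V) : Set α := D.cut X ∩ G

/-- `X` induces a bond of the subgraph with edge set `G`. -/
def IsBondSideOn (X : Set V) : Prop :=
  (D.cutOn G X).Nonempty ∧ ∀ Y : Set V, (D.cutOn G Y).Nonempty → ¬ D.cutOn G Y ⊂ D.cutOn G X

variable {D G} {X Y W : Set V} {e : α}

theorem mem_cutOn : e ∈ D.cutOn G X ↔ ¬ (D.tail e ∈ X ↔ D.head e ∈ X) ∧ e ∈ G :=
  and_congr_left' (D.mem_cut X e)

theorem mem_signedCutOn_fst :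
    e ∈ (D.signedCutOn G X).1 ↔ (D.tail e ∈ X ∧ D.head e ∉ X) ∧ e ∈ G := Iff.rfl

theorem mem_signedCutOn_snd :
    e ∈ (D.signedCutOn G X).2 ↔ (D.tail e ∉ X ∧ D.head e ∈ X) ∧ e ∈ G := Iff.rfl

theorem signedCutOn_union : (D.signedCutOn G X).1 ∪ (D.signedCutOn G X).2 = D.cutOn G X :=
  (Set.union_inter_distrib_right _ _ _).symm

theorem signedCutOn_disjoint : Disjoint (D.signedCutOn G X).1 (D.signedCutOn G X).2 :=
  Set.disjoint_left.2 fun _ h h' => h'.1.1 h.1.1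

theorem signedCutOn_compl : D.signedCutOn G Xᶜ = (D.signedCutOn G X).swap := by
  rw [signedCutOn, signedCut_compl]
  rfl

theorem cutOn_compl : D.cutOn G Xᶜ = D.cutOn G X := by rw [cutOn, cut_compl, cutOn]

theorem IsBondSideOn.compl (h : D.IsBondSideOn G X) : D.IsBondSideOn G Xᶜ := by
  simpa only [IsBondSideOn, cutOn_compl] using h

theorem cutOn_subset_of_signedCutOn_subset (h₁ : (D.signedCutOn G X).1 ⊆ (D.signedCutOn G W).1)
    (h₂ : (D.signedCutOn G X).2 ⊆ (D.signedCutOn G W).2) : D.cutOn G X ⊆ D.cutOn G W := by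
  rw [← signedCutOn_union, ← signedCutOn_union]
  exact Set.union_subset_union h₁ h₂

/-- The uncrossing step for cuts, edge by edge: the unprimed and primed variables record the sides
of the two ends of each of two edges. If both edges cross the first cut and exactly one crosses the
second, some corner is crossed by the first edge but not by the second. -/
theorem uncross_cases {p q p' q' r s r' s' : Prop} (h1 : ¬ (p ↔ p')) (h2 : ¬ (r ↔ r'))
    (h3 : ¬ (¬ (q ↔ q') ↔ ¬ (s ↔ s'))) :
    (¬ (p ∧ q ↔ p' ∧ q') ∧ (r ∧ s ↔ r' ∧ s')) ∨
      (¬ (p ∧ ¬ q ↔ p' ∧ ¬ q') ∧ (r ∧ ¬ s ↔ r' ∧ ¬ s')) ∨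
      (¬ (p ∨ q ↔ p' ∨ q') ∧ (r ∨ s ↔ r' ∨ s')) ∨
      (¬ (p ∨ ¬ q ↔ p' ∨ ¬ q') ∧ (r ∨ ¬ s ↔ r' ∨ ¬ s')) := by
  by_cases p <;> by_cases q <;> by_cases r <;> by_cases s <;> by_cases q' <;> by_cases s' <;>
    simp_all

/-- Every edge of a cut lies in a bond that is conformal to the cut. -/
theorem exists_isBondSideOn (hG : G.Finite) (he : e ∈ D.cutOn G W) :
    ∃ X, D.IsBondSideOn G X ∧ e ∈ D.cutOn G X ∧ (D.signedCutOn G X).1 ⊆ (D.signedCutOn G W).1 ∧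
      (D.signedCutOn G X).2 ⊆ (D.signedCutOn G W).2 := by
  induction hn : (D.cutOn G W).ncard using Nat.strong_induction_on generalizing W with
  | _ n ih =>
  subst hn
  by_cases hb : D.IsBondSideOn G W
  · exact ⟨W, hb, he, subset_rfl, subset_rfl⟩
  obtain ⟨Z, ⟨g, hg⟩, hZ⟩ : ∃ Z, (D.cutOn G Z).Nonempty ∧ D.cutOn G Z ⊂ D.cutOn G W := by
    by_contra! h
    exact hb ⟨⟨e, he⟩, h⟩
  -- The cut of `Z` distinguishes `e` from some other edge `f` of the cut of `W`; uncrossing keeps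
  -- `e` and loses `f`.
  obtain ⟨f, hfW, hef⟩ : ∃ f ∈ D.cutOn G W, ¬ (e ∈ D.cutOn G Z ↔ f ∈ D.cutOn G Z) := by
    obtain ⟨k, hkW, hkZ⟩ := Set.exists_of_ssubset hZ
    by_cases heZ : e ∈ D.cutOn G Z
    · exact ⟨k, hkW, by tauto⟩
    · exact ⟨g, hZ.1 hg, by tauto⟩
  have hsub : ∀ x ∈ G, ¬ (D.tail x ∈ Z ↔ D.head x ∈ Z) → ¬ (D.tail x ∈ W ↔ D.head x ∈ W) :=
    fun x hx h => (mem_cutOn.1 (hZ.1 (mem_cutOn.2 ⟨h, hx⟩))).1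
  -- Conformality uses that every edge crossing `Z` crosses `W`: an edge inside `W` or inside its
  -- complement does not cross a corner.
  have conf : ∀ U : Set V, (U = W ∩ Z ∨ U = W ∩ Zᶜ ∨ U = W ∪ Z ∨ U = W ∪ Zᶜ) →
      (D.signedCutOn G U).1 ⊆ (D.signedCutOn G W).1 ∧
      (D.signedCutOn G U).2 ⊆ (D.signedCutOn G W).2 := by
    intro U hU
    refine ⟨fun x hx => ?_, fun x hx => ?_⟩ <;>
    · have h := hsub x hx.2
      obtain ⟨hx1, hx2⟩ := hx
      refine ⟨?_, hx2⟩
      rcases hU with rfl | rfl | rfl | rfl <;>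
      simp only [signedCut, Set.mem_ofPred_eq, Set.mem_inter_iff, Set.mem_union,
        Set.mem_compl_iff] at hx1 ⊢ <;> tauto
  obtain ⟨U, hU, heU, hfU⟩ : ∃ U : Set V,
      (U = W ∩ Z ∨ U = W ∩ Zᶜ ∨ U = W ∪ Z ∨ U = W ∪ Zᶜ) ∧ e ∈ D.cutOn G U ∧
        f ∉ D.cutOn G U := by
    have heG := (mem_cutOn.1 he).2
    have hfG := (mem_cutOn.1 hfW).2
    simp only [mem_cutOn, heG, hfG, and_true] at he hfW hef
    simp only [mem_cutOn, heG, hfG, and_true, not_not]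
    rcases uncross_cases he hfW hef with h | h | h | h
    · exact ⟨W ∩ Z, Or.inl rfl, h⟩
    · exact ⟨W ∩ Zᶜ, Or.inr (Or.inl rfl), h⟩
    · exact ⟨W ∪ Z, Or.inr (Or.inr (Or.inl rfl)), h⟩
    · exact ⟨W ∪ Zᶜ, Or.inr (Or.inr (Or.inr rfl)), h⟩
  obtain ⟨hp, hq⟩ := conf U hU
  have hlt : D.cutOn G U ⊂ D.cutOn G W :=
    ⟨cutOn_subset_of_signedCutOn_subset hp hq, fun h => hfU (h hfW)⟩
  obtain ⟨X, hX, heX, h1, h2⟩ := ih _ (Set.ncard_lt_ncard hlt (hG.inter_of_right _)) heU rfl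
  exact ⟨X, hX, heX, h1.trans hp, h2.trans hq⟩

variable (D G) in
/-- The nonnegative vectors on `G` that are differences of an integral potential. -/
def cone : AddSubmonoid (α → ℕ) where
  carrier := {w | (∃ k : V → ℤ, ∀ e ∈ G, (w e : ℤ) = k (D.tail e) - k (D.head e)) ∧
    ∀ e ∉ G, w e = 0}
  zero_mem' := ⟨⟨0, by simp⟩, by simp⟩
  add_mem' := by
    rintro x y ⟨⟨k, hk⟩, hx⟩ ⟨⟨l, hl⟩, hy⟩
    refine ⟨⟨k + l, fun e he => ?_⟩, fun e he => by simp [hx e he, hy e he]⟩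
    simp only [Pi.add_apply]
    push_cast
    rw [hk e he, hl e he]
    ring

theorem cone_isSaturatedOn (hG : G.Finite) : (D.cone G).IsSaturatedOn G where
  finite := hG
  eq_zero _ hx := hx.2
  sub_mem := by
    rintro x ⟨⟨k, hk⟩, hx⟩ y ⟨⟨l, hl⟩, hy⟩ hle
    refine ⟨⟨l - k, fun e he => ?_⟩, fun e he => by simp [hx e he, hy e he]⟩
    simp only [Pi.sub_apply]
    rw [Nat.cast_sub (hle e), hk e he, hl e he]
    ring

/-- Halve the potential, rounding down: its differences along edges of `G` are even, so the rounding
errors at the two ends cancel. -/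
theorem exists_add_self_of_even {w : α → ℕ} (hw : w ∈ D.cone G) (h : ∀ e, Even (w e)) :
    ∃ y ∈ D.cone G, w = y + y := by
  obtain ⟨⟨k, hk⟩, h0⟩ := hw
  refine ⟨fun e => w e / 2, ⟨⟨fun v => k v / 2, fun e he => ?_⟩, fun e he => by simp [h0 e he]⟩,
    funext fun e => ?_⟩
  · have := hk e he
    obtain ⟨c, hc⟩ := h e
    push_cast
    omega
  · obtain ⟨c, hc⟩ := h e
    simp only [Pi.add_apply]
    omega

theorem vec_signedCutOn_mem_cone (hX : (D.signedCutOn G X).2 = ∅) :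
    vec (D.signedCutOn G X).1 ∈ D.cone G := by
  classical
  refine ⟨⟨fun v => if v ∈ X then 1 else 0, fun e he => ?_⟩, fun e he =>
    vec_apply_of_notMem fun h => he h.2⟩
  have h2 : ¬ (D.tail e ∉ X ∧ D.head e ∈ X) := fun h =>
    Set.eq_empty_iff_forall_notMem.1 hX e ⟨h, he⟩
  by_cases h : D.tail e ∈ X ∧ D.head e ∉ X
  · rw [vec_apply_of_mem (mem_signedCutOn_fst.2 ⟨h, he⟩)]
    simp [h]
  · rw [vec_apply_of_notMem fun h' => h h'.1]
    by_cases h3 : D.tail e ∈ X <;> by_cases h4 : D.head e ∈ X <;> simp_all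

/-- The potential does not increase along edges of `G`, so no edge enters an upper level set. -/
theorem signedCutOn_level_snd {x : α → ℕ} {k : V → ℤ}
    (hk : ∀ e ∈ G, (x e : ℤ) = k (D.tail e) - k (D.head e)) (c : ℤ) :
    (D.signedCutOn G {v | c ≤ k v}).2 = ∅ := by
  refine Set.eq_empty_iff_forall_notMem.2 fun e he => ?_
  obtain ⟨⟨h1, h2⟩, he⟩ := mem_signedCutOn_snd.1 he
  have := hk e he
  simp only [Set.mem_ofPred_eq] at h1 h2
  omega

theorem vec_level_le {x : α → ℕ} {k : V → ℤ}
    (hk : ∀ e ∈ G, (x e : ℤ) = k (D.tail e) - k (D.head e)) (c : ℤ) :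
    vec (D.signedCutOn G {v | c ≤ k v}).1 ≤ x := by
  refine vec_le_iff.2 fun e he => ?_
  obtain ⟨⟨h1, h2⟩, he⟩ := mem_signedCutOn_fst.1 he
  have := hk e he
  simp only [Set.mem_ofPred_eq] at h1 h2
  omega

/-- The indecomposable elements of the cone are the directed bonds. -/
theorem isIndecomposable_cone_iff (hG : G.Finite) {a : α → ℕ} :
    (D.cone G).IsIndecomposable a ↔ ∃ X, D.IsBondSideOn G X ∧ (D.signedCutOn G X).2 = ∅ ∧
      a = vec (D.signedCutOn G X).1 := by
  constructor
  · rintro ⟨ha, ha0, hind⟩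
    obtain ⟨⟨k, hk⟩, h0⟩ := ha
    obtain ⟨e, he⟩ := Function.ne_iff.1 ha0
    have heG : e ∈ G := by
      by_contra h
      exact he (h0 e h)
    have hke := hk e heG
    simp only [Pi.zero_apply] at he
    -- The level cut at the tail of `e` is directed and lies below `a`; a bond inside it through `e`
    -- can be subtracted from `a`.
    obtain ⟨X, hX, heX, h1, h2⟩ := D.exists_isBondSideOn hG (W := {v | k (D.tail e) ≤ k v})
      (mem_cutOn.2 ⟨by simp only [Set.mem_ofPred_eq]; omega, heG⟩)
    rw [signedCutOn_level_snd hk, Set.subset_empty_iff] at h2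
    have hle : vec (D.signedCutOn G X).1 ≤ a := fun f =>
      le_trans (vec_le_iff.2 (fun g hg => (vec_apply_of_mem (h1 hg)).ge) f) (vec_level_le hk _ f)
    have hXK := vec_signedCutOn_mem_cone h2
    refine ⟨X, hX, h2, ?_⟩
    have := hind _ hXK _ ((D.cone_isSaturatedOn hG).sub_mem _ hXK _ ⟨⟨k, hk⟩, h0⟩ hle)
      (add_tsub_cancel_of_le hle).symm
    rcases this with h | h
    · exfalso
      rw [← signedCutOn_union, h2, Set.union_empty] at heX
      exact vec_ne_zero ⟨e, heX⟩ h
    · exact le_antisymm (tsub_eq_zero_iff_le.1 h) hle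
  · rintro ⟨X, hX, h2, rfl⟩
    have hne : (D.signedCutOn G X).1.Nonempty := by
      have := hX.1
      rwa [← signedCutOn_union, h2, Set.union_empty] at this
    refine ⟨vec_signedCutOn_mem_cone h2, vec_ne_zero hne, fun x hx y hy hxy => ?_⟩
    by_cases hx0 : x = 0
    · exact Or.inl hx0
    right
    obtain ⟨⟨k, hk⟩, h0⟩ := hx
    obtain ⟨e, he⟩ := Function.ne_iff.1 hx0
    have heG : e ∈ G := by
      by_contra h
      exact he (h0 e h)
    have hke := hk e heG
    simp only [Pi.zero_apply] at he
    -- A nonzero summand `x` dominates one of its level cuts. This cut lies in the bond and so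
    -- equals it, which leaves nothing for `y`.
    have hle := vec_level_le hk (k (D.tail e))
    set Y := {v | k (D.tail e) ≤ k v} with hY
    have hY2 : (D.signedCutOn G Y).2 = ∅ := signedCutOn_level_snd hk _
    have hsub : D.cutOn G Y ⊆ D.cutOn G X := by
      rw [← signedCutOn_union, ← signedCutOn_union, h2, hY2, Set.union_empty, Set.union_empty]
      intro f hf
      by_contra hfX
      have a1 := congrFun hxy f
      have a2 := vec_le_iff.1 hle f hf
      rw [vec_apply_of_notMem hfX, Pi.add_apply] at a1
      omega
    have heq : D.cutOn G Y = D.cutOn G X := by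
      by_contra hne
      refine hX.2 Y ⟨e, mem_cutOn.2 ⟨?_, heG⟩⟩ (hsub.ssubset_of_ne hne)
      simp only [hY, Set.mem_ofPred_eq]
      omega
    rw [← signedCutOn_union, ← signedCutOn_union, h2, hY2, Set.union_empty, Set.union_empty] at heq
    funext f
    have a1 := congrFun hxy f
    have a2 : vec _ f ≤ x f := hle f
    rw [heq] at a2
    rw [Pi.add_apply] at a1
    simp only [Pi.zero_apply]
    omega

end MultiDigraph

/-! ### Ambiguity under faces and isomorphisms of monoids -/

namespace AddSubmonoid

variable {α : Type*} {K K' : AddSubmonoid (α → ℕ)} {w : α → ℕ}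

/-- Ambiguity in the face of `K` where the coordinate `e` vanishes. -/
theorem isAmbiguous_face_iff {e : α} (h : ∀ w, w ∈ K' ↔ w ∈ K ∧ w e = 0) :
    K'.IsAmbiguous w ↔ K.IsAmbiguous w ∧ w e = 0 := by
  have hind : ∀ a, K'.IsIndecomposable a ↔ K.IsIndecomposable a ∧ a e = 0 := by
    intro a
    constructor
    · rintro ⟨ha, ha0, hi⟩
      refine ⟨⟨((h a).1 ha).1, ha0, fun x hx y hy hxy => ?_⟩, ((h a).1 ha).2⟩
      have h1 := congrFun hxy e
      rw [((h a).1 ha).2, Pi.add_apply] at h1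
      exact hi x ((h x).2 ⟨hx, by omega⟩) y ((h y).2 ⟨hy, by omega⟩) hxy
    · rintro ⟨⟨ha, ha0, hi⟩, h0⟩
      exact ⟨(h a).2 ⟨ha, h0⟩, ha0, fun x hx y hy =>
        hi x ((h x).1 hx).1 y ((h y).1 hy).1⟩
  have hpar : ∀ ε, K'.HasLengthParity w ε ↔ K.HasLengthParity w ε ∧ w e = 0 := by
    intro ε
    constructor
    · intro hw
      refine ⟨?_, ((h w).1 hw.mem).2⟩
      obtain ⟨s, hs, h1, h2⟩ := hw
      exact ⟨s, fun a ha => ((hind a).1 (hs a ha)).1, h1, h2⟩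
    · rintro ⟨⟨s, hs, rfl, h2⟩, h0⟩
      refine ⟨s, fun a ha => (hind a).2 ⟨hs a ha, ?_⟩, rfl, h2⟩
      -- By nonnegativity, the factors of a vector that vanishes at `e` vanish there as well.
      have : a e ≤ s.sum e := by
        obtain ⟨t, rfl⟩ := Multiset.exists_cons_of_mem ha
        rw [Multiset.sum_cons, Pi.add_apply]
        exact Nat.le_add_right _ _
      omega
  simp only [IsAmbiguous, hpar]
  tauto

/-- Ambiguity is invariant under additive bijections. -/
theorem isAmbiguous_map_iff (f : (α → ℕ) →+ (α → ℕ)) (hf : Set.InjOn f K) (hw : w ∈ K) :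
    (K.map f).IsAmbiguous (f w) ↔ K.IsAmbiguous w := by
  have hind : ∀ a ∈ K, ((K.map f).IsIndecomposable (f a) ↔ K.IsIndecomposable a) := by
    intro a ha
    have h0 : ∀ x ∈ K, f x = 0 → x = 0 := fun x hx h =>
      hf hx K.zero_mem (h.trans (map_zero f).symm)
    constructor
    · rintro ⟨-, ha0, hi⟩
      refine ⟨ha, ?_, fun x hx y hy hxy => ?_⟩
      · rintro rfl
        exact ha0 (map_zero f)
      · rcases hi _ (mem_map_of_mem f hx) _ (mem_map_of_mem f hy)
          (by rw [hxy, map_add]) with h | h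
        · exact Or.inl (h0 x hx h)
        · exact Or.inr (h0 y hy h)
    · rintro ⟨-, ha0, hi⟩
      refine ⟨mem_map_of_mem f ha, fun h => ha0 (h0 a ha h), ?_⟩
      rintro _ ⟨x, hx, rfl⟩ _ ⟨y, hy, rfl⟩ hxy
      rw [← map_add] at hxy
      rcases hi x hx y hy (hf ha (K.add_mem hx hy) hxy) with rfl | rfl
      · exact Or.inl (map_zero f)
      · exact Or.inr (map_zero f)
  have hpar : ∀ ε, (K.map f).HasLengthParity (f w) ε ↔ K.HasLengthParity w ε := by
    intro ε
    constructor
    · rintro ⟨s, hs, h1, h2⟩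
      have hex : ∀ a : α → ℕ, ∃ b, a ∈ K.map f → b ∈ K ∧ f b = a := by
        intro a
        by_cases ha : a ∈ K.map f
        · obtain ⟨b, hb, rfl⟩ := ha
          exact ⟨b, fun _ => ⟨hb, rfl⟩⟩
        · exact ⟨0, fun h => absurd h ha⟩
      choose g hg using hex
      have hs' : ∀ a ∈ s, g a ∈ K ∧ f (g a) = a := fun a ha => hg a (hs a ha).1
      refine ⟨s.map g, ?_, ?_, by rwa [Multiset.card_map]⟩
      · intro a ha
        obtain ⟨b, hb, rfl⟩ := Multiset.mem_map.1 ha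
        rw [← hind _ (hs' b hb).1, (hs' b hb).2]
        exact hs b hb
      · refine hf (K.multiset_sum_mem _ fun a ha => ?_) hw ?_
        · obtain ⟨b, hb, rfl⟩ := Multiset.mem_map.1 ha
          exact (hs' b hb).1
        · rw [map_multiset_sum, Multiset.map_map, ← h1]
          congr 1
          conv_rhs => rw [← Multiset.map_id s]
          exact Multiset.map_congr rfl fun a ha => (hs' a ha).2
    · rintro ⟨s, hs, rfl, h2⟩
      refine ⟨s.map f, fun a ha => ?_, by rw [map_multiset_sum], by rwa [Multiset.card_map]⟩
      obtain ⟨b, hb, rfl⟩ := Multiset.mem_map.1 ha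
      exact (hind b (hs b hb).1).2 (hs b hb)
  rw [IsAmbiguous, hpar, hpar, IsAmbiguous]

end AddSubmonoid

/-! ### Oriented matroids represented by digraphs, deletion and contraction -/

namespace MultiDigraph

open AddSubmonoid OrientedMatroid

variable {V α : Type*}

/-- The signed circuits of `M` are the signed bonds of the subgraph of `D` with edge set `M.E`. -/
def Represents (D : MultiDigraph V α) (M : OrientedMatroid α) : Prop :=
  M.circuits = {C | ∃ X, D.IsBondSideOn M.E X ∧ C = D.signedCutOn M.E X}

theorem represents_bondMatroid [Finite α] (D : MultiDigraph V α) : D.Represents D.bondMatroid := by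
  have h1 : ∀ X, D.signedCutOn D.bondMatroid.E X = D.signedCut X := fun X =>
    Prod.ext (Set.inter_univ _) (Set.inter_univ _)
  have h2 : ∀ X, D.cutOn D.bondMatroid.E X = D.cut X := fun X => Set.inter_univ _
  simp only [Represents, IsBondSideOn, h1, h2]
  rfl

/-- Moves the digraph onto the edge type of `M`, so that minors can be represented on fixed vertex
and edge types. -/
theorem exists_represents {α : Type*} {M : OrientedMatroid α} (hM : M.IsOrientedBondMatroid) :
    ∃ (V : Type) (D : MultiDigraph V α), D.Represents M := by
  classical
  obtain ⟨V, E, _, _, D, σ, hσ⟩ := hM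
  let τ : M.E → E := fun x => (σ x : E)
  have hτ : Function.Bijective τ :=
    ⟨fun x y h => σ.injective (Subtype.ext h), fun y => ⟨σ.symm ⟨y, Set.mem_univ y⟩, by simp [τ]⟩⟩
  -- Elements outside `M.E` become loops at the extra vertex `none`, which exists even if `V` is
  -- empty.
  let D' : MultiDigraph (Option V) α :=
    ⟨fun a => if h : a ∈ M.E then some (D.tail (τ ⟨a, h⟩)) else none,
      fun a => if h : a ∈ M.E then some (D.head (τ ⟨a, h⟩)) else none⟩
  have ht : ∀ x : M.E, D'.tail x = some (D.tail (τ x)) := fun x => dif_pos x.2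
  have hh : ∀ x : M.E, D'.head x = some (D.head (τ x)) := fun x => dif_pos x.2
  have hs : ∀ X, D'.signedCutOn M.E X =
      (Subtype.val '' (τ ⁻¹' (D.signedCut (some ⁻¹' X)).1),
        Subtype.val '' (τ ⁻¹' (D.signedCut (some ⁻¹' X)).2)) := by
    intro X
    refine Prod.ext (Set.ext fun a => ?_) (Set.ext fun a => ?_) <;>
    · constructor
      · rintro ⟨h, ha⟩
        refine ⟨⟨a, ha⟩, ?_, rfl⟩
        have := ht ⟨a, ha⟩
        have := hh ⟨a, ha⟩
        simp_all [signedCut]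
      · rintro ⟨x, hx, rfl⟩
        refine ⟨?_, x.2⟩
        have := ht x
        have := hh x
        simp_all [signedCut]
  have hc : ∀ X, D'.cutOn M.E X = Subtype.val '' (τ ⁻¹' D.cut (some ⁻¹' X)) := by
    intro X
    rw [← signedCutOn_union, hs, ← Set.image_union, ← Set.preimage_union]
    rfl
  have hinj : Function.Injective fun S : Set E => (Subtype.val '' (τ ⁻¹' S) : Set α) :=
    Subtype.val_injective.image_injective.comp hτ.2.preimage_injective
  have hmono : ∀ S T : Set E, (Subtype.val '' (τ ⁻¹' S) : Set α) ⊂ Subtype.val '' (τ ⁻¹' T) ↔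
      S ⊂ T := by
    intro S T
    rw [ssubset_iff_subset_ne, ssubset_iff_subset_ne, Set.image_subset_image_iff
      Subtype.val_injective, hτ.2.preimage_subset_preimage_iff, (hinj.ne_iff (x := S) (y := T))]
  have hb : ∀ X, D'.IsBondSideOn M.E X ↔ D.IsBondSide (some ⁻¹' X) := by
    intro X
    simp only [IsBondSideOn, hc, hmono, Set.image_nonempty, hτ.2.nonempty_preimage, IsBondSide]
    refine and_congr_right' ⟨fun h Y => ?_, fun h Y => h _⟩
    have := h (some '' Y)
    rwa [Set.preimage_image_eq _ (Option.some_injective V)] at this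
  refine ⟨Option V, D', Set.ext fun C => ?_⟩
  have key : ∀ P Q : Set M.E, ((Subtype.val '' P, Subtype.val '' Q) : Set α × Set α) ∈ M.circuits ↔
      (τ '' P, τ '' Q) ∈ D.bondMatroid.circuits := hσ
  constructor
  · intro hC
    have hsub := M.subset_ground C hC
    obtain ⟨P, hP⟩ : ∃ P : Set M.E, Subtype.val '' P = C.1 :=
      ⟨_, by rw [Subtype.image_preimage_coe, Set.inter_eq_right]
             exact Set.subset_union_left.trans hsub⟩
    obtain ⟨Q, hQ⟩ : ∃ Q : Set M.E, Subtype.val '' Q = C.2 :=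
      ⟨_, by rw [Subtype.image_preimage_coe, Set.inter_eq_right]
             exact Set.subset_union_right.trans hsub⟩
    obtain rfl : C = (Subtype.val '' P, Subtype.val '' Q) := Prod.ext hP.symm hQ.symm
    obtain ⟨Y, hY, hYe⟩ := (key P Q).1 hC
    have hpre : some ⁻¹' (some '' Y) = Y := Set.preimage_image_eq _ (Option.some_injective V)
    refine ⟨some '' Y, (hb _).2 (hpre.symm ▸ hY), ?_⟩
    rw [hs, hpre, ← hYe, Set.preimage_image_eq _ hτ.1, Set.preimage_image_eq _ hτ.1]
  · rintro ⟨X, hX, rfl⟩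
    rw [hs, key, Set.image_preimage_eq _ hτ.2, Set.image_preimage_eq _ hτ.2]
    exact ⟨_, (hb X).1 hX, rfl⟩

variable {D : MultiDigraph V α} {M : OrientedMatroid α} {e : α}

theorem Represents.mem_circuits (h : D.Represents M) {C : Set α × Set α} :
    C ∈ M.circuits ↔ ∃ X, D.IsBondSideOn M.E X ∧ C = D.signedCutOn M.E X := by
  rw [h, Set.mem_ofPred_eq]

theorem sum_vec (S : Set α) (J : Finset α) : ∑ e ∈ J, vec S e = (S ∩ J).ncard := by
  classical
  have : S ∩ J = ((J.filter (· ∈ S) : Finset α) : Set α) := by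
    ext x
    simp [and_comm]
  rw [this, Set.ncard_coe_finset, Finset.card_filter]
  rfl

/-- A set meeting all directed circuits oddly exists if and only if no vector is ambiguous. -/
theorem Represents.exists_odd_iff (h : D.Represents M) :
    (∃ J ⊆ M.E, ∀ C ∈ M.circuits, IsDirected C → Odd ((C.1 ∪ C.2) ∩ J).ncard) ↔
      ∀ w, ¬ (D.cone M.E).IsAmbiguous w := by
  rw [← exists_odd_iff_forall_not_isAmbiguous (cone_isSaturatedOn M.finite)
    fun w => exists_add_self_of_even]
  have key : ∀ J : Finset α, (∀ C ∈ M.circuits, IsDirected C → Odd ((C.1 ∪ C.2) ∩ J).ncard) ↔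
      ∀ a, (D.cone M.E).IsIndecomposable a → Odd (∑ e ∈ J, a e) := by
    intro J
    constructor
    · intro hJ a ha
      obtain ⟨X, hX, h2, rfl⟩ := (isIndecomposable_cone_iff M.finite).1 ha
      have := hJ _ (h.mem_circuits.2 ⟨X, hX, rfl⟩) (Or.inr h2)
      rwa [h2, Set.union_empty, ← sum_vec] at this
    · intro hJ C hC hdir
      obtain ⟨X, hX, rfl⟩ := h.mem_circuits.1 hC
      rcases hdir with h1 | h2
      · have := hJ _ ((isIndecomposable_cone_iff M.finite).2 ⟨Xᶜ, hX.compl, by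
          rw [signedCutOn_compl, Prod.snd_swap, h1], rfl⟩)
        rw [signedCutOn_compl, Prod.fst_swap, sum_vec] at this
        rwa [h1, Set.empty_union]
      · have := hJ _ ((isIndecomposable_cone_iff M.finite).2 ⟨X, hX, h2, rfl⟩)
        rwa [h2, Set.union_empty, ← sum_vec]
  constructor
  · rintro ⟨J, hJE, hJ⟩
    obtain ⟨J, rfl⟩ := (M.finite.subset hJE).exists_finset_coe
    exact ⟨J, hJE, (key J).1 hJ⟩
  · rintro ⟨J, hJE, hJ⟩
    exact ⟨J, hJE, (key J).2 hJ⟩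

open Classical in
/-- Contraction of the edge `e` to its tail, on the same vertex and edge types. -/
noncomputable def contractEdge (D : MultiDigraph V α) (e : α) : MultiDigraph V α where
  tail f := if D.tail f = D.head e then D.tail e else D.tail f
  head f := if D.head f = D.head e then D.tail e else D.head f

/-- Deletion in the bond matroid is contraction of the edge in the digraph. Cuts of the contracted
digraph are the cuts of `D` avoiding `e`, and its tensions are those vanishing at `e`, so the cone
becomes a face. -/
theorem Represents.delete (h : D.Represents M) (e : α) (he : e ∈ M.E) :
    (D.contractEdge e).Represents (M.delete e) ∧ ∀ w,
      ((D.contractEdge e).cone (M.delete e).E).IsAmbiguous w ↔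
        (D.cone M.E).IsAmbiguous w ∧ w e = 0 := by
  classical
  set φ : V → V := fun v => if v = D.head e then D.tail e else v with hφ
  have ht : ∀ f, (D.contractEdge e).tail f = φ (D.tail f) := fun _ => rfl
  have hh : ∀ f, (D.contractEdge e).head f = φ (D.head f) := fun _ => rfl
  have hφe : φ (D.tail e) = φ (D.head e) := by
    simp only [hφ, if_true]
    split_ifs <;> rfl
  have hk : ∀ {β : Type _} (k : V → β), k (D.tail e) = k (D.head e) → ∀ v, k (φ v) = k v := by
    intro β k hk v
    simp only [hφ]
    split_ifs with hv
    · rw [hv, hk]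
    · rfl
  have hE : (M.delete e).E = M.E \ {e} := rfl
  have hs : ∀ X, (D.contractEdge e).signedCutOn (M.delete e).E X =
      D.signedCutOn M.E (φ ⁻¹' X) := by
    intro X
    have hne : ∀ f, (φ (D.tail f) ∈ X ↔ ¬ φ (D.head f) ∈ X) → f ≠ e := by
      rintro f hf rfl
      rw [hφe] at hf
      tauto
    refine Prod.ext (Set.ext fun f => ?_) (Set.ext fun f => ?_)
    · rw [mem_signedCutOn_fst, mem_signedCutOn_fst, ht, hh, hE]
      have := hne f
      simp only [Set.mem_preimage, Set.mem_sdiff, Set.mem_singleton_iff]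
      tauto
    · rw [mem_signedCutOn_snd, mem_signedCutOn_snd, ht, hh, hE]
      have := hne f
      simp only [Set.mem_preimage, Set.mem_sdiff, Set.mem_singleton_iff]
      tauto
  have hc : ∀ X, (D.contractEdge e).cutOn (M.delete e).E X = D.cutOn M.E (φ ⁻¹' X) := by
    intro X
    rw [← signedCutOn_union, hs, signedCutOn_union]
  have hpre : ∀ Y, e ∉ D.cutOn M.E Y → φ ⁻¹' Y = Y := by
    intro Y hY
    have : D.tail e ∈ Y ↔ D.head e ∈ Y := by
      by_contra h'
      exact hY (mem_cutOn.2 ⟨h', he⟩)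
    exact Set.ext fun v => iff_of_eq (hk (· ∈ Y) (propext this) v)
  have hnot : ∀ X, e ∉ D.cutOn M.E (φ ⁻¹' X) := by
    intro X hX
    rw [mem_cutOn, Set.mem_preimage, Set.mem_preimage, hφe] at hX
    exact hX.1 Iff.rfl
  have hb : ∀ X, (D.contractEdge e).IsBondSideOn (M.delete e).E X ↔
      D.IsBondSideOn M.E (φ ⁻¹' X) := by
    intro X
    simp only [IsBondSideOn, hc]
    refine and_congr_right' ⟨fun h' Y hY hlt => ?_, fun h' Y => h' _⟩
    have heY : e ∉ D.cutOn M.E Y := fun heY => hnot X (hlt.1 heY)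
    have := h' Y
    rw [hpre Y heY] at this
    exact this hY hlt
  refine ⟨Set.ext fun C => ⟨?_, ?_⟩, fun w => isAmbiguous_face_iff fun w => ⟨?_, ?_⟩⟩
  · rintro ⟨hC, heC⟩
    obtain ⟨X, hX, rfl⟩ := h.mem_circuits.1 hC
    rw [signedCutOn_union] at heC
    exact ⟨X, by rwa [hb, hpre X heC], by rw [hs, hpre X heC]⟩
  · rintro ⟨X, hX, rfl⟩
    rw [hs]
    refine ⟨h.mem_circuits.2 ⟨_, (hb X).1 hX, rfl⟩, ?_⟩
    rw [signedCutOn_union]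
    exact hnot X
  · rintro ⟨⟨k, hkw⟩, h0⟩
    have he0 : w e = 0 := h0 e fun h => h.2 rfl
    -- Pulling the potential back along `φ` gives both ends of `e` the same value.
    refine ⟨⟨⟨k ∘ φ, fun f hf => ?_⟩, fun f hf => h0 f fun h => hf h.1⟩, he0⟩
    by_cases hfe : f = e
    · rw [hfe, he0, Function.comp_apply, Function.comp_apply, hφe]
      simp
    · exact hkw f ⟨hf, hfe⟩
  · rintro ⟨⟨⟨k, hkw⟩, h0⟩, he0⟩
    have := hkw e he
    refine ⟨⟨k, fun f hf => ?_⟩, fun f hf => ?_⟩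
    · rw [ht, hh, hk k (by omega), hk k (by omega)]
      exact hkw f hf.1
    · by_cases hfe : f = e
      · rw [hfe, he0]
      · exact h0 f fun h => hf ⟨h, hfe⟩

/-- Contraction in the bond matroid is deletion of the edge from the digraph: the minimal traces of
bonds on the remaining edges are the bonds there, because every edge of a cut lies in a conformal
bond. -/
theorem Represents.contract (h : D.Represents M) (e : α) : D.Represents (M.contract e) := by
  have hs : ∀ X, D.signedCutOn (M.contract e).E X =
      ((D.signedCutOn M.E X).1 \ {e}, (D.signedCutOn M.E X).2 \ {e}) := fun X =>
    Prod.ext (Set.inter_sdiff_assoc _ _ _).symm (Set.inter_sdiff_assoc _ _ _).symm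
  have hc : ∀ X, D.cutOn (M.contract e).E X = D.cutOn M.E X \ {e} := fun X =>
    (Set.inter_sdiff_assoc _ _ _).symm
  refine Set.ext fun Z => ⟨?_, ?_⟩
  · rintro ⟨C, hC, rfl, hne, hmin⟩
    obtain ⟨X, hX, rfl⟩ := h.mem_circuits.1 hC
    refine ⟨X, ⟨?_, ?_⟩, (hs X).symm⟩
    · rwa [hc, ← signedCutOn_union]
    · rw [hc]
      rintro Y ⟨f, hf⟩ hlt
      rw [hc] at hf hlt
      obtain ⟨B, hB, hfB, h1, h2⟩ := exists_isBondSideOn M.finite hf.1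
      have hBY := cutOn_subset_of_signedCutOn_subset h1 h2
      have := hmin _ (h.mem_circuits.2 ⟨B, hB, rfl⟩)
      simp only [signedCutOn_union] at this
      exact this ⟨f, hfB, hf.2⟩ ((Set.sdiff_subset_sdiff_left hBY).trans_ssubset hlt)
  · rintro ⟨X, ⟨⟨f, hf⟩, hmin⟩, rfl⟩
    rw [hc] at hf hmin
    obtain ⟨B, hB, hfB, h1, h2⟩ := exists_isBondSideOn M.finite hf.1
    have hBX := cutOn_subset_of_signedCutOn_subset h1 h2
    have heq : D.cutOn M.E B \ {e} = D.cutOn M.E X \ {e} := by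
      by_contra hne
      refine hmin B ?_ ?_
      · rw [hc]
        exact ⟨f, hfB, hf.2⟩
      · rw [hc]
        exact (Set.sdiff_subset_sdiff_left hBX).ssubset_of_ne hne
    refine ⟨_, h.mem_circuits.2 ⟨B, hB, rfl⟩, ?_, ?_, ?_⟩
    · rw [hs]
      have hd := Set.disjoint_left.1 (D.signedCutOn_disjoint (G := M.E) (X := X))
      have hmem : ∀ x, x ≠ e → (x ∈ D.cutOn M.E B ↔ x ∈ D.cutOn M.E X) := by
        intro x hx
        have : x ∈ D.cutOn M.E B \ {e} ↔ x ∈ D.cutOn M.E X \ {e} := by rw [heq]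
        simpa [hx] using this
      simp only [← signedCutOn_union, Set.mem_union] at hmem
      refine Prod.ext (Set.ext fun x => ?_) (Set.ext fun x => ?_) <;>
      · have a1 := @h1 x
        have a2 := @h2 x
        have a3 := hmem x
        have a4 := @hd x
        simp only [Set.mem_sdiff, Set.mem_singleton_iff]
        tauto
    · rw [signedCutOn_union]
      exact ⟨f, hfB, hf.2⟩
    · intro C hC hne hlt
      obtain ⟨Y, hY, rfl⟩ := h.mem_circuits.1 hC
      rw [signedCutOn_union] at hne hlt
      rw [signedCutOn_union, heq] at hlt
      exact hmin Y (by rwa [hc]) (by rwa [hc])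

/-! ### Redundant edges and butterfly-contractible elements -/

/-- Every potential that decreases along the edges of `G` other than `e` decreases along `e`. -/
def IsRedundant (D : MultiDigraph V α) (G : Set α) (e : α) : Prop :=
  ∀ k : V → ℤ, (∀ f ∈ G, f ≠ e → k (D.head f) ≤ k (D.tail f)) → k (D.head e) ≤ k (D.tail e)

/-- Forgetting the coordinate `e` maps the cone isomorphically onto the cone without `e`:
nonnegativity at `e` is implied by the other coordinates, and so is the value there. -/
theorem IsRedundant.exists_isAmbiguous_iff {G : Set α} (hr : D.IsRedundant G e) (he : e ∈ G) :
    (∃ w, (D.cone (G \ {e})).IsAmbiguous w) ↔ ∃ w, (D.cone G).IsAmbiguous w := by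
  classical
  let f : (α → ℕ) →+ (α → ℕ) :=
    { toFun := fun w x => if x = e then 0 else w x
      map_zero' := by
        funext x
        simp
      map_add' := fun u v => by
        funext x
        simp only [Pi.add_apply]
        split_ifs <;> rfl }
  have hfe : ∀ w, f w e = 0 := fun w => if_pos rfl
  have hf : ∀ w x, x ≠ e → f w x = w x := fun w x hx => if_neg hx
  have hinj : Set.InjOn f (D.cone G) := by
    rintro x ⟨⟨k, hk⟩, hx⟩ y ⟨⟨l, hl⟩, hy⟩ hxy
    have hne : ∀ g, g ≠ e → x g = y g := fun g hg => by
      rw [← hf x g hg, ← hf y g hg, hxy]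
    -- The two potentials have the same differences off `e`; redundancy, applied to their difference
    -- in both orders, gives equality along `e`.
    have h1 := hr (k - l) fun g hg hge => by
      have a1 := hk g hg
      have a2 := hl g hg
      rw [hne g hge] at a1
      simp only [Pi.sub_apply]
      omega
    have h2 := hr (l - k) fun g hg hge => by
      have a1 := hk g hg
      have a2 := hl g hg
      rw [hne g hge] at a1
      simp only [Pi.sub_apply]
      omega
    funext g
    by_cases hge : g = e
    · subst hge
      have a1 := hk g he
      have a2 := hl g he
      simp only [Pi.sub_apply] at h1 h2
      omega
    · exact hne g hge
  have hmap : (D.cone G).map f = D.cone (G \ {e}) := by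
    ext w
    constructor
    · rintro ⟨w, ⟨⟨k, hk⟩, h0⟩, rfl⟩
      refine ⟨⟨k, fun g hg => ?_⟩, fun g hg => ?_⟩
      · rw [hf w g hg.2]
        exact hk g hg.1
      · by_cases hge : g = e
        · rw [hge, hfe]
        · rw [hf w g hge]
          exact h0 g fun h => hg ⟨h, hge⟩
    · rintro ⟨⟨k, hk⟩, h0⟩
      have hke := hr k fun g hg hge => by
        have := hk g ⟨hg, hge⟩
        omega
      -- Redundancy makes the difference along `e` nonnegative, so `toNat` does not truncate it.
      refine ⟨fun x => if x = e then (k (D.tail e) - k (D.head e)).toNat else w x,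
        ⟨⟨k, fun g hg => ?_⟩, fun g hg => ?_⟩, ?_⟩
      · dsimp only
        split_ifs with hge
        · rw [hge]
          omega
        · exact hk g ⟨hg, hge⟩
      · have hge : g ≠ e := by
          rintro rfl
          exact hg he
        exact (if_neg hge).trans (h0 g fun h => hg h.1)
      · funext g
        by_cases hge : g = e
        · rw [hge, hfe, h0]
          exact fun h => h.2 rfl
        · rw [hf _ g hge, if_neg hge]
  constructor
  · rintro ⟨w, hw⟩
    rw [← hmap] at hw
    obtain ⟨v, hv, rfl⟩ := hw.1.mem
    exact ⟨v, (isAmbiguous_map_iff f hinj hv).1 hw⟩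
  · rintro ⟨w, hw⟩
    refine ⟨f w, ?_⟩
    rw [← hmap]
    exact (isAmbiguous_map_iff f hinj hw.1.mem).2 hw

/-- A potential violating the inequality only at `e` has a level cut whose only backward edge is
`e`. A bond inside it through `e` agrees in sign with the cocircuit at `e` and opposes it nowhere,
contradicting orthogonality. -/
theorem Represents.isRedundant (h : D.Represents M) (he : e ∈ M.E)
    (hb : M.IsButterflyContractible e) : D.IsRedundant M.E e := by
  intro k hk
  by_contra hlt
  obtain ⟨S, heS, ⟨-, -, horth⟩, -⟩ := hb
  obtain ⟨X, hX, heX, h1, h2⟩ := exists_isBondSideOn (D := D) (W := {v | k (D.head e) ≤ k v})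
    M.finite (e := e) (mem_cutOn.2 ⟨by simp only [Set.mem_ofPred_eq]; omega, he⟩)
  have hsub : (D.signedCutOn M.E X).2 ⊆ {e} := by
    intro f hf
    obtain ⟨⟨a, b⟩, hfE⟩ := mem_signedCutOn_snd.1 (h2 hf)
    by_contra hfe
    have := hk f hfE hfe
    simp only [Set.mem_ofPred_eq] at a b
    omega
  have he2 : e ∈ (D.signedCutOn M.E X).2 := by
    rw [← signedCutOn_union] at heX
    refine heX.resolve_left fun he1 => ?_
    have := (h1 he1).1.1
    simp only [Set.mem_ofPred_eq] at this
    omega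
  obtain ⟨x, hx⟩ := (horth _ (h.mem_circuits.2 ⟨X, hX, rfl⟩)).1 ⟨e, Or.inr ⟨rfl, he2⟩⟩
  rcases hx with hx | hx
  · exact hx.1.2 (hsub hx.2)
  · obtain rfl : x = e := hx.1
    exact Set.disjoint_left.1 signedCutOn_disjoint hx.2 he2

end MultiDigraph

/-! ### Signed cocircuits from parallel edges and transitive triangles -/

namespace MultiDigraph

open AddSubmonoid OrientedMatroid

variable {V α : Type*} {D : MultiDigraph V α} {M : OrientedMatroid α} {e f g : α}

/-- Orthogonality to a bond inside the cut through `x` needs a second common element with the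
opposite sign relation. This proves the minimality of the short cycles below, using stars of
vertices as cuts. -/
theorem Represents.exists_ne_mem_cutOn (h : D.Represents M) {T : Set α × Set α}
    (hT : M.IsOrthogonal T) {X : Set V} {x : α} (hxT : x ∈ T.1 ∪ T.2) (hx : x ∈ D.cutOn M.E X) :
    ∃ y ∈ T.1 ∪ T.2, y ≠ x ∧ y ∈ D.cutOn M.E X := by
  obtain ⟨B, hB, hxB, h1, h2⟩ := exists_isBondSideOn M.finite hx
  have hBX := cutOn_subset_of_signedCutOn_subset h1 h2
  have horth := hT.2.2 _ (h.mem_circuits.2 ⟨B, hB, rfl⟩)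
  have hd := Set.disjoint_left.1 hT.2.1
  have hd' := Set.disjoint_left.1 (D.signedCutOn_disjoint (G := M.E) (X := B))
  rw [← signedCutOn_union] at hxB hBX
  have key : ∀ y, (x ∈ (T.1 ∩ (D.signedCutOn M.E B).1) ∪ (T.2 ∩ (D.signedCutOn M.E B).2) ∧
      y ∈ (T.1 ∩ (D.signedCutOn M.E B).2) ∪ (T.2 ∩ (D.signedCutOn M.E B).1)) ∨
      (x ∈ (T.1 ∩ (D.signedCutOn M.E B).2) ∪ (T.2 ∩ (D.signedCutOn M.E B).1) ∧
      y ∈ (T.1 ∩ (D.signedCutOn M.E B).1) ∪ (T.2 ∩ (D.signedCutOn M.E B).2)) →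
      y ∈ T.1 ∪ T.2 ∧ y ≠ x ∧ y ∈ D.cutOn M.E X := by
    intro y hy
    simp only [Set.mem_union, Set.mem_inter_iff] at hy ⊢
    refine ⟨by tauto, ?_, hBX (by simp only [Set.mem_union]; tauto)⟩
    rintro rfl
    have := @hd y
    have := @hd' y
    tauto
  have hor : x ∈ (T.1 ∩ (D.signedCutOn M.E B).1) ∪ (T.2 ∩ (D.signedCutOn M.E B).2) ∨
      x ∈ (T.1 ∩ (D.signedCutOn M.E B).2) ∪ (T.2 ∩ (D.signedCutOn M.E B).1) := by
    simp only [Set.mem_union, Set.mem_inter_iff] at hxT hxB ⊢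
    tauto
  rcases hor with hx | hx
  · obtain ⟨y, hy⟩ := horth.1 ⟨x, hx⟩
    exact ⟨y, key y (Or.inl ⟨hx, hy⟩)⟩
  · obtain ⟨y, hy⟩ := horth.2 ⟨x, hx⟩
    exact ⟨y, key y (Or.inr ⟨hx, hy⟩)⟩

/-- The cycle formed by two parallel edges, with `e` traversed backwards, is a signed cocircuit. -/
theorem Represents.isButterflyContractible_of_parallel (h : D.Represents M) (he : e ∈ M.E)
    (hf : f ∈ M.E) (hne : f ≠ e) (ht : D.tail f = D.tail e) (hh : D.head f = D.head e)
    (hl : D.tail e ≠ D.head e) : M.IsButterflyContractible e := by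
  have hdiff : ({e, f} : Set α) \ {e} = {f} := by
    rw [Set.insert_sdiff_self_of_notMem]
    simpa using hne.symm
  refine ⟨{e, f}, Or.inl rfl, ?_⟩
  rw [hdiff]
  refine ⟨⟨?_, ?_, fun C hC => ?_⟩, ⟨f, Or.inl rfl⟩, fun T hT ⟨x, hx⟩ hlt => ?_⟩
  · rintro x (rfl | rfl) <;> assumption
  · simpa using hne
  · obtain ⟨X, -, rfl⟩ := h.mem_circuits.1 hC
    have h1 : f ∈ (D.signedCutOn M.E X).1 ↔ e ∈ (D.signedCutOn M.E X).1 := by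
      rw [mem_signedCutOn_fst, mem_signedCutOn_fst, ht, hh]
      tauto
    have h2 : f ∈ (D.signedCutOn M.E X).2 ↔ e ∈ (D.signedCutOn M.E X).2 := by
      rw [mem_signedCutOn_snd, mem_signedCutOn_snd, ht, hh]
      tauto
    simp only [Set.union_nonempty, Set.singleton_inter_nonempty, h1, h2]
    tauto
  · have hce : e ∈ D.cutOn M.E {D.tail e} := mem_cutOn.2 ⟨by simpa using hl.symm, he⟩
    have hcf : f ∈ D.cutOn M.E {D.tail e} := mem_cutOn.2 ⟨by simpa [ht, hh] using hl.symm, hf⟩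
    have hall : f ∈ T.1 ∪ T.2 ∧ e ∈ T.1 ∪ T.2 := by
      rcases hlt.1 hx with rfl | rfl
      · obtain ⟨y, hy, hyx, -⟩ := h.exists_ne_mem_cutOn hT hx hcf
        rcases hlt.1 hy with rfl | rfl
        · exact absurd rfl hyx
        · exact ⟨hx, hy⟩
      · obtain ⟨y, hy, hyx, -⟩ := h.exists_ne_mem_cutOn hT hx hce
        rcases hlt.1 hy with rfl | rfl
        · exact ⟨hy, hx⟩
        · exact absurd rfl hyx
    refine hlt.2 ?_
    rintro y (rfl | rfl)
    exacts [hall.1, hall.2]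

/-- In the cycle that follows `f` and `g` and returns along `e`, only `e` is traversed backwards.
Each vertex star meets the triangle in two edges, so no proper part is orthogonal. -/
theorem Represents.isButterflyContractible_of_triangle (h : D.Represents M) (he : e ∈ M.E)
    (hf : f ∈ M.E) (hg : g ∈ M.E) (htf : D.tail f = D.tail e) (hfg : D.head f = D.tail g)
    (hhg : D.head g = D.head e) (hle : D.tail e ≠ D.head e) (hlf : D.tail f ≠ D.head f)
    (hlg : D.tail g ≠ D.head g) : M.IsButterflyContractible e := by
  have hfe : f ≠ e := by
    rintro rfl
    exact hlg (hfg.symm.trans hhg.symm)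
  have hge : g ≠ e := by
    rintro rfl
    exact hlf (htf.trans hfg.symm)
  have hdiff : ({e, f, g} : Set α) \ {e} = {f, g} := by
    rw [Set.insert_sdiff_self_of_notMem]
    simp [hfe.symm, hge.symm]
  refine ⟨{e, f, g}, Or.inl rfl, ?_⟩
  rw [hdiff]
  refine ⟨⟨?_, ?_, fun C hC => ?_⟩, ⟨f, Or.inl (Or.inl rfl)⟩, fun T hT ⟨x, hx⟩ hlt => ?_⟩
  · rintro x ((rfl | rfl) | rfl) <;> assumption
  · rw [Set.disjoint_singleton_right]
    simp [hfe.symm, hge.symm]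
  · obtain ⟨X, -, rfl⟩ := h.mem_circuits.1 hC
    have h1 : ∀ S : Set α, (({f, g} : Set α) ∩ S).Nonempty ↔ f ∈ S ∨ g ∈ S := by
      intro S
      constructor
      · rintro ⟨x, rfl | rfl, hx⟩
        exacts [Or.inl hx, Or.inr hx]
      · rintro (hx | hx)
        exacts [⟨f, Or.inl rfl, hx⟩, ⟨g, Or.inr rfl, hx⟩]
    simp only [Set.union_nonempty, Set.singleton_inter_nonempty, h1, mem_signedCutOn_fst,
      mem_signedCutOn_snd, he, hf, hg, and_true, htf, hfg, hhg]
    tauto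
  · have hct : ∀ x, x ∈ D.cutOn M.E {D.tail e} → x = e ∨ x = f ∨ x = g → x = e ∨ x = f := by
      rintro x hx (rfl | rfl | rfl)
      · exact Or.inl rfl
      · exact Or.inr rfl
      · refine absurd ?_ (mem_cutOn.1 hx).1
        rw [← htf, Set.mem_singleton_iff, Set.mem_singleton_iff, htf, hhg, ← hfg, ← htf]
        exact iff_of_false (Ne.symm hlf) (htf ▸ hle.symm)
    have hch : ∀ x, x ∈ D.cutOn M.E {D.head e} → x = e ∨ x = f ∨ x = g → x = e ∨ x = g := by
      rintro x hx (rfl | rfl | rfl)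
      · exact Or.inl rfl
      · refine absurd ?_ (mem_cutOn.1 hx).1
        rw [Set.mem_singleton_iff, Set.mem_singleton_iff, htf, hfg, ← hhg]
        exact iff_of_false (hhg ▸ hle) hlg
      · exact Or.inr rfl
    have het : e ∈ D.cutOn M.E {D.tail e} := mem_cutOn.2 ⟨by simpa using hle.symm, he⟩
    have heh : e ∈ D.cutOn M.E {D.head e} := mem_cutOn.2 ⟨by simpa using hle, he⟩
    have hft : f ∈ D.cutOn M.E {D.tail e} :=
      mem_cutOn.2 ⟨by simpa [htf] using fun h => hlf (htf.trans h.symm), hf⟩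
    have hgh : g ∈ D.cutOn M.E {D.head e} :=
      mem_cutOn.2 ⟨by simpa [hhg] using fun h => hlg (h.trans hhg.symm), hg⟩
    have hT' : ∀ y ∈ T.1 ∪ T.2, y = e ∨ y = f ∨ y = g := by
      intro y hy
      rcases hlt.1 hy with (hy | hy) | hy
      exacts [Or.inr (Or.inl hy), Or.inr (Or.inr hy), Or.inl hy]
    have heT : e ∈ T.1 ∪ T.2 := by
      rcases hT' x hx with rfl | rfl | rfl
      · exact hx
      · obtain ⟨y, hy, hyx, hyc⟩ := h.exists_ne_mem_cutOn hT hx hft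
        rcases hct y hyc (hT' y hy) with rfl | rfl
        exacts [hy, absurd rfl hyx]
      · obtain ⟨y, hy, hyx, hyc⟩ := h.exists_ne_mem_cutOn hT hx hgh
        rcases hch y hyc (hT' y hy) with rfl | rfl
        exacts [hy, absurd rfl hyx]
    refine hlt.2 ?_
    rintro y ((rfl | rfl) | rfl)
    · obtain ⟨z, hz, hzx, hzc⟩ := h.exists_ne_mem_cutOn hT heT het
      rcases hct z hzc (hT' z hz) with rfl | rfl
      exacts [absurd rfl hzx, hz]
    · obtain ⟨z, hz, hzx, hzc⟩ := h.exists_ne_mem_cutOn hT heT heh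
      rcases hch z hzc (hT' z hz) with rfl | rfl
      exacts [absurd rfl hzx, hz]
    · exact heT

theorem isRedundant_of_parallel {G : Set α} (hf : f ∈ G) (hne : f ≠ e)
    (ht : D.tail f = D.tail e) (hh : D.head f = D.head e) : D.IsRedundant G e := by
  intro k hk
  rw [← ht, ← hh]
  exact hk f hf hne

theorem isRedundant_of_triangle {G : Set α} (hf : f ∈ G) (hg : g ∈ G) (hfe : f ≠ e) (hge : g ≠ e)
    (htf : D.tail f = D.tail e) (hfg : D.head f = D.tail g) (hhg : D.head g = D.head e) :
    D.IsRedundant G e := by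
  intro k hk
  rw [← htf, ← hhg]
  exact (hk g hg hge).trans (hfg ▸ hk f hf hfe)

/-! ### Tensions determine the oriented matroid -/

/-- The restrictions to `G` of integral potential differences. -/
def tensions (D : MultiDigraph V α) (G : Set α) : Set (G → ℤ) :=
  {u | ∃ k : V → ℤ, ∀ x : G, u x = k (D.tail x) - k (D.head x)}

/-- The signed circuits of a represented oriented matroid are the sign patterns of the nonzero
tensions of minimal support. -/
theorem Represents.image_mem_circuits_iff (h : D.Represents M) (P Q : Set M.E) :
    ((Subtype.val '' P, Subtype.val '' Q) : Set α × Set α) ∈ M.circuits ↔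
      ∃ u ∈ D.tensions M.E, u ≠ 0 ∧ P = {x | 0 < u x} ∧ Q = {x | u x < 0} ∧
        ∀ u' ∈ D.tensions M.E, u' ≠ 0 → ¬ Function.support u' ⊂ Function.support u := by
  classical
  -- A nonzero tension conformally contains a nonempty cut.
  have level : ∀ u ∈ D.tensions M.E, u ≠ 0 → ∃ X, (D.cutOn M.E X).Nonempty ∧
      (D.signedCutOn M.E X).1 ⊆ Subtype.val '' {x | 0 < u x} ∧
      (D.signedCutOn M.E X).2 ⊆ Subtype.val '' {x | u x < 0} := by
    rintro u ⟨k, hk⟩ hu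
    obtain ⟨x, hx⟩ := Function.ne_iff.1 hu
    -- The maximum of the two end values puts `x` in the cut whatever the sign of `u x`.
    refine ⟨{v | max (k (D.tail x)) (k (D.head x)) ≤ k v}, ⟨x, mem_cutOn.2 ⟨?_, x.2⟩⟩, ?_, ?_⟩
    · have := hk x
      simp only [Set.mem_ofPred_eq, Pi.zero_apply] at hx ⊢
      omega
    · rintro y ⟨⟨h1, h2⟩, hy⟩
      refine ⟨⟨y, hy⟩, ?_, rfl⟩
      have : u ⟨y, hy⟩ = k (D.tail y) - k (D.head y) := hk ⟨y, hy⟩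
      simp only [Set.mem_ofPred_eq] at h1 h2 ⊢
      omega
    · rintro y ⟨⟨h1, h2⟩, hy⟩
      refine ⟨⟨y, hy⟩, ?_, rfl⟩
      have : u ⟨y, hy⟩ = k (D.tail y) - k (D.head y) := hk ⟨y, hy⟩
      simp only [Set.mem_ofPred_eq] at h1 h2 ⊢
      omega
  have supp : ∀ u : M.E → ℤ, Function.support u = {x | 0 < u x} ∪ {x | u x < 0} := by
    intro u
    ext x
    simp only [Function.mem_support, Set.mem_union, Set.mem_ofPred_eq]
    omega
  -- The tension of a cut.
  have cutvec : ∀ X, ∃ u ∈ D.tensions M.E,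
      Subtype.val '' {x : M.E | 0 < u x} = (D.signedCutOn M.E X).1 ∧
      Subtype.val '' {x : M.E | u x < 0} = (D.signedCutOn M.E X).2 := by
    intro X
    refine ⟨fun x => (if D.tail x ∈ X then 1 else 0) - (if D.head x ∈ X then 1 else 0),
      ⟨fun v => if v ∈ X then 1 else 0, fun _ => rfl⟩, ?_, ?_⟩
    · ext y
      rw [mem_signedCutOn_fst]
      constructor
      · rintro ⟨x, hx, rfl⟩
        refine ⟨?_, x.2⟩
        by_cases h1 : D.tail x ∈ X <;> by_cases h2 : D.head x ∈ X <;> simp_all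
      · rintro ⟨⟨h1, h2⟩, hy⟩
        exact ⟨⟨y, hy⟩, by simp [h1, h2], rfl⟩
    · ext y
      rw [mem_signedCutOn_snd]
      constructor
      · rintro ⟨x, hx, rfl⟩
        refine ⟨?_, x.2⟩
        by_cases h1 : D.tail x ∈ X <;> by_cases h2 : D.head x ∈ X <;> simp_all
      · rintro ⟨⟨h1, h2⟩, hy⟩
        exact ⟨⟨y, hy⟩, by simp [h1, h2], rfl⟩
  have suppimg : ∀ u : M.E → ℤ, Subtype.val '' Function.support u =
      Subtype.val '' {x | 0 < u x} ∪ Subtype.val '' {x | u x < 0} := by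
    intro u
    rw [supp, Set.image_union]
  constructor
  · intro hPQ
    obtain ⟨X, hX, hXe⟩ := h.mem_circuits.1 hPQ
    obtain ⟨u, hu, h1, h2⟩ := cutvec X
    have hs : Subtype.val '' Function.support u = D.cutOn M.E X := by
      rw [suppimg, h1, h2, signedCutOn_union]
    obtain ⟨e1, e2⟩ := Prod.ext_iff.1 hXe
    refine ⟨u, hu, ?_, ?_, ?_, fun u' hu' hu0 hlt => ?_⟩
    · rintro rfl
      obtain ⟨x, hx⟩ := hX.1
      rw [← hs] at hx
      simp at hx
    · exact Subtype.val_injective.image_injective (e1.trans h1.symm)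
    · exact Subtype.val_injective.image_injective (e2.trans h2.symm)
    · obtain ⟨Y, hY, a1, a2⟩ := level u' hu' hu0
      refine hX.2 Y hY ?_
      rw [← hs]
      refine lt_of_le_of_lt ?_ (Subtype.val_injective.image_strictMono hlt)
      rw [suppimg, ← signedCutOn_union]
      exact Set.union_subset_union a1 a2
  · rintro ⟨u, hu, hu0, rfl, rfl, hmin⟩
    obtain ⟨X, hX, a1, a2⟩ := level u hu hu0
    have hsub : ∀ Y, (D.cutOn M.E Y).Nonempty →
        D.cutOn M.E Y ⊆ Subtype.val '' Function.support u →
        D.cutOn M.E Y = Subtype.val '' Function.support u := by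
      intro Y hY hYs
      obtain ⟨u', hu', h1, h2⟩ := cutvec Y
      have hs : Subtype.val '' Function.support u' = D.cutOn M.E Y := by
        rw [suppimg, h1, h2, signedCutOn_union]
      by_contra hne
      refine hmin u' hu' ?_ ?_
      · rintro rfl
        rw [← hs] at hY
        simp at hY
      · rw [← hs] at hne hYs
        refine ((Set.image_subset_image_iff Subtype.val_injective).1 hYs).ssubset_of_ne ?_
        rintro heq
        exact hne (by rw [heq])
    have hXs : D.cutOn M.E X = Subtype.val '' Function.support u := by
      refine hsub X hX ?_
      rw [suppimg, ← signedCutOn_union]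
      exact Set.union_subset_union a1 a2
    refine h.mem_circuits.2 ⟨X, ⟨hX, fun Y hY hlt => ?_⟩, ?_⟩
    · rw [hXs] at hlt
      exact hlt.ne (hsub Y hY hlt.1)
    · rw [suppimg, ← signedCutOn_union] at hXs
      have hd : Disjoint (Subtype.val '' {x | 0 < u x} : Set α) (Subtype.val '' {x | u x < 0}) := by
        refine Set.disjoint_image_of_injective Subtype.val_injective ?_
        refine Set.disjoint_left.2 fun x h1 h2 => ?_
        simp only [Set.mem_ofPred_eq] at h1 h2
        omega
      have hd' := Set.disjoint_left.1 hd
      have hm : ∀ y, y ∈ (D.signedCutOn M.E X).1 ∨ y ∈ (D.signedCutOn M.E X).2 ↔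
          y ∈ (Subtype.val '' {x | 0 < u x} : Set α) ∨
            y ∈ (Subtype.val '' {x | u x < 0} : Set α) := fun y => by
        rw [← Set.mem_union, hXs, Set.mem_union]
      refine Prod.ext (Set.ext fun y => ?_) (Set.ext fun y => ?_) <;>
      · have b1 := @a1 y
        have b2 := @a2 y
        have b3 := @hd' y
        have b4 := hm y
        tauto

/-- Signed circuits are read off from the tensions, so a bijection of edges preserving tensions
suffices; the digraphs themselves need not be isomorphic. -/
theorem Represents.isIsomorphic {W β : Type*} {D' : MultiDigraph W β} {N : OrientedMatroid β}
    (h : D.Represents M) (h' : D'.Represents N) (σ : M.E ≃ N.E)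
    (hσ : ∀ u : N.E → ℤ, u ∘ σ ∈ D.tensions M.E ↔ u ∈ D'.tensions N.E) : M.IsIsomorphic N := by
  refine ⟨σ, fun P Q => ?_⟩
  have himg : ∀ P : Set M.E, (fun x : M.E => (σ x : β)) '' P = Subtype.val '' (σ '' P) := fun P =>
    (Set.image_image _ _ _).symm
  rw [himg, himg, h'.image_mem_circuits_iff]
  refine (h.image_mem_circuits_iff P Q).trans ?_
  have hsupp : ∀ u : N.E → ℤ, Function.support (u ∘ σ) = σ ⁻¹' Function.support u := fun _ => rfl
  have hlt : ∀ S T : Set N.E, σ ⁻¹' S ⊂ σ ⁻¹' T ↔ S ⊂ T := by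
    intro S T
    rw [ssubset_iff_subset_ne, ssubset_iff_subset_ne, σ.surjective.preimage_subset_preimage_iff,
      (σ.surjective.preimage_injective.ne_iff)]
  have h0 : ∀ u : N.E → ℤ, u ∘ σ = 0 ↔ u = 0 := fun u =>
    ⟨fun h => σ.surjective.injective_comp_right h, fun h => by rw [h]; rfl⟩
  have hex : ∀ u : M.E → ℤ, ∃ u' : N.E → ℤ, u = u' ∘ σ := fun u => ⟨u ∘ σ.symm, by
    funext x
    simp⟩
  have himg' : ∀ (P : Set M.E) (S : Set N.E), P = σ ⁻¹' S ↔ σ '' P = S := fun P S =>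
    ⟨by rintro rfl; exact Set.image_preimage_eq S σ.surjective,
      by rintro rfl; exact (Set.preimage_image_eq P σ.injective).symm⟩
  constructor
  · rintro ⟨u, hu, hu0, hP, hQ, hmin⟩
    obtain ⟨u, rfl⟩ := hex u
    refine ⟨u, (hσ u).1 hu, fun h => hu0 ((h0 u).2 h), (himg' _ _).1 hP, (himg' _ _).1 hQ,
      fun v hv hv0 hvu => ?_⟩
    refine hmin (v ∘ σ) ((hσ v).2 hv) (fun h => hv0 ((h0 v).1 h)) ?_
    rwa [hsupp, hsupp, hlt]
  · rintro ⟨u, hu, hu0, hP, hQ, hmin⟩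
    refine ⟨u ∘ σ, (hσ u).2 hu, fun h => hu0 ((h0 u).1 h), (himg' _ _).2 hP, (himg' _ _).2 hQ,
      fun v hv hv0 hvu => ?_⟩
    obtain ⟨v, rfl⟩ := hex v
    refine hmin v ((hσ v).1 hv) (fun h => hv0 ((h0 v).2 h)) ?_
    rwa [hsupp, hsupp, hlt] at hvu

end MultiDigraph

/-! ### Regularity, and the obstructions are not non-even -/

namespace MultiDigraph

open AddSubmonoid OrientedMatroid

/-- Over any field, map each edge to its class modulo the space of tensions. A dependency among
these vectors is a tension supported in `I`, and such a nonzero tension exists exactly when `I`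
contains a bond. -/
theorem Represents.isRegular {V : Type*} {α : Type u} {D : MultiDigraph V α}
    {M : OrientedMatroid α} (h : D.Represents M) : Matroid.IsRegular.{u, w} M.underlying := by
  classical
  intro F _
  have := M.finite.to_subtype
  let δ : (V → F) →ₗ[F] (M.E → F) :=
    LinearMap.funLeft F F (fun x : M.E => D.tail x) - LinearMap.funLeft F F fun x : M.E => D.head x
  let r : (α →₀ F) →ₗ[F] (M.E → F) :=
    LinearMap.funLeft F F (Subtype.val : M.E → α) ∘ₗ Finsupp.lcoeFun
  let b := Module.finBasis F ((M.E → F) ⧸ LinearMap.range δ)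
  let L : (α →₀ F) →ₗ[F] (Fin _ → F) := b.equivFun.toLinearMap ∘ₗ (LinearMap.range δ).mkQ ∘ₗ r
  have hL : ∀ l, L l = 0 ↔ ∃ k : V → F, ∀ x ∈ M.E, l x = k (D.tail x) - k (D.head x) := by
    intro l
    have : L l = 0 ↔ r l ∈ LinearMap.range δ := by
      rw [← Submodule.Quotient.mk_eq_zero]
      exact b.equivFun.map_eq_zero_iff
    rw [this]
    constructor
    · rintro ⟨k, hk⟩
      exact ⟨k, fun x hx => (congrFun hk ⟨x, hx⟩).symm⟩
    · rintro ⟨k, hk⟩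
      exact ⟨k, funext fun x => (hk x x.2).symm⟩
  refine ⟨_, fun a => L (Finsupp.single a 1), fun I hI => ?_⟩
  have hcomb : Finsupp.linearCombination F (fun a => L (Finsupp.single a 1)) = L := by
    ext a : 2
    simp
  rw [linearIndepOn_iff, hcomb, underlying_indep_iff]
  constructor
  · rintro ⟨-, hind⟩ l hl h0
    obtain ⟨k, hk⟩ := (hL l).1 h0
    rw [Finsupp.mem_supported] at hl
    by_contra hne
    obtain ⟨x, hx⟩ := Finsupp.ne_iff.1 hne
    rw [Finsupp.zero_apply] at hx
    have hxE := hI (hl (Finsupp.mem_support_iff.2 hx))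
    rw [hk x hxE, sub_ne_zero] at hx
    -- A field has no order to cut by, so the fibre of `k` through one end of `x` is used; every
    -- edge leaving or entering it has nonzero tension.
    obtain ⟨B, hB, -, h1, h2⟩ := exists_isBondSideOn (D := D) (W := {v | k v = k (D.tail x)})
      M.finite (e := x) (mem_cutOn.2 ⟨by simpa using hx.symm, hxE⟩)
    refine hind _ (h.mem_circuits.2 ⟨B, hB, rfl⟩) ?_
    rw [signedCutOn_union]
    refine (cutOn_subset_of_signedCutOn_subset h1 h2).trans fun y hy => ?_
    obtain ⟨hy, hyE⟩ := mem_cutOn.1 hy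
    refine hl (Finsupp.mem_support_iff.2 ?_)
    rw [hk y hyE, sub_ne_zero]
    intro heq
    simp only [Set.mem_ofPred_eq, heq, not_true_eq_false] at hy
  · intro hind
    refine ⟨hI, fun C hC hCI => ?_⟩
    obtain ⟨X, hX, rfl⟩ := h.mem_circuits.1 hC
    rw [signedCutOn_union] at hCI
    let k : V → F := fun v => if v ∈ X then 1 else 0
    let l : α →₀ F := Finsupp.onFinset M.finite.toFinset
      (fun x => if x ∈ M.E then k (D.tail x) - k (D.head x) else 0) fun x hx => by
        by_contra hxE
        simp at hxE
        simp [hxE] at hx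
    have hl : ∀ x ∈ M.E, l x = k (D.tail x) - k (D.head x) := fun x hx => if_pos hx
    have hlX : ∀ x, l x ≠ 0 ↔ x ∈ D.cutOn M.E X := by
      intro x
      rw [mem_cutOn]
      by_cases hx : x ∈ M.E
      · rw [hl x hx]
        by_cases h1 : D.tail x ∈ X <;> by_cases h2 : D.head x ∈ X <;> simp [k, h1, h2, hx]
      · have : l x = 0 := if_neg hx
        simp [this, hx]
    have h0 := hind l (by
      rw [Finsupp.mem_supported]
      exact fun x hx => hCI ((hlX x).1 (Finsupp.mem_support_iff.1 hx))) ((hL l).2 ⟨k, hl⟩)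
    obtain ⟨x, hx⟩ := hX.1
    rw [← hlX, h0] at hx
    exact hx rfl

/-- A second vertex `i'` of the same class keeps the opposite class on one side of any smaller cut,
so that cut contains all or none of the star. -/
theorem completeBipartite_isBondSide_inl {m n : ℕ} (hm : 2 ≤ m) (hn : 2 ≤ n) (i : Fin m) :
    (completeBipartite m n).IsBondSide {Sum.inl i} := by
  have : Nontrivial (Fin m) := Fin.nontrivial_iff_two_le.2 hm
  have hmem : ∀ e, e ∈ (completeBipartite m n).cut {Sum.inl i} ↔ e.1 = i := by
    intro e
    simp [mem_cut, completeBipartite]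
  refine ⟨⟨(i, ⟨0, by omega⟩), (hmem _).2 rfl⟩, fun Y ⟨e, he⟩ hlt => hlt.2 fun f hf => ?_⟩
  obtain ⟨i', hi'⟩ := exists_ne i
  have hei := (hmem e).1 (hlt.1 he)
  rw [hmem] at hf
  have key : ∀ j, (Sum.inl i' ∈ Y ↔ Sum.inr j ∈ Y) := by
    intro j
    by_contra h
    exact hi' ((hmem (i', j)).1 (hlt.1 ((mem_cut _ Y (i', j)).2 h)))
  rw [mem_cut] at he ⊢
  simp only [completeBipartite, hei, hf, ← key] at he ⊢
  exact he

/-- The complement of the vertex is used as the side so that all edges of the star leave it. -/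
theorem completeBipartite_isBondSide_inr {m n : ℕ} (hm : 2 ≤ m) (hn : 2 ≤ n) (j : Fin n) :
    (completeBipartite m n).IsBondSide {Sum.inr j}ᶜ := by
  have : Nontrivial (Fin n) := Fin.nontrivial_iff_two_le.2 hn
  have hmem : ∀ e, e ∈ (completeBipartite m n).cut {Sum.inr j}ᶜ ↔ e.2 = j := by
    intro e
    simp [mem_cut, completeBipartite]
  refine ⟨⟨(⟨0, by omega⟩, j), (hmem _).2 rfl⟩, fun Y ⟨e, he⟩ hlt => hlt.2 fun f hf => ?_⟩
  obtain ⟨j', hj'⟩ := exists_ne j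
  have hej := (hmem e).1 (hlt.1 he)
  rw [hmem] at hf
  have key : ∀ i, (Sum.inl i ∈ Y ↔ Sum.inr j' ∈ Y) := by
    intro i
    by_contra h
    exact hj' ((hmem (i, j')).1 (hlt.1 ((mem_cut _ Y (i, j')).2 h)))
  rw [mem_cut] at he ⊢
  simp only [completeBipartite, hej, hf, key] at he ⊢
  exact he

/-- Counting `J` by rows gives `m` and by columns gives `n` modulo two, as every star is a directed
bond. -/
theorem not_exists_odd_of_isIsomorphic_completeBipartite {α : Type*} {N : OrientedMatroid α}
    {m n : ℕ} (hm : 2 ≤ m) (hn : 2 ≤ n) (hodd : Odd (m + n))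
    (h : N.IsIsomorphic (completeBipartite m n).bondMatroid) :
    ¬ ∃ J ⊆ N.E, ∀ C ∈ N.circuits, IsDirected C → Odd ((C.1 ∪ C.2) ∩ J).ncard := by
  classical
  rintro ⟨J, -, hJ⟩
  obtain ⟨σ, hσ⟩ := h
  let τ : N.E → Fin m × Fin n := fun x => (σ x : Fin m × Fin n)
  have hτ : Function.Bijective τ :=
    ⟨fun x y h => σ.injective (Subtype.ext h), fun y => ⟨σ.symm ⟨y, Set.mem_univ y⟩, by simp [τ]⟩⟩
  let J' : Finset (Fin m × Fin n) := Finset.univ.filter fun y => ∃ x : N.E, τ x = y ∧ ↑x ∈ J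
  have key : ∀ X : Set (Fin m ⊕ Fin n), (completeBipartite m n).IsBondSide X →
      ((completeBipartite m n).signedCut X).2 = ∅ →
      Odd (J'.filter (· ∈ ((completeBipartite m n).signedCut X).1)).card := by
    intro X hX h2
    set S := ((completeBipartite m n).signedCut X).1 with hS
    have hC : ((Subtype.val '' (τ ⁻¹' S), Subtype.val '' (∅ : Set N.E)) : Set α × Set α) ∈
        N.circuits := by
      refine (hσ _ _).2 ⟨X, hX, ?_⟩
      refine Prod.ext (Set.image_preimage_eq S hτ.2) ?_
      rw [h2]
      exact Set.image_empty _
    have := hJ _ hC (Or.inr (Set.image_empty _))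
    rw [Set.image_empty, Set.union_empty] at this
    convert this using 1
    rw [← Set.ncard_coe_finset]
    have e1 : (Subtype.val '' (τ ⁻¹' S) ∩ J : Set α) =
        Subtype.val '' {x : N.E | τ x ∈ S ∧ ↑x ∈ J} := by
      ext a
      constructor
      · rintro ⟨⟨x, hx, rfl⟩, ha⟩
        exact ⟨x, ⟨hx, ha⟩, rfl⟩
      · rintro ⟨x, ⟨hx, ha⟩, rfl⟩
        exact ⟨⟨x, hx, rfl⟩, ha⟩
    have e2 : ((J'.filter (· ∈ S) : Finset _) : Set (Fin m × Fin n)) =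
        τ '' {x : N.E | τ x ∈ S ∧ ↑x ∈ J} := by
      ext y
      simp only [J', Finset.coe_filter, Finset.mem_filter, Finset.mem_univ, true_and,
        Set.mem_ofPred_eq]
      constructor
      · rintro ⟨⟨x, rfl, hx⟩, hy⟩
        exact ⟨x, ⟨hy, hx⟩, rfl⟩
      · rintro ⟨x, ⟨hy, hx⟩, rfl⟩
        exact ⟨⟨x, rfl, hx⟩, hy⟩
    rw [e1, e2, Set.ncard_image_of_injective _ hτ.1,
      Set.ncard_image_of_injective _ Subtype.val_injective]
  have hrow : ∀ i, Odd (J'.filter (·.1 = i)).card := by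
    intro i
    convert key _ (completeBipartite_isBondSide_inl hm hn i) ?_ using 3
    · simp [signedCut, completeBipartite]
    · ext e
      simp [signedCut, completeBipartite]
  have hcol : ∀ j, Odd (J'.filter (·.2 = j)).card := by
    intro j
    convert key _ (completeBipartite_isBondSide_inr hm hn j) ?_ using 3
    · simp [signedCut, completeBipartite]
    · ext e
      simp [signedCut, completeBipartite]
  have h1 : (J'.card : ZMod 2) = m := by
    rw [Finset.card_eq_sum_card_fiberwise (f := Prod.fst) (t := Finset.univ) 
      (by simp [Set.MapsTo]), Nat.cast_sum,
      Finset.sum_congr rfl fun i _ => ZMod.natCast_eq_one_iff_odd.2 (hrow i)]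
    simp
  have h2 : (J'.card : ZMod 2) = n := by
    rw [Finset.card_eq_sum_card_fiberwise (f := Prod.snd) (t := Finset.univ) 
      (by simp [Set.MapsTo]), Nat.cast_sum,
      Finset.sum_congr rfl fun j _ => ZMod.natCast_eq_one_iff_odd.2 (hcol j)]
    simp
  rw [← Nat.not_even_iff_odd, ← ZMod.natCast_eq_zero_iff_even, Nat.cast_add, ← h1, ← h2] at hodd
  exact hodd (CharTwo.add_self_eq_zero _)

end MultiDigraph

/-! ### Levels of the potential of a minimal ambiguous vector -/

namespace MultiDigraph

open AddSubmonoid OrientedMatroid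

variable {V α : Type*} {D : MultiDigraph V α} {G : Set α} {w : α → ℕ} {k : V → ℤ} {t : ℤ}

variable (D G) in
/-- The indicator vector of the edges of `G` that leave `X`. -/
noncomputable def outVec (X : Set V) : α → ℕ := vec (D.signedCutOn G X).1

theorem outVec_mem_cone {X : Set V} (h : ∀ e ∈ G, D.head e ∈ X → D.tail e ∈ X) :
    D.outVec G X ∈ D.cone G :=
  vec_signedCutOn_mem_cone (Set.eq_empty_iff_forall_notMem.2 fun e he =>
    he.1.1 (h e he.2 he.1.2))

open Classical in
theorem outVec_apply {e : α} (he : e ∈ G) (X : Set V) :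
    D.outVec G X e = if D.tail e ∈ X ∧ D.head e ∉ X then 1 else 0 := by
  unfold outVec
  split_ifs with h
  · exact vec_apply_of_mem ⟨h, he⟩
  · exact vec_apply_of_notMem fun h' => h h'.1

theorem outVec_apply_of_notMem {e : α} (he : e ∉ G) (X : Set V) : D.outVec G X e = 0 :=
  vec_apply_of_notMem fun h => he h.2

theorem outVec_ne_zero {e : α} (he : e ∈ G) {X : Set V} (h1 : D.tail e ∈ X) (h2 : D.head e ∉ X) :
    D.outVec G X ≠ 0 := vec_ne_zero ⟨e, ⟨h1, h2⟩, he⟩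

theorem le_of_forall_mem {x y : α → ℕ} (hx : ∀ e ∉ G, x e = 0) (h : ∀ e ∈ G, x e ≤ y e) :
    x ≤ y := by
  intro e
  by_cases he : e ∈ G
  · exact h e he
  · rw [hx e he]
    exact Nat.zero_le _

/-- Two directed cuts fit below `w` together as soon as `w` is at least two on their common edges.
This is how compatibility of cuts is checked. -/
theorem outVec_add_le {X Y : Set V} (hpos : ∀ e ∈ G, 1 ≤ w e)
    (h : ∀ e ∈ G, D.tail e ∈ X → D.head e ∉ X → D.tail e ∈ Y → D.head e ∉ Y → 2 ≤ w e) :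
    D.outVec G X + D.outVec G Y ≤ w := by
  classical
  refine le_of_forall_mem (G := G) (fun e he => by
    simp [outVec_apply_of_notMem he]) fun e he => ?_
  rw [Pi.add_apply, outVec_apply he, outVec_apply he]
  have h1 := hpos e he
  have h2 := h e he
  split_ifs with a b b
  · exact h2 a.1 a.2 b.1 b.2
  all_goals omega

/-- If the potential of a minimal ambiguous vector has two nontrivial levels, it has exactly two,
and some closed set between them has the other split parity. -/
theorem exists_two_levels (hG : G.Finite) (hw : (D.cone G).IsMinimalAmbiguous w)
    (hk : ∀ e ∈ G, (w e : ℤ) = k (D.tail e) - k (D.head e)) (hpos : ∀ e ∈ G, 1 ≤ w e)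
    {s₁ s₂ : ℤ} (hs : s₁ ≠ s₂) (h₁ : ∃ e ∈ G, k (D.head e) < s₁ ∧ s₁ ≤ k (D.tail e))
    (h₂ : ∃ e ∈ G, k (D.head e) < s₂ ∧ s₂ ≤ k (D.tail e)) :
    ∃ t, (∀ e ∈ G, k (D.tail e) ≤ t + 1 ∧ t - 1 ≤ k (D.head e)) ∧
      (∃ e ∈ G, k (D.head e) < t ∧ t ≤ k (D.tail e)) ∧
      (∃ e ∈ G, k (D.head e) < t + 1 ∧ t + 1 ≤ k (D.tail e)) ∧
      ∃ Q ⊆ {v | k v = t}, D.outVec G ({v | t + 1 ≤ k v} ∪ Q) ≠ 0 ∧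
        D.outVec G ({v | t + 1 ≤ k v} ∪ Q) ≠ w ∧
        (D.cone G).splitParity w (D.outVec G ({v | t + 1 ≤ k v} ∪ Q)) ≠
          (D.cone G).splitParity w (D.outVec G {v | t + 1 ≤ k v}) := by
  classical
  have hK := D.cone_isSaturatedOn hG
  have hstep : ∀ e ∈ G, k (D.head e) + 1 ≤ k (D.tail e) := fun e he => by
    have := hk e he
    have := hpos e he
    omega
  set T : Set ℤ := {s | ∃ e ∈ G, k (D.head e) < s ∧ s ≤ k (D.tail e)} with hT
  have hyK : ∀ s, D.outVec G {v | s ≤ k v} ∈ D.cone G := fun s => outVec_mem_cone fun e he h => by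
    have := hstep e he
    simp only [Set.mem_ofPred_eq] at h ⊢
    omega
  have hy0 : ∀ s ∈ T, D.outVec G {v | s ≤ k v} ≠ 0 := by
    rintro s ⟨e, he, h1, h2⟩
    exact outVec_ne_zero he h2 (by simpa using h1)
  obtain ⟨ε, hε⟩ : ∃ ε, (D.cone G).splitParity w (D.outVec G {v | s₁ ≤ k v}) = ε := ⟨_, rfl⟩
  -- An edge crossing two distinct levels has weight at least two, so distinct level cuts are
  -- compatible and share their split parity.
  have hlev : ∀ s ∈ T, (D.cone G).splitParity w (D.outVec G {v | s ≤ k v}) = ε := by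
    intro s hsT
    by_cases hss : s = s₁
    · rw [hss, hε]
    rw [← hε]
    refine hw.splitParity_eq_of_add_le hK (hyK _) (hyK _) (hy0 _ hsT) (hy0 _ h₁)
      (outVec_add_le hpos fun e he a1 a2 a3 a4 => ?_)
    have := hk e he
    simp only [Set.mem_ofPred_eq] at a1 a2 a3 a4
    omega
  obtain ⟨x, hx, hxle, hxne, hxε⟩ := hw.exists_splitParity_eq (ε + 1)
  have hx0 := hx.2.1
  have hxK := hx.1
  obtain ⟨Z, -, hZ2, rfl⟩ := (isIndecomposable_cone_iff hG).1 hx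
  change D.outVec G Z ≤ w at hxle
  change D.outVec G Z ≠ w at hxne
  change D.outVec G Z ≠ 0 at hx0
  -- Here `Z` gives a bond of the other parity. A common edge of the cuts of `Z` and `W s` must
  -- start at level at least `s + 1` and end at level at most `s - 1`, so it has weight at least two
  -- and the cuts are compatible.
  set W : ℤ → Set V := fun s => {v | s + 1 ≤ k v} ∪ {v | k v = s ∧ v ∉ Z} with hW
  have hWm : ∀ s v, v ∈ W s ↔ s + 1 ≤ k v ∨ (k v = s ∧ v ∉ Z) := fun _ _ => Iff.rfl
  have hWK : ∀ s, D.outVec G (W s) ∈ D.cone G := fun s => outVec_mem_cone fun e he h => by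
    have := hstep e he
    rw [hWm] at h ⊢
    omega
  have hxW : ∀ s, D.outVec G Z + D.outVec G (W s) ≤ w := fun s =>
    outVec_add_le hpos fun e he a1 a2 a3 a4 => by
      have := hk e he
      have := hstep e he
      rw [hWm] at a3 a4
      have a3' : s + 1 ≤ k (D.tail e) := by tauto
      by_cases hh : k (D.head e) = s
      · exact absurd (Or.inr ⟨hh, a2⟩) a4
      · omega
  have hWε : ∀ s, D.outVec G (W s) ≠ 0 → (D.cone G).splitParity w (D.outVec G (W s)) = ε + 1 :=
    fun s h0 => hxε ▸ (hw.splitParity_eq_of_add_le hK hxK (hWK s) hx0 h0 (hxW s)).symm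
  have hε1 : ε + 1 ≠ ε := by simp
  -- The cut of `W s` would be compatible with any level cut other than `s` and `s + 1`, against the
  -- difference of their split parities.
  have hWT : ∀ s, D.outVec G (W s) ≠ 0 → ∀ r ∈ T, r = s ∨ r = s + 1 := by
    intro s h0 r hr
    by_contra hcon
    refine hε1 ((hWε s h0).symm.trans ((hw.splitParity_eq_of_add_le hK (hWK s) (hyK r) h0
      (hy0 r hr) (outVec_add_le hpos fun e he a1 a2 a3 a4 => ?_)).trans (hlev r hr)))
    have := hk e he
    have := hstep e he
    rw [hWm] at a1 a2
    simp only [Set.mem_ofPred_eq] at a3 a4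
    omega
  -- At an edge where `x` is smaller than `w`, the position of the two ends relative to `Z` tells
  -- which `W s` the edge leaves.
  obtain ⟨t, ht0⟩ : ∃ s, D.outVec G (W s) ≠ 0 := by
    obtain ⟨e, he⟩ : ∃ e, D.outVec G Z e ≠ w e := Function.ne_iff.1 hxne
    have heG : e ∈ G := by
      by_contra h
      rw [outVec_apply_of_notMem h, hw.mem.2 e h] at he
      exact he rfl
    have hle : D.outVec G Z e ≤ w e := hxle e
    have a1 := hk e heG
    have a2 := hstep e heG
    rw [outVec_apply heG] at he hle
    by_cases h1 : D.tail e ∈ Z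
    · by_cases h2 : D.head e ∈ Z
      · refine ⟨k (D.head e), outVec_ne_zero heG ((hWm _ _).2 (Or.inl a2)) ?_⟩
        rw [hWm]
        rintro (h | h)
        · omega
        · exact h.2 h2
      · rw [if_pos ⟨h1, h2⟩] at he hle
        refine ⟨k (D.tail e) - 1, outVec_ne_zero heG ((hWm _ _).2 (Or.inl (by omega))) ?_⟩
        rw [hWm]
        omega
    · refine ⟨k (D.tail e), outVec_ne_zero heG ((hWm _ _).2 (Or.inr ⟨rfl, h1⟩)) ?_⟩
      rw [hWm]
      omega
  have hTt := hWT t ht0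
  have hmem : t ∈ T ∧ t + 1 ∈ T := by
    rcases hTt s₁ h₁ with e1 | e1 <;> rcases hTt s₂ h₂ with e2 | e2
    · exact absurd (e1.trans e2.symm) hs
    · exact ⟨e1 ▸ h₁, e2 ▸ h₂⟩
    · exact ⟨e2 ▸ h₂, e1 ▸ h₁⟩
    · exact absurd (e1.trans e2.symm) hs
  refine ⟨t, fun e he => ?_, hmem.1, hmem.2, {v | k v = t ∧ v ∉ Z}, fun v hv => hv.1, ht0, ?_, ?_⟩
  · have a := hstep e he
    have b := hTt (k (D.tail e)) ⟨e, he, by omega, le_rfl⟩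
    have c := hTt (k (D.head e) + 1) ⟨e, he, by omega, a⟩
    omega
  · intro h
    have := hxW t
    rw [hW] at this
    simp only at this
    rw [h] at this
    refine hx0 (funext fun e => ?_)
    have := this e
    simp only [Pi.add_apply] at this
    simp only [Pi.zero_apply]
    omega
  · rw [hlev _ hmem.2]
    exact fun h => hε1 ((hWε t ht0).symm.trans h)

end MultiDigraph

/-! ### The middle level -/

namespace MultiDigraph

open AddSubmonoid OrientedMatroid

variable {V α : Type*} {D : MultiDigraph V α} {G : Set α} {w : α → ℕ} {k : V → ℤ} {t : ℤ}

set_option maxHeartbeats 1000000 in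
/-- The middle level of a potential with two nontrivial levels has exactly two vertices `p` and
`q`, the split parities of the two sets `{v | t + 1 ≤ k v} ∪ {p}`, `{v | t + 1 ≤ k v} ∪ {q}`
agree, and they differ from those of the two levels. -/
theorem exists_middle_pair (hG : G.Finite) (hw : (D.cone G).IsMinimalAmbiguous w)
    (hk : ∀ e ∈ G, (w e : ℤ) = k (D.tail e) - k (D.head e)) (hpos : ∀ e ∈ G, 1 ≤ w e)
    (hzero : ∀ x, (D.cone G).IsAmbiguous x → ∀ e ∈ G, x e ≠ 0)
    (hb : ∀ e ∈ G, k (D.tail e) ≤ t + 1 ∧ t - 1 ≤ k (D.head e))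
    (hlow : ∃ e ∈ G, k (D.head e) < t ∧ t ≤ k (D.tail e))
    (hup : ∃ e ∈ G, k (D.head e) < t + 1 ∧ t + 1 ≤ k (D.tail e))
    {Q : Set V} (hQt : Q ⊆ {v | k v = t})
    (hQ0 : D.outVec G ({v | t + 1 ≤ k v} ∪ Q) ≠ 0) (hQw : D.outVec G ({v | t + 1 ≤ k v} ∪ Q) ≠ w)
    (hQ : (D.cone G).splitParity w (D.outVec G ({v | t + 1 ≤ k v} ∪ Q)) ≠
      (D.cone G).splitParity w (D.outVec G {v | t + 1 ≤ k v})) :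
    ∃ p q, p ≠ q ∧ k p = t ∧ k q = t ∧
      (∀ e ∈ G, k (D.tail e) = t → D.tail e = p ∨ D.tail e = q) ∧
      (∀ e ∈ G, k (D.head e) = t → D.head e = p ∨ D.head e = q) ∧
      (∀ e ∈ G, k (D.tail e) = t + 1 → ∀ c, c = p ∨ c = q →
        ∃ f ∈ G, D.tail f = D.tail e ∧ D.head f = c) ∧
      ∀ e ∈ G, k (D.head e) = t - 1 → ∀ c, c = p ∨ c = q →
        ∃ f ∈ G, D.head f = D.head e ∧ D.tail f = c := by
  classical
  have hK := D.cone_isSaturatedOn hG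
  -- Only middle vertices incident with `G` influence cuts. The vectors `d R` interpolate between
  -- the upper level cut `d ∅` and the lower one `d C`.
  set C : Set V := {v | k v = t ∧ ∃ e ∈ G, D.tail e = v ∨ D.head e = v} with hC
  set d : Set V → α → ℕ := fun R => D.outVec G ({v | t + 1 ≤ k v} ∪ R) with hd
  have hd0 : ∀ R, ∀ e ∉ G, d R e = 0 := fun R e he => outVec_apply_of_notMem he _
  -- The three types of edges.
  have types : ∀ e ∈ G,
      (k (D.tail e) = t + 1 ∧ k (D.head e) = t ∧ w e = 1 ∧ D.head e ∈ C ∧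
        ∀ R ⊆ {v | k v = t}, d R e = if D.head e ∈ R then 0 else 1) ∨
      (k (D.tail e) = t + 1 ∧ k (D.head e) = t - 1 ∧ w e = 2 ∧ ∀ R ⊆ {v | k v = t}, d R e = 1) ∨
      (k (D.tail e) = t ∧ k (D.head e) = t - 1 ∧ w e = 1 ∧ D.tail e ∈ C ∧
        ∀ R ⊆ {v | k v = t}, d R e = if D.tail e ∈ R then 1 else 0) := by
    intro e he
    have h1 := hk e he
    have h2 := hpos e he
    have h3 := hb e he
    have hor : (k (D.tail e) = t + 1 ∧ k (D.head e) = t ∧ w e = 1) ∨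
        (k (D.tail e) = t + 1 ∧ k (D.head e) = t - 1 ∧ w e = 2) ∨
        (k (D.tail e) = t ∧ k (D.head e) = t - 1 ∧ w e = 1) := by omega
    have hne : ∀ R ⊆ {v | k v = t}, ∀ v, k v ≠ t → v ∉ R := fun R hR v hv h => hv (hR h)
    rcases hor with ⟨a, b, c⟩ | ⟨a, b, c⟩ | ⟨a, b, c⟩
    · refine Or.inl ⟨a, b, c, ⟨b, e, he, Or.inr rfl⟩, fun R hR => ?_⟩
      simp only [hd]
      rw [outVec_apply he]
      by_cases hh : D.head e ∈ R <;> simp [a, b, hh]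
    · refine Or.inr (Or.inl ⟨a, b, c, fun R hR => ?_⟩)
      simp only [hd]
      rw [outVec_apply he, if_pos]
      refine ⟨Or.inl (by simp [a]), ?_⟩
      rintro (h | h)
      · simp only [Set.mem_ofPred_eq] at h
        omega
      · exact hne R hR _ (by omega) h
    · refine Or.inr (Or.inr ⟨a, b, c, ⟨a, e, he, Or.inl rfl⟩, fun R hR => ?_⟩)
      have := hne R hR (D.head e) (by omega)
      simp only [hd]
      rw [outVec_apply he]
      by_cases hh : D.tail e ∈ R <;> simp [a, b, hh, this]
  have hstep : ∀ e ∈ G, k (D.head e) + 1 ≤ k (D.tail e) := fun e he => by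
    have := hk e he
    have := hpos e he
    omega
  have hdK : ∀ R ⊆ {v | k v = t}, d R ∈ D.cone G := fun R hR => outVec_mem_cone fun e he h => by
    have h1 := hstep e he
    left
    simp only [Set.mem_ofPred_eq]
    rcases h with h | h
    · simp only [Set.mem_ofPred_eq] at h
      omega
    · have := hR h
      simp only [Set.mem_ofPred_eq] at this
      omega
  have hCt : C ⊆ {v | k v = t} := fun v hv => hv.1
  have hempt : (∅ : Set V) ⊆ {v | k v = t} := Set.empty_subset _
  have hext : ∀ x y : α → ℕ, (∀ e ∉ G, x e = 0) → (∀ e ∉ G, y e = 0) → (∀ e ∈ G, x e = y e) →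
      x = y := fun x y hx hy h => funext fun e => by
    by_cases he : e ∈ G
    · exact h e he
    · rw [hx e he, hy e he]
  have hadd0 : ∀ R S, ∀ e ∉ G, (d R + d S) e = 0 := fun R S e he => by
    rw [Pi.add_apply, hd0 R e he, hd0 S e he]
  -- Reduce to a subset of `C`.
  obtain ⟨Q, hQC, hQ0, hQw, hQ⟩ : ∃ Q ⊆ C, d Q ≠ 0 ∧ d Q ≠ w ∧
      (D.cone G).splitParity w (d Q) ≠ (D.cone G).splitParity w (d ∅) := by
    have e1 : d (Q ∩ C) = d Q := by
      refine hext _ _ (hd0 _) (hd0 _) fun e he => ?_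
      have hsub : Q ∩ C ⊆ {v | k v = t} := Set.inter_subset_left.trans hQt
      rcases types e he with ⟨-, -, -, hc, h⟩ | ⟨-, -, -, h⟩ | ⟨-, -, -, hc, h⟩
      · rw [h _ hsub, h _ hQt]
        simp [hc]
      · rw [h _ hsub, h _ hQt]
      · rw [h _ hsub, h _ hQt]
        simp [hc]
    have e2 : d ∅ = D.outVec G {v | t + 1 ≤ k v} := by
      simp only [hd, Set.union_empty]
    refine ⟨Q ∩ C, Set.inter_subset_right, ?_, ?_, ?_⟩ <;> rw [e1]
    · exact hQ0
    · exact hQw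
    · rw [e2]
      exact hQ
  have hcompl : ∀ R ⊆ C, d R + d (C \ R) = w := by
    intro R hR
    refine hext _ _ (hadd0 _ _) hw.mem.2 fun e he => ?_
    have h1 := hR.trans hCt
    have h2 : C \ R ⊆ {v | k v = t} := Set.sdiff_subset.trans hCt
    rw [Pi.add_apply]
    rcases types e he with ⟨-, -, hwe, hc, h⟩ | ⟨-, -, hwe, h⟩ | ⟨-, -, hwe, hc, h⟩
    · rw [h _ h1, h _ h2, hwe]
      by_cases hh : D.head e ∈ R <;> simp [hh, hc]
    · rw [h _ h1, h _ h2, hwe]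
    · rw [h _ h1, h _ h2, hwe]
      by_cases hh : D.tail e ∈ R <;> simp [hh, hc]
  have hsplit : ∀ R ⊆ C, (D.cone G).splitParity w (d R) =
      (D.cone G).lengthParity (d R) + (D.cone G).lengthParity (d (C \ R)) := by
    intro R hR
    unfold splitParity
    rw [← hcompl R hR, add_tsub_cancel_left]
  have hsplit' : ∀ R ⊆ C, (D.cone G).splitParity w (d (C \ R)) =
      (D.cone G).splitParity w (d R) := by
    intro R hR
    rw [hsplit R hR, hsplit _ Set.sdiff_subset, Set.sdiff_sdiff_cancel_left hR, add_comm]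
  have hCε : (D.cone G).splitParity w (d C) = (D.cone G).splitParity w (d ∅) := by
    rw [← hsplit' ∅ (Set.empty_subset _), Set.sdiff_empty]
  have hdE0 : d ∅ ≠ 0 := by
    obtain ⟨e, he, h1, h2⟩ := hup
    refine outVec_ne_zero he (Or.inl h2) ?_
    rintro (h | h)
    · simp only [Set.mem_ofPred_eq] at h
      omega
    · exact h
  have hdC0 : d C ≠ 0 := by
    obtain ⟨e, he, h1, h2⟩ := hlow
    refine outVec_ne_zero he ?_ ?_
    · by_cases h3 : t + 1 ≤ k (D.tail e)
      · exact Or.inl h3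
      · exact Or.inr ⟨by omega, e, he, Or.inl rfl⟩
    · rintro (h | h)
      · simp only [Set.mem_ofPred_eq] at h
        omega
      · have := h.1
        omega
  have hQ'0 : d (C \ Q) ≠ 0 := by
    intro h
    have := hcompl Q hQC
    rw [h, add_zero] at this
    exact hQw this
  -- Properties shared by `Q` and its complement.
  have both : ∀ R, R = Q ∨ R = C \ Q → R ⊆ C ∧ d R ≠ 0 ∧
      (D.cone G).splitParity w (d R) ≠ (D.cone G).splitParity w (d ∅) ∧
      (C \ R = Q ∨ C \ R = C \ Q) := by
    rintro R (rfl | rfl)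
    · exact ⟨hQC, hQ0, hQ, Or.inr rfl⟩
    · refine ⟨Set.sdiff_subset, hQ'0, ?_, Or.inl (Set.sdiff_sdiff_cancel_left hQC)⟩
      rw [hsplit' Q hQC]
      exact hQ
  have hpick : ∀ c ∈ C, ∃ R, (R = Q ∨ R = C \ Q) ∧ c ∈ R := by
    intro c hc
    by_cases h : c ∈ Q
    · exact ⟨Q, Or.inl rfl, h⟩
    · exact ⟨C \ Q, Or.inr rfl, hc, h⟩
  -- Comparison of a star with the sets `d R`.
  have hcomp : ∀ z ∈ D.cone G, z ≠ 0 → ∀ R ⊆ C, d R ≠ 0 →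
      (∀ e ∈ G, z e + d R e ≤ w e) →
      (D.cone G).splitParity w z = (D.cone G).splitParity w (d R) := by
    intro z hz hz0 R hR hR0 hle
    exact hw.splitParity_eq_of_add_le hK hz (hdK R (hR.trans hCt)) hz0 hR0
      (le_of_forall_mem (G := G) (fun e he => by
        rw [Pi.add_apply, hz.2 e he, hd0 R e he]) hle)
  -- The star of a sink `c` is compatible with every `d R` for `c ∈ R`, hence with both `d C` and
  -- `Q` or its complement, whose split parities differ.
  have hout : ∀ c ∈ C, ∃ e ∈ G, D.tail e = c := by
    intro c hc
    by_contra! hno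
    obtain ⟨R, hRor, hcR⟩ := hpick c hc
    obtain ⟨hRC, hR0, hRε, -⟩ := both R hRor
    obtain ⟨hct, e₀, he₀, h₀⟩ := id hc
    have h₀ := h₀.resolve_left (hno e₀ he₀)
    have hzK : D.outVec G {c}ᶜ ∈ D.cone G := outVec_mem_cone fun e he _ => hno e he
    have hz0 : D.outVec G {c}ᶜ ≠ 0 := outVec_ne_zero he₀ (hno e₀ he₀) (by simp [h₀])
    have hz : ∀ S ⊆ C, c ∈ S → ∀ e ∈ G, D.outVec G {c}ᶜ e + d S e ≤ w e := by
      intro S hS hcS e he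
      rw [outVec_apply he]
      rcases types e he with ⟨-, -, hwe, -, h⟩ | ⟨-, hh, hwe, h⟩ | ⟨-, hh, hwe, -, h⟩
      · rw [h S (hS.trans hCt), hwe]
        by_cases h1 : D.head e = c
        · rw [if_pos (c := D.head e ∈ S) (h1 ▸ hcS)]
          split_ifs <;> simp
        · rw [if_neg (c := D.tail e ∈ ({c}ᶜ : Set V) ∧ D.head e ∉ ({c}ᶜ : Set V)) fun h => h.2 h1]
          split_ifs <;> simp
      · rw [h S (hS.trans hCt), hwe]
        split_ifs <;> simp
      · rw [if_neg, h S (hS.trans hCt), hwe]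
        · split_ifs <;> simp
        · simp only [Set.mem_compl_iff, Set.mem_singleton_iff, not_not, not_and]
          rintro - rfl
          omega
    have h1 := hcomp _ hzK hz0 C subset_rfl hdC0 (hz C subset_rfl hc)
    have h2 := hcomp _ hzK hz0 R hRC hR0 (hz R hRC hcR)
    exact hRε (h2.symm.trans (h1.trans hCε))
  -- Dually, the star of a source `c` is compatible with `d R` whenever `c ∉ R`, in particular with
  -- `d ∅`.
  have hin : ∀ c ∈ C, ∃ e ∈ G, D.head e = c := by
    intro c hc
    by_contra! hno
    obtain ⟨R', hRor', hcR⟩ := hpick c hc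
    obtain ⟨R, rfl⟩ : ∃ R, R = C \ R' := ⟨_, rfl⟩
    obtain ⟨hRC, hR0, hRε, -⟩ := both _ (both R' hRor').2.2.2
    obtain ⟨hct, e₀, he₀, h₀⟩ := id hc
    have h₀ := h₀.resolve_right (hno e₀ he₀)
    have hzK : D.outVec G {c} ∈ D.cone G := outVec_mem_cone fun e he h => absurd h (hno e he)
    have hz0 : D.outVec G {c} ≠ 0 := outVec_ne_zero he₀ h₀ (hno e₀ he₀)
    have hz : ∀ S ⊆ C, c ∉ S → ∀ e ∈ G, D.outVec G {c} e + d S e ≤ w e := by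
      intro S hS hcS e he
      rw [outVec_apply he]
      rcases types e he with ⟨hh, -, hwe, -, h⟩ | ⟨hh, -, hwe, h⟩ | ⟨-, -, hwe, -, h⟩
      · rw [if_neg, h S (hS.trans hCt), hwe]
        · split_ifs <;> simp
        · rintro ⟨h1, -⟩
          rw [Set.mem_singleton_iff.1 h1] at hh
          omega
      · rw [h S (hS.trans hCt), hwe]
        split_ifs <;> simp
      · rw [h S (hS.trans hCt), hwe]
        by_cases h1 : D.tail e = c
        · rw [if_neg (c := D.tail e ∈ S) fun h => hcS (h1 ▸ h)]
          split_ifs <;> simp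
        · rw [if_neg (c := D.tail e ∈ ({c} : Set V) ∧ D.head e ∉ ({c} : Set V)) fun h => h1 h.1]
          split_ifs <;> simp
    have h1 := hcomp _ hzK hz0 ∅ (Set.empty_subset _) hdE0 (hz ∅ (Set.empty_subset _) id)
    have h2 := hcomp _ hzK hz0 _ hRC hR0 (hz _ hRC fun h => h.2 hcR)
    exact hRε (h2.symm.trans h1)
  -- Sums with a zero coordinate are not ambiguous.
  have hmod : ∀ R S : Set V, R ⊆ C → S ⊆ C → (∃ e ∈ G, d R e = 0 ∧ d S e = 0) →
      (D.cone G).lengthParity (d R) + (D.cone G).lengthParity (d S) =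
        (D.cone G).lengthParity (d (R ∩ S)) + (D.cone G).lengthParity (d (R ∪ S)) := by
    rintro R S hR hS ⟨e, he, hRe, hSe⟩
    have a1 := hR.trans hCt
    have a2 := hS.trans hCt
    have a3 : R ∩ S ⊆ {v | k v = t} := Set.inter_subset_left.trans a1
    have a4 : R ∪ S ⊆ {v | k v = t} := Set.union_subset a1 a2
    have heq : d R + d S = d (R ∩ S) + d (R ∪ S) := by
      refine hext _ _ (hadd0 _ _) (hadd0 _ _) fun e he => ?_
      rw [Pi.add_apply, Pi.add_apply]
      rcases types e he with ⟨-, -, -, -, h⟩ | ⟨-, -, -, h⟩ | ⟨-, -, -, -, h⟩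
      · rw [h _ a1, h _ a2, h _ a3, h _ a4]
        by_cases h1 : D.head e ∈ R <;> by_cases h2 : D.head e ∈ S <;> simp [h1, h2]
      · rw [h _ a1, h _ a2, h _ a3, h _ a4]
      · rw [h _ a1, h _ a2, h _ a3, h _ a4]
        by_cases h1 : D.tail e ∈ R <;> by_cases h2 : D.tail e ∈ S <;> simp [h1, h2]
    have hna : ¬ (D.cone G).IsAmbiguous (d R + d S) := fun h => hzero _ h e he (by
      rw [Pi.add_apply, hRe, hSe])
    rw [← hK.lengthParity_add (hdK R a1) (hdK S a2) hna, heq,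
      hK.lengthParity_add (hdK _ a3) (hdK _ a4) (heq ▸ hna)]
  -- For distinct `c`, `c'` in `R`, apply modularity to `R`, `(C \ R) ∪ {c}` and to `C \ R`, `{c}`.
  -- The sum of the two identities equates the split parities of `d R` and `d ∅`.
  have hsub : ∀ R, R = Q ∨ R = C \ Q → R.Subsingleton := by
    intro R hRor c hc c' hc'
    by_contra hne
    obtain ⟨hRC, hR0, hRε, -⟩ := both R hRor
    have hcC : {c} ⊆ C := Set.singleton_subset_iff.2 (hRC hc)
    have hR'C : C \ R ⊆ C := Set.sdiff_subset
    have hR'cC : C \ R ∪ {c} ⊆ C := Set.union_subset hR'C hcC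
    have eq1 := hmod R (C \ R ∪ {c}) hRC hR'cC ?_
    have eq2 := hmod (C \ R) {c} hR'C hcC ?_
    · have s1 : R ∩ (C \ R ∪ {c}) = {c} := by
        ext v
        simp only [Set.mem_inter_iff, Set.mem_union, Set.mem_sdiff, Set.mem_singleton_iff]
        constructor
        · tauto
        · rintro rfl
          exact ⟨hc, Or.inr rfl⟩
      have s2 : R ∪ (C \ R ∪ {c}) = C := by
        rw [← Set.union_assoc, Set.union_sdiff_cancel hRC, Set.union_eq_left.2 hcC]
      have s3 : C \ R ∩ {c} = ∅ :=
        Set.disjoint_iff_inter_eq_empty.1 (Set.disjoint_singleton_right.2 fun h => h.2 hc)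
      rw [s1, s2] at eq1
      rw [s3] at eq2
      refine hRε ?_
      rw [hsplit R hRC, hsplit ∅ (Set.empty_subset _), Set.sdiff_empty]
      linear_combination eq1 + eq2
    -- An edge leaving `c'` is a zero coordinate, since `c'` lies in neither set.
    · obtain ⟨e, he, hec⟩ := hout c' (hRC hc')
      refine ⟨e, he, ?_⟩
      have hkt : k (D.tail e) = t := hec ▸ hCt (hRC hc')
      rcases types e he with ⟨a, -⟩ | ⟨a, -⟩ | ⟨-, -, -, -, h⟩
      · omega
      · omega
      · rw [h _ (hR'C.trans hCt), h _ (hcC.trans hCt), hec]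
        exact ⟨if_neg fun h => h.2 hc', if_neg (Ne.symm hne)⟩
    -- An edge entering `c` is a zero coordinate, since `c` lies in both sets.
    · obtain ⟨e, he, hec⟩ := hin c (hRC hc)
      refine ⟨e, he, ?_⟩
      have hkt : k (D.head e) = t := hec ▸ hCt (hRC hc)
      rcases types e he with ⟨-, -, -, -, h⟩ | ⟨-, a, -⟩ | ⟨-, a, -⟩
      · rw [h _ (hRC.trans hCt), h _ (hR'cC.trans hCt), hec]
        exact ⟨if_pos hc, if_pos (Or.inr rfl)⟩
      · omega
      · omega
  have hQne : Q.Nonempty := by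
    by_contra h
    rw [Set.not_nonempty_iff_eq_empty] at h
    exact hQ (by rw [h])
  have hQ'ne : (C \ Q).Nonempty := by
    by_contra h
    rw [Set.not_nonempty_iff_eq_empty, Set.sdiff_eq_empty] at h
    exact hQ (by rw [hQC.antisymm h, hCε])
  obtain ⟨q, hq⟩ := hQne
  obtain ⟨p, hp⟩ := hQ'ne
  have hCpq : ∀ c ∈ C, c = p ∨ c = q := by
    intro c hc
    by_cases h : c ∈ Q
    · exact Or.inr (hsub Q (Or.inl rfl) h hq)
    · exact Or.inl (hsub _ (Or.inr rfl) ⟨hc, h⟩ hp)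
  have hsing : ∀ c, c = p ∨ c = q → ∃ R, (R = Q ∨ R = C \ Q) ∧ ∀ v, v ∈ R ↔ v = c := by
    rintro c (rfl | rfl)
    · exact ⟨_, Or.inr rfl, fun v => ⟨fun h => hsub _ (Or.inr rfl) h hp, fun h => h ▸ hp⟩⟩
    · exact ⟨_, Or.inl rfl, fun v => ⟨fun h => hsub _ (Or.inl rfl) h hq, fun h => h ▸ hq⟩⟩
  refine ⟨p, q, ?_, hp.1.1, hQC hq |>.1, fun e he h => hCpq _ ⟨h, e, he, Or.inl rfl⟩,
    fun e he h => hCpq _ ⟨h, e, he, Or.inr rfl⟩, fun e₀ he₀ h₀ c hc => ?_,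
    fun e₀ he₀ h₀ c hc => ?_⟩
  · rintro rfl
    exact hp.2 hq
  -- If the tail of `e₀` has no edge to `c`, its star is compatible with both `d C` and `d (C \
  -- {c})`, because among the edges from the upper to the middle level the latter contains only
  -- those entering `c`. Their split parities differ.
  · by_contra! hno
    obtain ⟨R', hR'or, hR'⟩ := hsing c hc
    obtain ⟨-, -, -, hor⟩ := both R' hR'or
    obtain ⟨hRC, hR0, hRε, -⟩ := both _ hor
    have hzK : D.outVec G {D.tail e₀} ∈ D.cone G := outVec_mem_cone fun e he h => by
      have h1 := hstep e he
      have h2 := hb e he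
      rw [Set.mem_singleton_iff.1 h] at h1
      omega
    have hz0 : D.outVec G {D.tail e₀} ≠ 0 := outVec_ne_zero he₀ rfl fun h => by
      have h1 := hstep e₀ he₀
      rw [Set.mem_singleton_iff.1 h] at h1
      omega
    have h1 := hcomp _ hzK hz0 C subset_rfl hdC0 fun e he => by
      rw [outVec_apply he]
      rcases types e he with ⟨-, -, hwe, hm, h⟩ | ⟨-, -, hwe, h⟩ | ⟨hh, -, hwe, hm, h⟩
      · rw [h C hCt, hwe, if_pos hm]
        split_ifs <;> simp
      · rw [h C hCt, hwe]
        split_ifs <;> simp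
      · rw [h C hCt, hwe, if_pos hm, if_neg]
        rintro ⟨h1, -⟩
        rw [Set.mem_singleton_iff.1 h1] at hh
        omega
    have h2 := hcomp _ hzK hz0 _ hRC hR0 fun e he => by
      rw [outVec_apply he]
      rcases types e he with ⟨-, -, hwe, hm, h⟩ | ⟨-, -, hwe, h⟩ | ⟨hh, -, hwe, hm, h⟩
      · rw [h _ (hRC.trans hCt), hwe]
        by_cases h1 : D.tail e = D.tail e₀
        · rw [if_pos (c := D.head e ∈ C \ R') ⟨hm, fun h => hno e he h1 ((hR' _).1 h)⟩]
          split_ifs <;> simp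
        · rw [if_neg (c := D.tail e ∈ ({D.tail e₀} : Set V) ∧ D.head e ∉ ({D.tail e₀} : Set V))
            fun h => h1 h.1]
          split_ifs <;> simp
      · rw [h _ (hRC.trans hCt), hwe]
        split_ifs <;> simp
      · rw [h _ (hRC.trans hCt), hwe, if_neg (c := _ ∧ _)]
        · split_ifs <;> simp
        rintro ⟨h1, -⟩
        rw [Set.mem_singleton_iff.1 h1] at hh
        omega
    exact hRε (h2.symm.trans (h1.trans hCε))
  -- The dual argument at the bottom: the star of the head of `e₀` would be compatible with both `d
  -- ∅` and `d {c}`.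
  · by_contra! hno
    obtain ⟨R, hRor, hR⟩ := hsing c hc
    obtain ⟨hRC, hR0, hRε, -⟩ := both R hRor
    have hzK : D.outVec G {D.head e₀}ᶜ ∈ D.cone G := outVec_mem_cone fun e he _ h => by
      have h1 := hstep e he
      have h2 := hb e he
      rw [Set.mem_singleton_iff.1 h] at h1
      omega
    have hz0 : D.outVec G {D.head e₀}ᶜ ≠ 0 := outVec_ne_zero he₀ (fun h => by
      have h1 := hstep e₀ he₀
      rw [Set.mem_singleton_iff.1 h] at h1
      omega) fun h => h rfl
    have h1 := hcomp _ hzK hz0 ∅ (Set.empty_subset _) hdE0 fun e he => by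
      rw [outVec_apply he]
      rcases types e he with ⟨-, hh, hwe, hm, h⟩ | ⟨-, -, hwe, h⟩ | ⟨-, -, hwe, hm, h⟩
      · rw [h ∅ hempt, hwe, if_neg (c := _ ∧ _)]
        · split_ifs <;> simp
        rintro ⟨-, h1⟩
        rw [Set.mem_singleton_iff.1 (not_not.1 h1)] at hh
        omega
      · rw [h ∅ hempt, hwe]
        split_ifs <;> simp
      · rw [h ∅ hempt, hwe, if_neg (c := D.tail e ∈ ∅) id]
        split_ifs <;> simp
    have h2 := hcomp _ hzK hz0 R hRC hR0 fun e he => by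
      rw [outVec_apply he]
      rcases types e he with ⟨-, hh, hwe, hm, h⟩ | ⟨-, -, hwe, h⟩ | ⟨-, -, hwe, hm, h⟩
      · rw [h R (hRC.trans hCt), hwe, if_neg (c := _ ∧ _)]
        · split_ifs <;> simp
        rintro ⟨-, h1⟩
        rw [Set.mem_singleton_iff.1 (not_not.1 h1)] at hh
        omega
      · rw [h R (hRC.trans hCt), hwe]
        split_ifs <;> simp
      · rw [h R (hRC.trans hCt), hwe]
        by_cases h1 : D.head e = D.head e₀
        · rw [if_neg (c := D.tail e ∈ R) fun h => hno e he h1 ((hR _).1 h)]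
          split_ifs <;> simp
        · rw [if_neg (c := D.tail e ∈ ({D.head e₀}ᶜ : Set V) ∧ D.head e ∉ ({D.head e₀}ᶜ : Set V))
            fun h => h1 (not_not.1 h.2)]
          split_ifs <;> simp
    exact hRε (h2.symm.trans h1)

end MultiDigraph

/-! ### Reduction to complete bipartite digraphs -/

namespace MultiDigraph

open AddSubmonoid OrientedMatroid

section

variable {V α : Type*} {D : MultiDigraph V α} {G : Set α}

/-- A digraph without redundant edges in which every ambiguous vector has full support has, up to
twisting, the tensions of a simple bipartite digraph, and all its edges have weight one. -/
theorem exists_bipartite_labelling {w : α → ℕ} (hG : G.Finite)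
    (hw : (D.cone G).IsMinimalAmbiguous w)
    (hzero : ∀ x, (D.cone G).IsAmbiguous x → ∀ e ∈ G, x e ≠ 0)
    (hpar : ∀ e ∈ G, ∀ f ∈ G, D.tail f = D.tail e → D.head f = D.head e → f = e)
    (htri : ∀ e ∈ G, ∀ f ∈ G, ∀ g ∈ G, D.tail f = D.tail e → D.head f = D.tail g →
      D.head g ≠ D.head e) :
    w = vec G ∧ ∃ i j : α → V,
      (∀ u : G → ℤ, u ∈ D.tensions G ↔ ∃ a b : V → ℤ, ∀ x : G, u x = a (i x) - b (j x)) ∧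
      ∀ e ∈ G, ∀ f ∈ G, i f = i e → j f = j e → f = e := by
  classical
  obtain ⟨⟨k, hk⟩, hw0⟩ := hw.mem
  have hpos : ∀ e ∈ G, 1 ≤ w e := fun e he => Nat.one_le_iff_ne_zero.2
    (hzero w hw.isAmbiguous e he)
  have hstep : ∀ e ∈ G, k (D.head e) + 1 ≤ k (D.tail e) := fun e he => by
    have := hk e he
    have := hpos e he
    omega
  have hvec : (∀ e ∈ G, w e = 1) → w = vec G := fun h => funext fun e => by
    by_cases he : e ∈ G
    · rw [h e he, vec_apply_of_mem he]
    · rw [hw0 e he, vec_apply_of_notMem he]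
  by_cases htwo : ∃ s₁ s₂ : ℤ, s₁ ≠ s₂ ∧ (∃ e ∈ G, k (D.head e) < s₁ ∧ s₁ ≤ k (D.tail e)) ∧
      ∃ e ∈ G, k (D.head e) < s₂ ∧ s₂ ≤ k (D.tail e)
  · obtain ⟨s₁, s₂, hs, h₁, h₂⟩ := htwo
    obtain ⟨t, hb, hlow, hup, Q, hQt, hQ0, hQw, hQ⟩ := exists_two_levels hG hw hk hpos hs h₁ h₂
    obtain ⟨p, q, hpq, hp, hq, htl, hhd, hA, hB⟩ :=
      exists_middle_pair hG hw hk hpos hzero hb hlow hup hQt hQ0 hQw hQ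
    have types : ∀ e ∈ G, w e = 1 ∧
        ((k (D.tail e) = t + 1 ∧ k (D.head e) = t ∧ (D.head e = p ∨ D.head e = q)) ∨
        (k (D.tail e) = t ∧ k (D.head e) = t - 1 ∧ (D.tail e = p ∨ D.tail e = q))) := by
      intro e he
      have h1 := hk e he
      have h2 := hpos e he
      have h3 := hb e he
      have hor : (k (D.tail e) = t + 1 ∧ k (D.head e) = t ∧ w e = 1) ∨
          (k (D.tail e) = t + 1 ∧ k (D.head e) = t - 1) ∨
          (k (D.tail e) = t ∧ k (D.head e) = t - 1 ∧ w e = 1) := by omega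
      rcases hor with ⟨a, b, c⟩ | ⟨a, b⟩ | ⟨a, b, c⟩
      · exact ⟨c, Or.inl ⟨a, b, hhd e he b⟩⟩
      -- An edge skipping the middle level closes a transitive triangle through `p`.
      · obtain ⟨f, hf, f1, f2⟩ := hA e he a p (Or.inl rfl)
        obtain ⟨g, hg, g1, g2⟩ := hB e he b p (Or.inl rfl)
        exact absurd g1 (htri e he f hf g hg f1 (f2.trans g2.symm))
      · exact ⟨c, Or.inr ⟨a, b, htl e he a⟩⟩
    -- The twist at the pair: `i` is the end outside the middle level, and `j` is the end in it,
    -- with `p` and `q` interchanged for the lower edges.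
    have hij : ∃ i j : α → V, ∀ e ∈ G,
        (k (D.tail e) = t + 1 ∧ k (D.head e) = t ∧ i e = D.tail e ∧
          (D.head e = p ∧ j e = p ∨ D.head e = q ∧ j e = q)) ∨
        (k (D.tail e) = t ∧ k (D.head e) = t - 1 ∧ i e = D.head e ∧
          (D.tail e = p ∧ j e = q ∨ D.tail e = q ∧ j e = p)) := by
      refine ⟨fun e => if k (D.tail e) = t then D.head e else D.tail e,
        fun e => if (k (D.tail e) = t + 1 ∧ D.head e = p) ∨ (k (D.tail e) = t ∧ D.tail e = q)
          then p else q, fun e he => ?_⟩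
      rcases (types e he).2 with ⟨a, b, c | c⟩ | ⟨a, b, c | c⟩
      · exact Or.inl ⟨a, b, if_neg (by omega), Or.inl ⟨c, if_pos (Or.inl ⟨a, c⟩)⟩⟩
      · refine Or.inl ⟨a, b, if_neg (by omega), Or.inr ⟨c, if_neg ?_⟩⟩
        rintro (⟨-, h⟩ | ⟨h, -⟩)
        · exact hpq (h.symm.trans c)
        · omega
      · refine Or.inr ⟨a, b, if_pos a, Or.inl ⟨c, if_neg ?_⟩⟩
        rintro (⟨h, -⟩ | ⟨-, h⟩)
        · omega
        · exact hpq (c.symm.trans h)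
      · exact Or.inr ⟨a, b, if_pos a, Or.inr ⟨c, if_pos (Or.inr ⟨a, c⟩)⟩⟩
    obtain ⟨i, j, hij⟩ := hij
    refine ⟨hvec fun e he => (types e he).1, i, j, fun u => ⟨?_, ?_⟩, fun e he f hf hi hj => ?_⟩
    · rintro ⟨l, hl⟩
      -- Below the pair the potential is reflected: `l p - l v = (l p + l q - l v) - l q`, which
      -- accounts for the interchange of `p` and `q`.
      refine ⟨fun v => if t + 1 ≤ k v then l v else l p + l q - l v, l, fun x => ?_⟩
      rw [hl x]
      beta_reduce
      rcases hij x x.2 with ⟨a, b, c, ⟨d, d'⟩ | ⟨d, d'⟩⟩ | ⟨a, b, c, ⟨d, d'⟩ | ⟨d, d'⟩⟩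
      · rw [c, d, d', if_pos (by omega)]
      · rw [c, d, d', if_pos (by omega)]
      · rw [c, d, d', if_neg (by omega)]
        ring
      · rw [c, d, d', if_neg (by omega)]
        ring
    · rintro ⟨a', b', hab⟩
      refine ⟨fun v => if v = p then b' p else if v = q then b' q else if t + 1 ≤ k v then a' v else
        b' p + b' q - a' v, fun x => ?_⟩
      rw [hab x]
      beta_reduce
      have hne : ∀ v, k v ≠ t → v ≠ p ∧ v ≠ q := by
        refine fun v hv => ⟨?_, ?_⟩ <;> rintro rfl <;> contradiction
      rcases hij x x.2 with ⟨a, b, c, ⟨d, d'⟩ | ⟨d, d'⟩⟩ | ⟨a, b, c, ⟨d, d'⟩ | ⟨d, d'⟩⟩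
      · have h := hne (D.tail x) (by omega)
        rw [c, d, d', if_neg h.1, if_neg h.2, if_pos (by omega), if_pos rfl]
      · have h := hne (D.tail x) (by omega)
        rw [c, d, d', if_neg h.1, if_neg h.2, if_pos (by omega), if_neg hpq.symm, if_pos rfl]
      · have h := hne (D.head x) (by omega)
        rw [c, d, d', if_pos (rfl : p = p), if_neg h.1, if_neg h.2, if_neg (by omega)]
        ring
      · have h := hne (D.head x) (by omega)
        rw [c, d, d', if_neg hpq.symm, if_pos (rfl : q = q), if_neg h.1, if_neg h.2,
          if_neg (by omega)]
        ring
    · rcases hij e he with ⟨a, b, c, d⟩ | ⟨a, b, c, d⟩ <;>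
        rcases hij f hf with ⟨a', b', c', d'⟩ | ⟨a', b', c', d'⟩ <;> rw [c, c'] at hi
      · refine hpar e he f hf hi ?_
        rcases d with d | d <;> rcases d' with d' | d' <;>
          rw [d.2, d'.2] at hj <;> rw [d.1, d'.1, hj]
      · rw [hi] at b'
        omega
      · rw [hi] at a'
        omega
      · refine hpar e he f hf ?_ hi
        rcases d with d | d <;> rcases d' with d' | d' <;>
          rw [d.2, d'.2] at hj <;> simp [d.1, d'.1, hj]
  · push Not at htwo
    -- With at most one crossed level, every edge goes from level `τ` to level `τ - 1`, so the
    -- digraph is already bipartite.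
    obtain ⟨τ, hτ⟩ : ∃ τ, ∀ e ∈ G, k (D.tail e) = τ ∧ k (D.head e) = τ - 1 := by
      rcases G.eq_empty_or_nonempty with rfl | ⟨e₀, he₀⟩
      · exact ⟨0, fun e he => absurd he (Set.notMem_empty e)⟩
      refine ⟨k (D.tail e₀), fun e he => ?_⟩
      have h0 := hstep e₀ he₀
      have h1 := hstep e he
      have key : ∀ s, k (D.head e) < s → s ≤ k (D.tail e) → s = k (D.tail e₀) := by
        intro s a b
        by_contra hne
        have := htwo s _ hne ⟨e, he, a, b⟩ e₀ he₀ (by omega)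
        omega
      have a1 := key _ (by omega) le_rfl
      have a2 := key (k (D.head e) + 1) (by omega) h1
      omega
    refine ⟨hvec fun e he => ?_, D.tail, D.head, fun u => ⟨?_, ?_⟩,
      fun e he f hf hi hj => hpar e he f hf hi hj⟩
    · have := hk e he
      have := hτ e he
      omega
    · rintro ⟨l, hl⟩
      exact ⟨l, l, hl⟩
    · rintro ⟨a, b, hab⟩
      -- Tails and heads lie on different levels, so the two functions glue to a single potential.
      refine ⟨fun v => if τ ≤ k v then a v else b v, fun x => ?_⟩
      have h1 := hτ x x.2
      have h2 : ¬ (τ ≤ k (D.head x)) := by omega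
      have h3 : τ ≤ k (D.tail x) := by omega
      simp only [h2, h3, if_true, if_false, hab x]

/-- With `i` and `j` as row and column labels, all stars are tensions and
`IsMinimalAmbiguous.bipartite` applies. Completeness and injectivity make `e ↦ (i e, j e)` a
bijection onto the edges of the complete bipartite digraph, and it matches tensions. -/
theorem Represents.exists_isIsomorphic_completeBipartite {M : OrientedMatroid α}
    (h : D.Represents M) {i j : α → V} (hw : (D.cone M.E).IsMinimalAmbiguous (vec M.E))
    (hu : ∀ u : M.E → ℤ, u ∈ D.tensions M.E ↔ ∃ a b : V → ℤ, ∀ x : M.E, u x = a (i x) - b (j x))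
    (hinj : ∀ e ∈ M.E, ∀ f ∈ M.E, i f = i e → j f = j e → f = e) :
    ∃ m n, 2 ≤ m ∧ 2 ≤ n ∧ Odd (m + n) ∧
      M.IsIsomorphic (completeBipartite m n).bondMatroid := by
  classical
  have hstar : ∀ S ⊆ M.E, (∃ a b : V → ℤ, ∀ x ∈ M.E, (vec S x : ℤ) = a (i x) - b (j x)) →
      vec S ∈ D.cone M.E := by
    rintro S hS ⟨a, b, hab⟩
    obtain ⟨k, hk⟩ := (hu fun x => vec S x).2 ⟨a, b, fun x => hab x x.2⟩
    exact ⟨⟨k, fun e he => hk ⟨e, he⟩⟩, fun e he => vec_apply_of_notMem fun h => he (hS h)⟩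
  obtain ⟨hcomp, hi2, hj2, hodd⟩ := hw.bipartite (i := i) (j := j) (cone_isSaturatedOn M.finite)
    (fun x hx => by
      obtain ⟨⟨k, hk⟩, -⟩ := hx
      obtain ⟨a, b, hab⟩ := (hu fun e => x e).1 ⟨k, fun e => hk e e.2⟩
      exact ⟨a, b, fun e he => hab ⟨e, he⟩⟩)
    (fun r => hstar _ (Set.sep_subset _ _) ⟨fun v => if v = r then 1 else 0, 0, fun x hx => by
      by_cases hr : i x = r
      · rw [vec_apply_of_mem (show x ∈ {y ∈ M.E | i y = r} from ⟨hx, hr⟩)]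
        simp [hr]
      · rw [vec_apply_of_notMem fun h => hr h.2]
        simp [hr]⟩)
    -- The value `-1` compensates for the minus sign in front of the column potential.
    (fun c => hstar _ (Set.sep_subset _ _) ⟨0, fun v => if v = c then -1 else 0, fun x hx => by
      by_cases hc : j x = c
      · rw [vec_apply_of_mem (show x ∈ {y ∈ M.E | j y = c} from ⟨hx, hc⟩)]
        simp [hc]
      · rw [vec_apply_of_notMem fun h => hc h.2]
        simp [hc]⟩)
  have := (M.finite.image i).to_subtype
  have := (M.finite.image j).to_subtype
  have ι : (i '' M.E) ≃ Fin (i '' M.E).ncard := Finite.equivFinOfCardEq rfl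
  have κ : (j '' M.E) ≃ Fin (j '' M.E).ncard := Finite.equivFinOfCardEq rfl
  refine ⟨_, _, hi2, hj2, hodd, ?_⟩
  let τ : M.E → (completeBipartite (i '' M.E).ncard (j '' M.E).ncard).bondMatroid.E := fun x =>
    ⟨(ι ⟨i x, x, x.2, rfl⟩, κ ⟨j x, x, x.2, rfl⟩), Set.mem_univ _⟩
  have hτ : Function.Bijective τ := by
    constructor
    · intro x y hxy
      have hxy' := Prod.ext_iff.1 (congrArg Subtype.val hxy)
      have h1 := congrArg Subtype.val (ι.injective hxy'.1)
      have h2 := congrArg Subtype.val (κ.injective hxy'.2)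
      exact Subtype.ext (hinj y y.2 x x.2 h1 h2)
    · rintro ⟨⟨r, c⟩, -⟩
      obtain ⟨e, he, hr⟩ := (ι.symm r).2
      obtain ⟨f, hf, hc⟩ := (κ.symm c).2
      obtain ⟨g, hg, hge, hgf⟩ := hcomp e he f hf
      refine ⟨⟨g, hg⟩, Subtype.ext (Prod.ext ?_ ?_)⟩
      · change ι _ = r
        rw [← ι.eq_symm_apply]
        exact Subtype.ext (hge.trans hr)
      · change κ _ = c
        rw [← κ.eq_symm_apply]
        exact Subtype.ext (hgf.trans hc)
  refine h.isIsomorphic (represents_bondMatroid _) (Equiv.ofBijective τ hτ) fun u => ?_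
  rw [hu]
  constructor
  · rintro ⟨a, b, hab⟩
    refine ⟨Sum.elim (fun r => a (ι.symm r)) fun c => b (κ.symm c), fun y => ?_⟩
    obtain ⟨x, rfl⟩ := hτ.2 y
    refine (hab x).trans ?_
    simp [τ, completeBipartite]
  · rintro ⟨k, hk⟩
    refine ⟨fun v => if hv : v ∈ i '' M.E then k (Sum.inl (ι ⟨v, hv⟩)) else 0,
      fun v => if hv : v ∈ j '' M.E then k (Sum.inr (κ ⟨v, hv⟩)) else 0, fun x => ?_⟩
    refine (hk (τ x)).trans ?_
    simp [τ, completeBipartite, Set.mem_image_of_mem _ x.2]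

/-! ### Induction over minors and the theorem -/

/-- An ambiguous vector yields one of the obstructions as a minor. -/
theorem Represents.exists_isGBMinor {D : MultiDigraph V α} {M : OrientedMatroid α}
    (h : D.Represents M) (hamb : ∃ w, (D.cone M.E).IsAmbiguous w) :
    ∃ N : OrientedMatroid α, N.IsGBMinor M ∧ ∃ m n, 2 ≤ m ∧ 2 ≤ n ∧ Odd (m + n) ∧
      N.IsIsomorphic (completeBipartite m n).bondMatroid := by
  induction hn : M.E.ncard using Nat.strong_induction_on generalizing D M with
  | _ n ih =>
  subst hn
  have hlt : ∀ e ∈ M.E, (M.E \ {e}).ncard < M.E.ncard := fun e he =>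
    Set.ncard_sdiff_singleton_lt_of_mem he M.finite
  have hdel : ∀ w, (D.cone M.E).IsAmbiguous w → ∀ e ∈ M.E, w e = 0 →
      ∃ N : OrientedMatroid α, N.IsGBMinor M ∧ ∃ m n, 2 ≤ m ∧ 2 ≤ n ∧ Odd (m + n) ∧
        N.IsIsomorphic (completeBipartite m n).bondMatroid := by
    intro w hw e he h0
    obtain ⟨hrep, hiff⟩ := h.delete e he
    obtain ⟨N, hN, hrest⟩ := ih _ (hlt e he) hrep ⟨w, (hiff w).2 ⟨hw, h0⟩⟩ rfl
    exact ⟨N, Relation.ReflTransGen.head ⟨e, he, Or.inl rfl⟩ hN, hrest⟩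
  have hcon : ∀ e ∈ M.E, D.IsRedundant M.E e → M.IsButterflyContractible e →
      ∃ N : OrientedMatroid α, N.IsGBMinor M ∧ ∃ m n, 2 ≤ m ∧ 2 ≤ n ∧ Odd (m + n) ∧
        N.IsIsomorphic (completeBipartite m n).bondMatroid := by
    intro e he hr hb
    obtain ⟨N, hN, hrest⟩ := ih _ (hlt e he) (h.contract e)
      ((hr.exists_isAmbiguous_iff he).2 hamb) rfl
    exact ⟨N, Relation.ReflTransGen.head ⟨e, he, Or.inr ⟨hb, rfl⟩⟩ hN, hrest⟩
  by_contra hno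
  have hzero : ∀ x, (D.cone M.E).IsAmbiguous x → ∀ e ∈ M.E, x e ≠ 0 := fun x hx e he h0 =>
    hno (hdel x hx e he h0)
  obtain ⟨w₀, hw₀⟩ := hamb
  obtain ⟨w, hw⟩ := (cone_isSaturatedOn M.finite).exists_isMinimalAmbiguous hw₀
  -- Every vector of the cone vanishes on a loop, whereas `w` has full support.
  have hloop : ∀ e ∈ M.E, D.tail e ≠ D.head e := by
    intro e he heq
    obtain ⟨k, hk⟩ := hw.mem.1
    have := hk e he
    rw [heq, sub_self] at this
    exact hzero w hw.isAmbiguous e he (by exact_mod_cast this)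
  obtain ⟨rfl, i, j, hu, hinj⟩ := exists_bipartite_labelling M.finite hw hzero
    (fun e he f hf ht hh => by
      by_contra hne
      exact hno (hcon e he (isRedundant_of_parallel hf hne ht hh)
        (h.isButterflyContractible_of_parallel he hf hne ht hh (hloop e he))))
    (fun e he f hf g hg htf hfg hhg => by
      have hfe : f ≠ e := by
        rintro rfl
        exact hloop g hg (hfg.symm.trans hhg.symm)
      have hge : g ≠ e := by
        rintro rfl
        exact hloop f hf (htf.trans hfg.symm)
      exact hno (hcon e he (isRedundant_of_triangle hf hg hfe hge htf hfg hhg)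
        (h.isButterflyContractible_of_triangle he hf hg htf hfg hhg (hloop e he) (hloop f hf)
          (hloop g hg))))
  exact hno ⟨M, Relation.ReflTransGen.refl, h.exists_isIsomorphic_completeBipartite hw hu hinj⟩

/-- Minors of represented oriented matroids are represented, and ambiguity passes from a minor to
the original oriented matroid. -/
theorem Represents.of_isGBMinor {M N : OrientedMatroid α} (h : D.Represents M)
    (hN : N.IsGBMinor M) : ∃ D' : MultiDigraph V α, D'.Represents N ∧
      ((∃ w, (D'.cone N.E).IsAmbiguous w) → ∃ w, (D.cone M.E).IsAmbiguous w) := by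
  induction hN with
  | refl => exact ⟨D, h, id⟩
  | tail _ hstep ih =>
    obtain ⟨D', h', hamb⟩ := ih
    obtain ⟨e, he, rfl | ⟨hb, rfl⟩⟩ := hstep
    · obtain ⟨hrep, hiff⟩ := h'.delete e he
      exact ⟨_, hrep, fun ⟨w, hw⟩ => hamb ⟨w, ((hiff w).1 hw).1⟩⟩
    · exact ⟨D', h'.contract e, fun hw =>
        hamb (((h'.isRedundant he hb).exists_isAmbiguous_iff he).1 hw)⟩

end

end MultiDigraph

theorem mainTheorem1 {α : Type u} (M : OrientedMatroid α)
    (hM : M.IsOrientedBondMatroid) :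
    OrientedMatroid.IsNonEven.{u, w} M ↔
      ∀ N : OrientedMatroid α, N.IsGBMinor M → ∀ m n : ℕ, 2 ≤ m → 2 ≤ n → Odd (m + n) →
        ¬ N.IsIsomorphic (MultiDigraph.completeBipartite m n).bondMatroid := by
  obtain ⟨V, D, hD⟩ := MultiDigraph.exists_represents hM
  constructor
  · rintro ⟨-, hJ⟩ N hN m n hm hn hodd hiso
    obtain ⟨D', hD', hamb⟩ := hD.of_isGBMinor hN
    refine MultiDigraph.not_exists_odd_of_isIsomorphic_completeBipartite hm hn hodd hiso ?_
    rw [hD'.exists_odd_iff]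
    intro w hw
    obtain ⟨w', hw'⟩ := hamb ⟨w, hw⟩
    exact hD.exists_odd_iff.1 hJ w' hw'
  · intro hno
    refine ⟨hD.isRegular, hD.exists_odd_iff.2 fun w hw => ?_⟩
    obtain ⟨N, hN, m, n, hm, hn, hodd, hiso⟩ := hD.exists_isGBMinor ⟨w, hw⟩
    exact hno N hN m n hm hn hodd hiso
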